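/- **Theorem (Coulomb–Sobolev interpolation inequality).** Let $N\in\mathbb N$, $N\ge 1$, $\alpha\in(0,N)$ and $p,q\in[1,+\infty)$. For $\beta\in(0,N)$ let $$I_\beta(x)=\frac{A_\beta}{|x|^{N-\beta}},\qquad A_\beta=\frac{\Gamma(\frac{N-\beta}{2})}{\Gamma(\frac{\beta}{2})\,\pi^{N/2}\,2^{\beta}},$$ be the Riesz kernel on $\mathbb R^N$. The Coulomb–Sobolev space $E^{\alpha,p}(\mathbb R^N)$ is the vector space (modulo equality almost everywhere) of measurable, weakly differentiable functions $u:\mathbb R^N\to\mathbb R$ such that $\int_{\mathbb R^N}|I_{\alpha/2}*|u|^p|^2<\infty$ and $Du\in L^2(\mathbb R^N)$, with the norm $$\|u\|_{E^{\alpha,p}}=\Bigl(\int_{\mathbb R^N}|Du|^2+\Bigl(\int_{\mathbb R^N}\bigl|I_{\alpha/2}*|u|^p\bigr|^2\Bigr)^{1/p}\Bigr)^{1/2}.$$ (i) The space $E^{\alpha,p}(\mathbb R^N)$ is continuously embedded in $L^q(\mathbb R^N)$ if and only if $$(\mathcal Q)\qquad \begin{aligned} \text{either}\quad&\frac1p\ge\frac{(N-2)_+}{N+\alpha}\quad\text{and}\quad\frac12-\frac1N\le\frac1q\le\frac12-\frac{p-1}{\alpha+2p},\\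 \text{or}\quad&\frac1p<\frac{(N-2)_+}{N+\alpha}\quad\text{and}\quad\frac12-\frac1N\ge\frac1q\ge\frac12-\frac{p-1}{\alpha+2p}. \end{aligned}$$ (ii) If $(\mathcal Q)$ holds and $\alpha+N\ne p(N-2)$, then there exists $S=S(N,\alpha,p,q)>0$ such that for every $u\in E^{\alpha,p}(\mathbb R^N)$ $$S\Bigl(\int_{\mathbb R^N}|u|^q\Bigr)^{\frac1q}\le\Bigl(\int_{\mathbb R^N}|Du|^2\Bigr)^{\frac\theta2}\Bigl(\int_{\mathbb R^N}\bigl|I_{\alpha/2}*|u|^p\bigr|^2\Bigr)^{\frac{1-\theta}{2p}},$$ where $\theta$ is the number determined by $$\frac1q=\theta\Bigl(\frac12-\frac1N\Bigr)+(1-\theta)\frac{N+\alpha}{2Np},$$ which satisfies $\frac{\alpha}{2p+\alpha}\le\theta\le1$ if $N\ge2$, and $\frac{\alpha}{2p+\alpha}\le\theta<\frac{1+\alpha}{1+\alpha+p}$ if $N=1$. (iii) If $N\ge3$, then there exists $C=C(N,\alpha)>0$ such that, for the exponent $p=\frac{N+\alpha}{N-2}$ (that is, $\alpha+N=p(N-2)$)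 and every $u\in E^{\alpha,\frac{N+\alpha}{N-2}}(\mathbb R^N)$, $$C\int_{\mathbb R^N}|u|^{\frac{2N}{N-2}}\le\Bigl(\int_{\mathbb R^N}|Du|^2\Bigr)^{\frac{\alpha}{2+\alpha}}\Bigl(\int_{\mathbb R^N}\bigl|I_{\alpha/2}*|u|^{\frac{N+\alpha}{N-2}}\bigr|^2\Bigr)^{\frac{2}{2+\alpha}}.$$ -/

import Mathlib

open MeasureTheory Real
open scoped ENNReal NNReal ContDiff

noncomputable section

namespace CoulombSobolev

/-- The Riesz kernel `I_β(x) = A_β / |x|^(N-β)` on `ℝ^N`, with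
`A_β = Γ((N-β)/2) / (Γ(β/2) π^(N/2) 2^β)`. -/
def rieszKernel (N : ℕ) (β : ℝ) (x : EuclideanSpace ℝ (Fin N)) : ℝ :=
  Gamma (((N : ℝ) - β) / 2) / (Gamma (β / 2) * π ^ ((N : ℝ) / 2) * 2 ^ β)
    * ‖x‖ ^ (β - (N : ℝ))

/-- The Riesz potential `(I_β * |u|^p)(x) ∈ [0, ∞]`. -/
def rieszPotential {N : ℕ} (β p : ℝ) (u : EuclideanSpace ℝ (Fin N) → ℝ)
    (x : EuclideanSpace ℝ (Fin N)) : ℝ≥0∞ :=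
  ∫⁻ y, ENNReal.ofReal (rieszKernel N β (x - y)) * ‖u y‖ₑ ^ p

/-- The Coulomb energy `∫ |I_{α/2} * |u|^p|² ∈ [0, ∞]`. -/
def coulombEnergy {N : ℕ} (α p : ℝ) (u : EuclideanSpace ℝ (Fin N) → ℝ) : ℝ≥0∞ :=
  ∫⁻ x, rieszPotential (α / 2) p u x ^ 2

/-- The Coulomb space `Q^{α,p}(ℝ^N)`. -/
def coulombSpace (N : ℕ) (α p : ℝ) : Set (EuclideanSpace ℝ (Fin N) → ℝ) :=
  {u | AEStronglyMeasurable u volume ∧ coulombEnergy α p u < ⊤}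

/-- `G` is a weak gradient of `u` on `ℝ^N`: both are locally integrable and
`∫ u ∂ᵢφ = - ∫ Gᵢ φ` for every test function `φ ∈ C_c^∞(ℝ^N)` and every `i`. -/
structure HasWeakGradient {N : ℕ} (u : EuclideanSpace ℝ (Fin N) → ℝ)
    (G : EuclideanSpace ℝ (Fin N) → EuclideanSpace ℝ (Fin N)) : Prop where
  locallyIntegrable : LocallyIntegrable u volume
  locallyIntegrable_grad : LocallyIntegrable G volume
  integral_eq : ∀ φ : EuclideanSpace ℝ (Fin N) → ℝ, ContDiff ℝ ∞ φ → HasCompactSupport φ →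
    ∀ i : Fin N, ∫ x, u x * fderiv ℝ φ x (EuclideanSpace.single i 1) = - ∫ x, G x i * φ x

/-- `u` is weakly differentiable on `ℝ^N`. -/
def WeaklyDifferentiable {N : ℕ} (u : EuclideanSpace ℝ (Fin N) → ℝ) : Prop :=
  ∃ G, HasWeakGradient u G

open Classical in
/-- The weak gradient `Du` of a weakly differentiable function
(unique up to null sets, see `HasWeakGradient.ae_eq`). -/
def weakGradient {N : ℕ} (u : EuclideanSpace ℝ (Fin N) → ℝ) :
    EuclideanSpace ℝ (Fin N) → EuclideanSpace ℝ (Fin N) :=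
  if h : WeaklyDifferentiable u then h.choose else 0

theorem hasWeakGradient_weakGradient {N : ℕ} {u : EuclideanSpace ℝ (Fin N) → ℝ}
    (h : WeaklyDifferentiable u) : HasWeakGradient u (weakGradient u) := by
  rw [weakGradient, dif_pos h]
  exact h.choose_spec

theorem HasWeakGradient.ae_eq {N : ℕ} {u : EuclideanSpace ℝ (Fin N) → ℝ}
    {G G' : EuclideanSpace ℝ (Fin N) → EuclideanSpace ℝ (Fin N)}
    (h : HasWeakGradient u G) (h' : HasWeakGradient u G') : G =ᵐ[volume] G' := by
  have key : ∀ {F : EuclideanSpace ℝ (Fin N) → EuclideanSpace ℝ (Fin N)} (i : Fin N),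
      LocallyIntegrable F volume → LocallyIntegrable (fun x => F x i) volume := by
    intro F i hF x
    obtain ⟨s, hs, hint⟩ := hF x
    exact ⟨s, hs, (EuclideanSpace.proj (𝕜 := ℝ) i).integrable_comp hint⟩
  have : ∀ᵐ x, ∀ i, G x i = G' x i := by
    rw [ae_all_iff]
    intro i
    refine ae_eq_of_integral_contDiff_smul_eq (key i h.locallyIntegrable_grad)
      (key i h'.locallyIntegrable_grad) fun φ hφ hc => ?_
    have e := (h.integral_eq φ hφ hc i).symm.trans (h'.integral_eq φ hφ hc i)
    simpa only [smul_eq_mul, mul_comm] using neg_injective e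
  filter_upwards [this] with x hx
  ext i
  exact hx i

/-- The Dirichlet energy `∫ |Du|² ∈ [0, ∞]`, for weakly differentiable `u`. -/
def dirichletEnergy {N : ℕ} (u : EuclideanSpace ℝ (Fin N) → ℝ) : ℝ≥0∞ :=
  ∫⁻ x, ‖weakGradient u x‖ₑ ^ 2

/-- The Coulomb–Sobolev space `E^{α,p}(ℝ^N)`: the `u ∈ Q^{α,p}(ℝ^N)` that are weakly
differentiable with `Du ∈ L²(ℝ^N)`. -/
def coulombSobolevSpace (N : ℕ) (α p : ℝ) : Set (EuclideanSpace ℝ (Fin N) → ℝ) :=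
  {u | u ∈ coulombSpace N α p ∧ WeaklyDifferentiable u ∧ MemLp (weakGradient u) 2 volume}

/-- The norm `(∫ |Du|² + (∫ |I_{α/2} * |u|^p|²)^(1/p))^(1/2)` of `E^{α,p}(ℝ^N)`. -/
def coulombSobolevNorm {N : ℕ} (α p : ℝ) (u : EuclideanSpace ℝ (Fin N) → ℝ) : ℝ≥0∞ :=
  (dirichletEnergy u + coulombEnergy α p u ^ (1 / p)) ^ (1 / 2 : ℝ)

/-- `E^{α,p}(ℝ^N)` is continuously embedded in `L^q(ℝ^N)`: it is contained in `L^q(ℝ^N)` and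
the (linear) inclusion is bounded. -/
def ContinuouslyEmbedded (N : ℕ) (α p q : ℝ) : Prop :=
  ∃ C : ℝ≥0, ∀ u ∈ coulombSobolevSpace N α p,
    MemLp u (ENNReal.ofReal q) volume ∧
      eLpNorm u (ENNReal.ofReal q) volume ≤ C * coulombSobolevNorm α p u

/-- The condition (Q) on the exponents. -/
def ConditionQ (N : ℕ) (α p q : ℝ) : Prop :=
  (1 / p ≥ max ((N : ℝ) - 2) 0 / (N + α) ∧
    1 / 2 - 1 / (N : ℝ) ≤ 1 / q ∧ 1 / q ≤ 1 / 2 - (p - 1) / (α + 2 * p)) ∨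
  (1 / p < max ((N : ℝ) - 2) 0 / (N + α) ∧
    1 / 2 - 1 / (N : ℝ) ≥ 1 / q ∧ 1 / q ≥ 1 / 2 - (p - 1) / (α + 2 * p))

end CoulombSobolev

end

/-! Sufficiency rests on pointwise bounds for u by its mollifications. Fix x and let U(r) be the
average of u near x against a smooth bump of radius r, so that U(r) → u(x) for almost every x as r →
0. The r-derivative of the scaled bump is the divergence of a field supported in the ball of radius
r, so |U'(r)| is at most a constant times the average of |Du| over that ball. It is therefore
bounded by the maximal function M of |Du| at x, and also, by Jensen, by ‖Du‖₂ r^(-N/2)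
(`exists_abs_deriv_mollify_le_gradMax`). Conversely, the Riesz kernel is bounded below on balls, so
|U(r)| ≤ C V(x)^(1/p) r^(-α/(2p)) with V the Riesz potential of |u|^p, and |U(r)| is at most a power
of the Coulomb energy times r^(-(α+N)/(2p)) (`exists_abs_mollify_le_rieszPotential`). A derivative
bound near 0 and a decay bound, balanced by the choice of r, control |u(x)| by a product
(`abs_le_of_deriv_bound_of_decay`).

The bounds by M and V give |u| ≤ C M^(α/(2p+α)) V^(2/(2p+α)). Hölder and the L² boundedness of M
turn this into the estimate at one end of (Q), on the critical line as well, which is (iii). The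
other end is Sobolev's inequality for N ≥ 3, where the decay comes from Du itself, and a family with
arbitrarily large q for N ≤ 2. Along the line relating 1/q and θ, everything in between follows by
Hölder.

Necessity is tested on x ↦ A v(l x), where v is a sum of m translates of one bump. The Dirichlet
energy and the L^q integral of v are exactly m times those of the bump, and far apart translates
have Coulomb energy at most a fixed multiple of m. Dilating a single bump gives the Sobolev side of
(Q). Letting m → ∞ with A and l chosen to keep both energies bounded gives the other side. -/

namespace CoulombSobolev

/-! ### The Hardy–Littlewood maximal function: weak type (1,1) and the L² bound. -/

section MaximalFunction

open Set Metric

variable {E : Type*} [NormedAddCommGroup E] [NormedSpace ℝ E] [MeasurableSpace E] [BorelSpace E]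
  [FiniteDimensional ℝ E]

/-- The centred Hardy–Littlewood maximal function over balls of dyadic radius. -/
noncomputable def maximalFunction (μ : Measure E) (g : E → ℝ≥0∞) (x : E) : ℝ≥0∞ :=
  ⨆ k : ℤ, (μ (closedBall x ((2 : ℝ) ^ k)))⁻¹ * ∫⁻ y in closedBall x ((2 : ℝ) ^ k), g y ∂μ

variable (μ : Measure E) [μ.IsAddHaarMeasure]

set_option linter.unusedSectionVars false

theorem measurable_setLIntegral_closedBall {g : E → ℝ≥0∞} (hg : Measurable g) (r : ℝ) :
    Measurable fun x => ∫⁻ y in closedBall x r, g y ∂μ := by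
  have h : ∀ x, ∫⁻ y in closedBall x r, g y ∂μ
      = ∫⁻ y, {z : E × E | dist z.2 z.1 ≤ r}.indicator (fun z => g z.2) (x, y) ∂μ := by
    intro x
    rw [← lintegral_indicator measurableSet_closedBall]
    rfl
  simp_rw [h]
  refine Measurable.lintegral_prod_right' (ν := μ) ?_
  refine (hg.comp measurable_snd).indicator ?_
  exact (isClosed_le (by fun_prop) continuous_const).measurableSet

/-- Restricting to dyadic radii makes the supremum countable, which is what measurability needs. -/
theorem measurable_maximalFunction {g : E → ℝ≥0∞} (hg : Measurable g) :
    Measurable (maximalFunction μ g) := by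
  refine Measurable.iSup fun k => ?_
  have : ∀ x : E, μ (closedBall x ((2 : ℝ) ^ k)) = μ (closedBall 0 ((2 : ℝ) ^ k)) := fun x => by
    rw [Measure.addHaar_closedBall_center]
  simp_rw [this]
  exact (measurable_setLIntegral_closedBall μ hg _).const_mul _

theorem maximalFunction_congr {g h : E → ℝ≥0∞} (hgh : g =ᵐ[μ] h) :
    maximalFunction μ g = maximalFunction μ h := by
  funext x
  simp only [maximalFunction]
  congr! 3 with k
  exact lintegral_congr_ae (ae_restrict_of_ae hgh)

theorem addHaar_closedBall_mul_radius (x y : E) {a r : ℝ} (ha : 0 ≤ a) (hr : 0 ≤ r) :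
    μ (closedBall x (a * r)) = ENNReal.ofReal (a ^ Module.finrank ℝ E) * μ (closedBall y r) := by
  rw [Measure.addHaar_closedBall μ x (mul_nonneg ha hr), Measure.addHaar_closedBall μ y hr, mul_pow,
    ENNReal.ofReal_mul (by positivity), mul_assoc]

/-- The weak type `(1, 1)` estimate. -/
theorem mul_meas_lt_maximalFunction_le [Nontrivial E] (g : E → ℝ≥0∞) (t : ℝ≥0∞) :
    t * μ {x | t < maximalFunction μ g x}
      ≤ ENNReal.ofReal (4 ^ Module.finrank ℝ E) * ∫⁻ y, g y ∂μ := by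
  rcases eq_or_ne t 0 with rfl | ht0
  · simp
  rcases eq_or_ne t ⊤ with rfl | htt
  · simp
  rcases eq_or_ne (∫⁻ y, g y ∂μ) ⊤ with hG | hG
  · rw [hG, ENNReal.mul_top (by simp)]
    exact le_top
  set S := {x | t < maximalFunction μ g x}
  have h1 : ∀ x : E, ∃ k : ℤ, x ∈ S →
      t * μ (closedBall x ((2 : ℝ) ^ k)) ≤ ∫⁻ y in closedBall x ((2 : ℝ) ^ k), g y ∂μ := by
    intro x
    by_cases hx : x ∈ S
    · obtain ⟨k, hk⟩ := lt_iSup_iff.1 (show t < ⨆ k : ℤ, _ from hx)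
      refine ⟨k, fun _ => ?_⟩
      rw [mul_comm, ← div_eq_mul_inv] at hk
      exact ENNReal.mul_le_of_le_div hk.le
    · exact ⟨0, fun h => absurd h hx⟩
  choose k hk using h1
  have hpos : ∀ x, (0 : ℝ) < 2 ^ k x := fun x => by positivity
  have hd : 0 < Module.finrank ℝ E := Module.finrank_pos
  have hball : μ (ball (0 : E) 1) ≠ 0 := (measure_ball_pos μ 0 one_pos).ne'
  have hballt : μ (ball (0 : E) 1) ≠ ⊤ := measure_ball_lt_top.ne
  -- Vitali's lemma requires bounded radii. A selected ball has measure at most ∫ g / t, so `R`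
  -- bounds the radius to the power of the dimension; the maximum with 1 covers small radii, for
  -- which that power is no upper bound for the radius.
  set R := ((∫⁻ y, g y ∂μ) / (t * μ (ball (0 : E) 1))).toReal with hR
  have hRad : ∀ x ∈ S, (2 : ℝ) ^ k x ≤ max 1 R := by
    intro x hx
    have h2 := (hk x hx).trans (setLIntegral_le_lintegral _ _)
    rw [Measure.addHaar_closedBall μ x (hpos x).le] at h2
    have h3 : ENNReal.ofReal (((2 : ℝ) ^ k x) ^ Module.finrank ℝ E)
        ≤ (∫⁻ y, g y ∂μ) / (t * μ (ball (0 : E) 1)) := by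
      rw [ENNReal.le_div_iff_mul_le (Or.inl (mul_ne_zero ht0 hball))
        (Or.inl (ENNReal.mul_ne_top htt hballt))]
      refine le_trans (le_of_eq ?_) h2
      ring
    have h4 : ((2 : ℝ) ^ k x) ^ Module.finrank ℝ E ≤ R := by
      rw [hR]
      rwa [ENNReal.ofReal_le_iff_le_toReal] at h3
      exact (ENNReal.div_lt_top hG (mul_ne_zero ht0 hball)).ne
    rcases le_total ((2 : ℝ) ^ k x) 1 with h5 | h5
    · exact h5.trans (le_max_left _ _)
    · exact ((le_self_pow₀ h5 hd.ne').trans h4).trans (le_max_right _ _)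
  -- Any enlargement factor above 3 is admissible; 4 produces the constant 4^d.
  obtain ⟨u, huS, hdisj, hcov⟩ := Vitali.exists_disjoint_subfamily_covering_enlargement_closedBall
    S (fun x => x) (fun x => (2 : ℝ) ^ k x) (max 1 R) hRad 4 (by norm_num)
  have hcount : u.Countable := hdisj.countable_of_nonempty_interior fun x _ =>
    ⟨x, ball_subset_interior_closedBall (mem_ball_self (hpos x))⟩
  have hsub : S ⊆ ⋃ x ∈ u, closedBall x (4 * 2 ^ k x) := by
    intro x hx
    obtain ⟨b, hb, hsb⟩ := hcov x hx
    exact mem_biUnion hb (hsb (mem_closedBall_self (hpos x).le))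
  calc t * μ S ≤ t * ∑' x : u, μ (closedBall (x : E) (4 * 2 ^ k x)) := by
        gcongr
        exact (measure_mono hsub).trans (measure_biUnion_le _ hcount _)
    _ = ENNReal.ofReal (4 ^ Module.finrank ℝ E)
          * ∑' x : u, t * μ (closedBall (x : E) (2 ^ k x)) := by
        rw [← ENNReal.tsum_mul_left, ← ENNReal.tsum_mul_left]
        congr! 2 with x
        rw [addHaar_closedBall_mul_radius μ (x : E) (x : E) (by norm_num) (hpos x).le]
        ring
    _ ≤ ENNReal.ofReal (4 ^ Module.finrank ℝ E)
          * ∑' x : u, ∫⁻ y in closedBall (x : E) (2 ^ k x), g y ∂μ := by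
        gcongr with x
        exact hk x (huS x.2)
    _ = ENNReal.ofReal (4 ^ Module.finrank ℝ E)
          * ∫⁻ y in ⋃ x ∈ u, closedBall x (2 ^ k x), g y ∂μ := by
        rw [lintegral_biUnion hcount (fun _ _ => measurableSet_closedBall) hdisj]
    _ ≤ _ := by
        gcongr
        exact Measure.restrict_le_self

/-- Truncation at height t: the part of g below t has averages at most t. It allows the weak type
bound to be applied only to the part of g above s/2. -/
theorem maximalFunction_le_add (g : E → ℝ≥0∞) (t : ℝ≥0∞) (x : E) :
    maximalFunction μ g x ≤ maximalFunction μ ({y | t < g y}.indicator g) x + t := by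
  refine iSup_le fun k => ?_
  have hpos : (0 : ℝ) < 2 ^ k := by positivity
  set B := closedBall x ((2 : ℝ) ^ k)
  have hB0 : μ B ≠ 0 := (measure_closedBall_pos μ x hpos).ne'
  have hBt : μ B ≠ ⊤ := measure_closedBall_lt_top.ne
  calc (μ B)⁻¹ * ∫⁻ y in B, g y ∂μ
      ≤ (μ B)⁻¹ * ∫⁻ y in B, ({y | t < g y}.indicator g y + t) ∂μ := by
        gcongr with y
        by_cases hy : t < g y
        · rw [indicator_of_mem (show y ∈ {y | t < g y} from hy)]
          exact le_self_add
        · exact (not_lt.1 hy).trans le_add_self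
    _ = (μ B)⁻¹ * ∫⁻ y in B, {y | t < g y}.indicator g y ∂μ + t := by
        rw [lintegral_add_right _ measurable_const, mul_add, setLIntegral_const, mul_comm t,
          ← mul_assoc, ENNReal.inv_mul_cancel hB0 hBt, one_mul]
    _ ≤ _ := by
        gcongr
        exact le_iSup (fun k : ℤ => (μ (closedBall x ((2 : ℝ) ^ k)))⁻¹ *
          ∫⁻ y in closedBall x ((2 : ℝ) ^ k), {y | t < g y}.indicator g y ∂μ) k

theorem volume_Ioi_inter_ofReal_lt (a : ℝ≥0∞) :
    volume {s : ℝ | s ∈ Ioi (0 : ℝ) ∧ ENNReal.ofReal s < a} = a := by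
  rcases eq_or_ne a ⊤ with rfl | ha
  · have : {s : ℝ | s ∈ Ioi (0 : ℝ) ∧ ENNReal.ofReal s < ⊤} = Ioi 0 := by
      ext s; simp
    rw [this, Real.volume_Ioi]
  · have : {s : ℝ | s ∈ Ioi (0 : ℝ) ∧ ENNReal.ofReal s < a} = Ioo 0 a.toReal := by
      ext s
      simp only [mem_Ioi, mem_ofPred_eq, mem_Ioo, and_congr_right_iff]
      intro hs
      rw [ENNReal.ofReal_lt_iff_lt_toReal hs.le ha]
    rw [this, Real.volume_Ioo, sub_zero, ENNReal.ofReal_toReal ha]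

/-- The layer-cake formula for a single value, in a form ready for Tonelli. The value ∞ is reached
by comparison with the finite values (r+1)² ≥ r. -/
theorem sq_eq_lintegral_Ioi_indicator (a : ℝ≥0∞) :
    a ^ 2 = ∫⁻ s in Ioi (0 : ℝ), {s : ℝ | ENNReal.ofReal s < a}.indicator
      (fun s => ENNReal.ofReal (2 * s)) s := by
  have key : ∀ b : ℝ, 0 ≤ b → ∫⁻ s in Ioo 0 b, ENNReal.ofReal (2 * s) = ENNReal.ofReal (b ^ 2) := by
    intro b hb
    rw [← ofReal_integral_eq_lintegral_ofReal, ← integral_Ioc_eq_integral_Ioo,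
      ← intervalIntegral.integral_of_le hb]
    · rw [intervalIntegral.integral_const_mul, integral_id]
      congr 1; ring
    · exact (Continuous.integrableOn_Icc (by fun_prop)).mono_set Ioo_subset_Icc_self
    · filter_upwards [ae_restrict_mem measurableSet_Ioo] with s hs
      have := hs.1
      simp only [Pi.zero_apply]; positivity
  have hind : ∀ a : ℝ≥0∞, ∫⁻ s in Ioi (0 : ℝ), {s : ℝ | ENNReal.ofReal s < a}.indicator
      (fun s => ENNReal.ofReal (2 * s)) s
      = ∫⁻ s in {s : ℝ | s ∈ Ioi (0 : ℝ) ∧ ENNReal.ofReal s < a}, ENNReal.ofReal (2 * s) := by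
    intro a
    rw [lintegral_indicator (measurableSet_lt (by fun_prop) measurable_const),
      Measure.restrict_restrict (measurableSet_lt (by fun_prop) measurable_const)]
    congr 2
    ext s; simp [and_comm]
  have hfin : ∀ a : ℝ≥0∞, a ≠ ⊤ → a ^ 2 = ∫⁻ s in Ioi (0 : ℝ),
      {s : ℝ | ENNReal.ofReal s < a}.indicator (fun s => ENNReal.ofReal (2 * s)) s := by
    intro a ha
    rw [hind]
    have : {s : ℝ | s ∈ Ioi (0 : ℝ) ∧ ENNReal.ofReal s < a} = Ioo 0 a.toReal := by
      ext s
      simp only [mem_Ioi, mem_ofPred_eq, mem_Ioo, and_congr_right_iff]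
      intro hs
      rw [ENNReal.ofReal_lt_iff_lt_toReal hs.le ha]
    rw [this, key _ ENNReal.toReal_nonneg, ENNReal.ofReal_pow ENNReal.toReal_nonneg,
      ENNReal.ofReal_toReal ha]
  rcases eq_or_ne a ⊤ with rfl | ha
  · symm
    rw [ENNReal.top_pow (by norm_num)]
    refine ENNReal.eq_top_of_forall_nnreal_le fun r => ?_
    have hr : (r : ℝ≥0∞) ≤ ((r + 1 : ℝ≥0) : ℝ≥0∞) ^ 2 := by
      rw [← ENNReal.coe_pow, ENNReal.coe_le_coe, ← NNReal.coe_le_coe]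
      push_cast
      nlinarith [r.coe_nonneg, sq_nonneg (r : ℝ)]
    refine hr.trans ?_
    rw [hfin _ ENNReal.coe_ne_top]
    refine lintegral_mono fun s => indicator_le_indicator_of_subset ?_ (fun _ => bot_le) s
    intro s hs
    exact ENNReal.ofReal_lt_top
  · exact hfin a ha

/-- The maximal function is bounded on `L²`. -/
theorem lintegral_maximalFunction_sq_le [Nontrivial E] {g : E → ℝ≥0∞} (hg : AEMeasurable g μ) :
    ∫⁻ x, maximalFunction μ g x ^ 2 ∂μ
      ≤ 8 * ENNReal.ofReal (4 ^ Module.finrank ℝ E) * ∫⁻ x, g x ^ 2 ∂μ := by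
  wlog hgm : Measurable g generalizing g
  · rw [maximalFunction_congr μ hg.ae_eq_mk]
    refine (this hg.measurable_mk.aemeasurable hg.measurable_mk).trans (le_of_eq ?_)
    congr 1
    refine lintegral_congr_ae ?_
    filter_upwards [hg.ae_eq_mk] with x hx
    rw [hx]
  set c := ENNReal.ofReal (4 ^ Module.finrank ℝ E)
  have hM := measurable_maximalFunction μ hgm
  have hm1 : Measurable fun z : E × ℝ =>
      {w : E × ℝ | ENNReal.ofReal w.2 < maximalFunction μ g w.1}.indicator
        (fun w => ENNReal.ofReal (2 * w.2)) z :=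
    Measurable.indicator (by fun_prop) (measurableSet_lt (by fun_prop) (hM.comp measurable_fst))
  have hm2 : Measurable fun z : ℝ × E =>
      {w : ℝ × E | ENNReal.ofReal (w.1 / 2) < g w.2}.indicator (fun w => g w.2) z :=
    Measurable.indicator (hgm.comp measurable_snd)
      (measurableSet_lt (by fun_prop) (hgm.comp measurable_snd))
  -- Where the maximal function exceeds s, that of g truncated at s/2 exceeds s/2. The factor 4 is
  -- 2s divided by s/2; integrating in s over {s/2 < g(y)}, of length 2 g(y), gives the remaining
  -- factor 2 of the constant 8.
  have hweak : ∀ s ∈ Ioi (0 : ℝ), ENNReal.ofReal (2 * s) *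
      μ {x | ENNReal.ofReal s < maximalFunction μ g x}
      ≤ 4 * c * ∫⁻ y, {y | ENNReal.ofReal (s / 2) < g y}.indicator g y ∂μ := by
    intro s hs
    have h2 : ENNReal.ofReal s = ENNReal.ofReal (s / 2) + ENNReal.ofReal (s / 2) := by
      have hs' : (0 : ℝ) < s := hs
      rw [← ENNReal.ofReal_add (by positivity) (by positivity)]; congr 1; ring
    have hsub : {x | ENNReal.ofReal s < maximalFunction μ g x} ⊆
        {x | ENNReal.ofReal (s / 2) < maximalFunction μ
          ({y | ENNReal.ofReal (s / 2) < g y}.indicator g) x} := by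
      intro x hx
      have h3 := lt_of_lt_of_le (show ENNReal.ofReal s < maximalFunction μ g x from hx)
        (maximalFunction_le_add μ g (ENNReal.ofReal (s / 2)) x)
      rw [h2] at h3
      exact lt_of_add_lt_add_right h3
    have h4 := mul_meas_lt_maximalFunction_le μ
      ({y | ENNReal.ofReal (s / 2) < g y}.indicator g) (ENNReal.ofReal (s / 2))
    have h5 : ENNReal.ofReal (2 * s) = 4 * ENNReal.ofReal (s / 2) := by
      have hs' : (0 : ℝ) < s := hs
      rw [show (4 : ℝ≥0∞) = ENNReal.ofReal 4 by simp, ← ENNReal.ofReal_mul (by norm_num)]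
      congr 1; ring
    rw [h5, mul_assoc, mul_assoc]
    exact mul_le_mul' le_rfl (le_trans (mul_le_mul' le_rfl (measure_mono hsub)) h4)
  calc ∫⁻ x, maximalFunction μ g x ^ 2 ∂μ
      = ∫⁻ x, (∫⁻ s in Ioi (0 : ℝ), {s : ℝ | ENNReal.ofReal s < maximalFunction μ g x}.indicator
          (fun s => ENNReal.ofReal (2 * s)) s) ∂μ := by
        simp_rw [← sq_eq_lintegral_Ioi_indicator]
    _ = ∫⁻ s in Ioi (0 : ℝ), ∫⁻ x, {s : ℝ | ENNReal.ofReal s < maximalFunction μ g x}.indicator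
          (fun s => ENNReal.ofReal (2 * s)) s ∂μ :=
        lintegral_lintegral_swap hm1.aemeasurable
    _ = ∫⁻ s in Ioi (0 : ℝ), ENNReal.ofReal (2 * s) *
          μ {x | ENNReal.ofReal s < maximalFunction μ g x} := by
        refine lintegral_congr fun s => ?_
        have : ∀ x, {s : ℝ | ENNReal.ofReal s < maximalFunction μ g x}.indicator
            (fun s => ENNReal.ofReal (2 * s)) s
            = {x | ENNReal.ofReal s < maximalFunction μ g x}.indicator
              (fun _ => ENNReal.ofReal (2 * s)) x := fun x => rfl
        simp_rw [this]
        rw [lintegral_indicator_const (measurableSet_lt measurable_const hM)]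
    _ ≤ ∫⁻ s in Ioi (0 : ℝ), 4 * c *
          ∫⁻ y, {y | ENNReal.ofReal (s / 2) < g y}.indicator g y ∂μ :=
        setLIntegral_mono' measurableSet_Ioi hweak
    _ = 4 * c * ∫⁻ s in Ioi (0 : ℝ),
          ∫⁻ y, {y | ENNReal.ofReal (s / 2) < g y}.indicator g y ∂μ :=
        lintegral_const_mul _ hm2.lintegral_prod_right'
    _ = 4 * c * ∫⁻ y, (∫⁻ s in Ioi (0 : ℝ),
          {y | ENNReal.ofReal (s / 2) < g y}.indicator g y) ∂μ := by
        rw [lintegral_lintegral_swap hm2.aemeasurable]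
    _ = 4 * c * ∫⁻ y, 2 * g y ^ 2 ∂μ := by
        congr 1
        refine lintegral_congr fun y => ?_
        have h1 : ∀ s, {y | ENNReal.ofReal (s / 2) < g y}.indicator g y
            = {s : ℝ | ENNReal.ofReal (s / 2) < g y}.indicator (fun _ => g y) s := fun s => rfl
        have hms : MeasurableSet {s : ℝ | ENNReal.ofReal (s / 2) < g y} :=
          measurableSet_lt (by fun_prop) measurable_const
        simp_rw [h1]
        rw [lintegral_indicator_const hms, Measure.restrict_apply hms]
        have h2 : {s : ℝ | ENNReal.ofReal (s / 2) < g y} ∩ Ioi 0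
            = {s : ℝ | s ∈ Ioi (0 : ℝ) ∧ ENNReal.ofReal s < 2 * g y} := by
          ext s
          simp only [mem_inter_iff, mem_ofPred_eq]
          rw [and_comm]
          refine and_congr_right fun hs => ?_
          rw [ENNReal.ofReal_div_of_pos two_pos,
            ENNReal.div_lt_iff (Or.inl (by simp)) (Or.inl (by simp)), mul_comm]
          simp
        rw [h2, volume_Ioi_inter_ofReal_lt]
        ring
    _ = _ := by
        rw [lintegral_const_mul _ (hgm.pow_const 2), ← mul_assoc]
        congr 1
        ring

/-- Averages over balls of arbitrary radius are controlled by the maximal function. -/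
theorem setLIntegral_ball_le_maximalFunction (g : E → ℝ≥0∞) (x : E) {r : ℝ} (hr : 0 < r) :
    ∫⁻ y in ball x r, g y ∂μ
      ≤ ENNReal.ofReal ((2 * r) ^ Module.finrank ℝ E) * μ (ball (0 : E) 1)
        * maximalFunction μ g x := by
  -- The next dyadic radius above r is at most 2r, whence the factor 2 in the constant.
  obtain ⟨k, hk1, hk2⟩ := exists_mem_Ico_zpow hr one_lt_two
  have hpos : (0 : ℝ) < 2 ^ (k + 1) := by positivity
  have h1 : (2 : ℝ) ^ (k + 1) ≤ 2 * r := by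
    rw [zpow_add_one₀ two_ne_zero, mul_comm]; gcongr
  set B := closedBall x ((2 : ℝ) ^ (k + 1)) with hB
  have hB0 : μ B ≠ 0 := (measure_closedBall_pos μ x hpos).ne'
  have hBt : μ B ≠ ⊤ := measure_closedBall_lt_top.ne
  calc ∫⁻ y in ball x r, g y ∂μ ≤ ∫⁻ y in B, g y ∂μ :=
        lintegral_mono_set ((ball_subset_closedBall).trans (closedBall_subset_closedBall hk2.le))
    _ = μ B * ((μ B)⁻¹ * ∫⁻ y in B, g y ∂μ) := by
        rw [← mul_assoc, ENNReal.mul_inv_cancel hB0 hBt, one_mul]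
    _ ≤ _ := by
        gcongr
        · rw [hB, Measure.addHaar_closedBall μ x hpos.le]
          gcongr
        · exact le_iSup (fun k : ℤ => (μ (closedBall x ((2 : ℝ) ^ k)))⁻¹ *
            ∫⁻ y in closedBall x ((2 : ℝ) ^ k), g y ∂μ) (k + 1)

end MaximalFunction

end CoulombSobolev

namespace CoulombSobolev

/-! ### Mollification at scale r, its derivative in r, and its limit as r → 0. -/

section Mollification

open Set Metric Filter Topology

/-- A smooth bump at the origin, supported in the closed unit ball. -/
noncomputable def unitBump (N : ℕ) : ContDiffBump (0 : EuclideanSpace ℝ (Fin N)) :=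
  ⟨1 / 2, 1, by norm_num, by norm_num⟩

/-- A nonnegative smooth function supported in the unit ball with integral one. -/
noncomputable def mollifier (N : ℕ) : EuclideanSpace ℝ (Fin N) → ℝ := (unitBump N).normed volume

variable {N : ℕ}

theorem contDiff_mollifier : ContDiff ℝ ∞ (mollifier N) := (unitBump N).contDiff_normed

theorem differentiable_mollifier : Differentiable ℝ (mollifier N) :=
  contDiff_mollifier.differentiable (by simp)

theorem hasCompactSupport_mollifier : HasCompactSupport (mollifier N) :=
  (unitBump N).hasCompactSupport_normed

theorem mollifier_eq_zero {w : EuclideanSpace ℝ (Fin N)} (hw : 1 ≤ ‖w‖) : mollifier N w = 0 := by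
  have h := (unitBump N).support_normed_eq (μ := volume)
  by_contra hne
  have : w ∈ Function.support ((unitBump N).normed volume) := hne
  rw [h, mem_ball_zero_iff] at this
  exact absurd this (not_lt.2 hw)

theorem fderiv_mollifier_eq_zero {w : EuclideanSpace ℝ (Fin N)} (hw : 1 < ‖w‖) :
    fderiv ℝ (mollifier N) w = 0 := by
  have : mollifier N =ᶠ[𝓝 w] fun _ => 0 := by
    filter_upwards [(isOpen_lt continuous_const continuous_norm).mem_nhds hw] with z hz
    exact mollifier_eq_zero (le_of_lt hz)
  rw [this.fderiv_eq]
  simp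

theorem exists_mollifier_le (N : ℕ) : ∃ C : ℝ, 0 < C ∧ ∀ w, |mollifier N w| ≤ C := by
  obtain ⟨C, hC⟩ := hasCompactSupport_mollifier.exists_bound_of_continuous
    (contDiff_mollifier (N := N)).continuous
  exact ⟨max C 1, by positivity, fun w => (hC w).trans (le_max_left _ _)⟩

theorem exists_fderiv_mollifier_le (N : ℕ) :
    ∃ C : ℝ, 0 < C ∧ ∀ w, ‖fderiv ℝ (mollifier N) w‖ ≤ C := by
  obtain ⟨C, hC⟩ := (hasCompactSupport_mollifier.fderiv (𝕜 := ℝ)).exists_bound_of_continuous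
    ((contDiff_mollifier (N := N)).continuous_fderiv (by simp))
  exact ⟨max C 1, by positivity, fun w => (hC w).trans (le_max_left _ _)⟩

/-- The mollification of `u` at scale `r`. -/
noncomputable def mollify (u : EuclideanSpace ℝ (Fin N) → ℝ) (r : ℝ)
    (x : EuclideanSpace ℝ (Fin N)) : ℝ :=
  ∫ y, u y * ((r ^ N)⁻¹ * mollifier N (r⁻¹ • (x - y)))

theorem norm_inv_smul_sub {r : ℝ} (hr : 0 < r) (x y : EuclideanSpace ℝ (Fin N)) :
    ‖r⁻¹ • (x - y)‖ = dist y x / r := by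
  rw [norm_smul, norm_inv, Real.norm_of_nonneg hr.le, dist_comm, dist_eq_norm]
  field_simp

theorem integrable_mul_of_bounded_on_ball {F : Type*} [NormedAddCommGroup F]
    {u : EuclideanSpace ℝ (Fin N) → F} (hu : LocallyIntegrable u volume)
    (x : EuclideanSpace ℝ (Fin N)) (r c : ℝ) :
    Integrable ((closedBall x r).indicator fun y => ‖u y‖ * c) volume :=
  (integrable_indicator_iff measurableSet_closedBall).2
    ((hu.integrableOn_isCompact (isCompact_closedBall x r)).norm.mul_const c)

/-- The derivative of the mollification with respect to the scale. -/
theorem hasDerivAt_mollify {u : EuclideanSpace ℝ (Fin N) → ℝ} (hu : LocallyIntegrable u volume)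
    (x : EuclideanSpace ℝ (Fin N)) {r : ℝ} (hr : 0 < r) :
    Integrable (fun y => u y * (-(r ^ (N + 1))⁻¹ * (N * mollifier N (r⁻¹ • (x - y))
      + fderiv ℝ (mollifier N) (r⁻¹ • (x - y)) (r⁻¹ • (x - y))))) ∧
    HasDerivAt (fun t => mollify u t x)
      (∫ y, u y * (-(r ^ (N + 1))⁻¹ * (N * mollifier N (r⁻¹ • (x - y))
        + fderiv ℝ (mollifier N) (r⁻¹ • (x - y)) (r⁻¹ • (x - y))))) r := by
  obtain ⟨C, hC0, hC⟩ := exists_mollifier_le N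
  obtain ⟨C', hC'0, hC'⟩ := exists_fderiv_mollifier_le N
  have hφ := (contDiff_mollifier (N := N)).continuous
  have hφ' := (contDiff_mollifier (N := N)).continuous_fderiv (by simp)
  have hr2 : 0 < r / 2 := by positivity
  have hsm : ∀ t : ℝ, AEStronglyMeasurable
      (fun y => u y * ((t ^ N)⁻¹ * mollifier N (t⁻¹ • (x - y)))) volume := fun t =>
    hu.aestronglyMeasurable.mul (by fun_prop : Continuous fun y =>
      (t ^ N)⁻¹ * mollifier N (t⁻¹ • (x - y))).aestronglyMeasurable
  -- For scales in (r/2, 2r) the integrands and their derivatives vanish outside the fixed ball of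
  -- radius 2r, and negative powers of the scale are bounded by those of r/2.
  refine hasDerivAt_integral_of_dominated_loc_of_deriv_le
    (bound := (closedBall x (2 * r)).indicator fun y =>
      ‖u y‖ * (((r / 2) ^ (N + 1))⁻¹ * (N * C + C')))
    (F' := fun t y => u y * (-(t ^ (N + 1))⁻¹ * (N * mollifier N (t⁻¹ • (x - y))
      + fderiv ℝ (mollifier N) (t⁻¹ • (x - y)) (t⁻¹ • (x - y)))))
    (Ioo_mem_nhds (show r / 2 < r by linarith) (show r < 2 * r by linarith))
    (Eventually.of_forall hsm) ?_ ?_ ?_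
    (integrable_mul_of_bounded_on_ball hu x _ _) ?_
  · refine (integrable_mul_of_bounded_on_ball hu x r ((r ^ N)⁻¹ * C)).mono' (hsm r)
      (ae_of_all _ fun y => ?_)
    by_cases hy : y ∈ closedBall x r
    · rw [indicator_of_mem hy, norm_mul, norm_mul, norm_inv, norm_pow, Real.norm_of_nonneg hr.le]
      gcongr
      exact hC _
    · rw [indicator_of_notMem hy, mollifier_eq_zero]
      · simp
      · rw [norm_inv_smul_sub hr, le_div_iff₀ hr, one_mul]
        exact le_of_lt (not_le.1 hy)
  · refine hu.aestronglyMeasurable.mul (Continuous.aestronglyMeasurable ?_)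
    exact continuous_const.mul ((continuous_const.mul (hφ.comp (by fun_prop))).add
      ((hφ'.comp (by fun_prop)).clm_apply (by fun_prop)))
  · refine ae_of_all _ fun y t ht => ?_
    have ht0 : 0 < t := hr2.trans ht.1
    by_cases hy : y ∈ closedBall x (2 * r)
    · rw [indicator_of_mem hy, norm_mul, norm_mul, norm_neg, norm_inv, norm_pow,
        Real.norm_of_nonneg ht0.le]
      have h1 : ‖fderiv ℝ (mollifier N) (t⁻¹ • (x - y)) (t⁻¹ • (x - y))‖ ≤ C' := by
        rcases le_or_gt ‖t⁻¹ • (x - y)‖ 1 with h | h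
        · refine (ContinuousLinearMap.le_opNorm _ _).trans ?_
          calc _ ≤ C' * 1 := by gcongr; exact hC' _
            _ = C' := mul_one _
        · rw [fderiv_mollifier_eq_zero h]
          simpa using hC'0.le
      have h2 : ‖(N : ℝ) * mollifier N (t⁻¹ • (x - y))‖ ≤ N * C := by
        rw [norm_mul, Real.norm_natCast]
        gcongr
        exact hC _
      gcongr
      · exact ht.1.le
      · exact (norm_add_le _ _).trans (add_le_add h2 h1)
    · have h1 : 1 < ‖t⁻¹ • (x - y)‖ := by
        rw [norm_inv_smul_sub ht0, lt_div_iff₀ ht0, one_mul]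
        exact ht.2.trans (not_le.1 hy)
      rw [indicator_of_notMem hy, mollifier_eq_zero h1.le, fderiv_mollifier_eq_zero h1]
      simp
  · refine ae_of_all _ fun y t ht => ?_
    have ht0 : 0 < t := hr2.trans ht.1
    refine HasDerivAt.const_mul (u y) ?_
    have e1 : HasDerivAt (fun t : ℝ => (t ^ N)⁻¹) (-(N * t ^ (N - 1)) / (t ^ N) ^ 2) t :=
      (hasDerivAt_pow N t).inv (by positivity)
    have e2 : HasDerivAt (fun t : ℝ => t⁻¹ • (x - y)) ((-(t ^ 2)⁻¹) • (x - y)) t :=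
      (hasDerivAt_inv ht0.ne').smul_const (x - y)
    have e3 := (differentiable_mollifier (t⁻¹ • (x - y))).hasFDerivAt.comp_hasDerivAt t e2
    refine (e1.mul e3).congr_deriv ?_
    simp only [map_smul, smul_eq_mul, Function.comp_apply]
    generalize fderiv ℝ (mollifier N) (t⁻¹ • (x - y)) (x - y) = a
    generalize mollifier N (t⁻¹ • (x - y)) = b
    -- The subtraction N - 1 is truncated; the prefactor N makes the identity hold for N = 0 too.
    have h : (N : ℝ) * t ^ (N - 1) = N * t ^ N / t := by
      rcases N with _ | n
      · simp
      · rw [Nat.add_sub_cancel]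
        field_simp
        ring
    rw [h]
    field_simp
    ring

/-- The `i`-th coordinate of the vector field whose divergence is the derivative of the scaled
mollifier with respect to the scale. -/
noncomputable def scaleField (x : EuclideanSpace ℝ (Fin N)) (r : ℝ) (i : Fin N)
    (y : EuclideanSpace ℝ (Fin N)) : ℝ :=
  (r ^ (N + 1))⁻¹ * (mollifier N (r⁻¹ • (x - y)) * EuclideanSpace.proj (𝕜 := ℝ) i (x - y))

theorem contDiff_scaleField (x : EuclideanSpace ℝ (Fin N)) (r : ℝ) (i : Fin N) :
    ContDiff ℝ ∞ (scaleField x r i) := by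
  have h1 : ContDiff ℝ ∞ fun y => r⁻¹ • (x - y) := by fun_prop
  have h2 : ContDiff ℝ ∞ fun y => mollifier N (r⁻¹ • (x - y)) := contDiff_mollifier.comp h1
  have h3 : ContDiff ℝ ∞ fun y => EuclideanSpace.proj (𝕜 := ℝ) i (x - y) := by fun_prop
  exact contDiff_const.mul (h2.mul h3)

theorem scaleField_eq_zero {x y : EuclideanSpace ℝ (Fin N)} {r : ℝ} (hr : 0 < r) (i : Fin N)
    (hy : r ≤ dist y x) : scaleField x r i y = 0 := by
  rw [scaleField, mollifier_eq_zero]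
  · simp
  · rwa [norm_inv_smul_sub hr, le_div_iff₀ hr, one_mul]

theorem hasCompactSupport_scaleField (x : EuclideanSpace ℝ (Fin N)) {r : ℝ} (hr : 0 < r)
    (i : Fin N) : HasCompactSupport (scaleField x r i) :=
  HasCompactSupport.of_support_subset_isCompact (isCompact_closedBall x r) fun y hy => by
    by_contra h
    exact hy (scaleField_eq_zero hr i (le_of_lt (not_le.1 h)))

theorem norm_scaleField_le {C : ℝ} (hC : ∀ w, |mollifier N w| ≤ C)
    {x y : EuclideanSpace ℝ (Fin N)} {r : ℝ} (hr : 0 < r) (i : Fin N) (hy : dist y x ≤ r) :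
    ‖scaleField x r i y‖ ≤ C * (r ^ N)⁻¹ := by
  have h2 : ‖EuclideanSpace.proj (𝕜 := ℝ) i (x - y)‖ ≤ r := by
    refine (PiLp.norm_apply_le (x - y) i).trans ?_
    rwa [← dist_eq_norm, dist_comm]
  have hC0 : 0 ≤ C := (abs_nonneg _).trans (hC 0)
  rw [scaleField, norm_mul, norm_mul, norm_inv, norm_pow, Real.norm_of_nonneg hr.le]
  calc _ ≤ (r ^ (N + 1))⁻¹ * (C * r) := by
        gcongr
        exact hC _
    _ = C * (r ^ N)⁻¹ := by rw [pow_succ]; field_simp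

theorem fderiv_scaleField (x y : EuclideanSpace ℝ (Fin N)) (r : ℝ) (i : Fin N) :
    fderiv ℝ (scaleField x r i) y (EuclideanSpace.single i 1) =
      -(r ^ (N + 1))⁻¹ * (mollifier N (r⁻¹ • (x - y))
        + r⁻¹ * ((x - y) i * fderiv ℝ (mollifier N) (r⁻¹ • (x - y))
          (EuclideanSpace.single i 1))) := by
  have e0 : HasFDerivAt (fun y => x - y) (-(ContinuousLinearMap.id ℝ _)) y :=
    (hasFDerivAt_id y).const_sub x
  have e1 : HasFDerivAt (fun y => r⁻¹ • (x - y)) (r⁻¹ • -(ContinuousLinearMap.id ℝ _)) y :=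
    e0.const_smul r⁻¹
  have e2 : HasFDerivAt (fun y => mollifier N (r⁻¹ • (x - y))) _ y :=
    (differentiable_mollifier (r⁻¹ • (x - y))).hasFDerivAt.comp y e1
  have e4 : HasFDerivAt (fun y => EuclideanSpace.proj (𝕜 := ℝ) i (x - y)) _ y :=
    (EuclideanSpace.proj (𝕜 := ℝ) i).hasFDerivAt.comp y e0
  have e6 : fderiv ℝ (scaleField x r i) y = _ := ((e2.mul e4).const_mul (r ^ (N + 1))⁻¹).fderiv
  rw [e6]
  simp only [smul_neg, ContinuousLinearMap.comp_neg, ContinuousLinearMap.comp_smul,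
    ContinuousLinearMap.comp_id, FunLike.coe_smul, FunLike.coe_add, FunLike.coe_neg,
    Pi.smul_apply, Pi.add_apply, Pi.neg_apply, smul_eq_mul, EuclideanSpace.coe_proj,
    PiLp.sub_apply, PiLp.single_apply, if_true]
  ring

/-- The right-hand side is the r-derivative of r^(-N) φ((x-y)/r), with φ the mollifier. Writing it
as a divergence in y lets the definition of the weak gradient move the derivative onto u. -/
theorem sum_fderiv_scaleField (x y : EuclideanSpace ℝ (Fin N)) (r : ℝ) :
    ∑ i, fderiv ℝ (scaleField x r i) y (EuclideanSpace.single i 1)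
      = -(r ^ (N + 1))⁻¹ * (N * mollifier N (r⁻¹ • (x - y))
        + fderiv ℝ (mollifier N) (r⁻¹ • (x - y)) (r⁻¹ • (x - y))) := by
  have h : ∑ i, (x - y) i * fderiv ℝ (mollifier N) (r⁻¹ • (x - y)) (EuclideanSpace.single i 1)
      = fderiv ℝ (mollifier N) (r⁻¹ • (x - y)) (x - y) := by
    generalize fderiv ℝ (mollifier N) (r⁻¹ • (x - y)) = L
    conv_rhs => rw [← (EuclideanSpace.basisFun (Fin N) ℝ).sum_repr (x - y)]
    rw [map_sum]
    refine Finset.sum_congr rfl fun i _ => ?_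
    rw [map_smul]
    simp
  simp_rw [fderiv_scaleField]
  rw [← Finset.mul_sum, Finset.sum_add_distrib, ← Finset.mul_sum, h, map_smul]
  simp

/-- The derivative of the mollification with respect to the scale is controlled by the average of
the weak gradient. -/
theorem exists_abs_deriv_mollify_le (N : ℕ) : ∃ C : ℝ, 0 < C ∧
    ∀ {u : EuclideanSpace ℝ (Fin N) → ℝ} {G : EuclideanSpace ℝ (Fin N) → EuclideanSpace ℝ (Fin N)},
      HasWeakGradient u G → ∀ (x : EuclideanSpace ℝ (Fin N)) {r : ℝ}, 0 < r →
        ∃ d, HasDerivAt (fun t => mollify u t x) d r ∧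
          |d| ≤ C * ((r ^ N)⁻¹ * ∫ y in ball x r, ‖G y‖) := by
  obtain ⟨C, hC0, hC⟩ := exists_mollifier_le N
  -- Each of the N coordinates contributes `C`; N + 1 keeps the constant positive when N = 0.
  refine ⟨(N + 1) * C, by positivity, fun {u G} hG x {r} hr => ?_⟩
  obtain ⟨hint, hder⟩ := hasDerivAt_mollify hG.locallyIntegrable x hr
  refine ⟨_, hder, ?_⟩
  have hui : ∀ i, Integrable fun y =>
      u y * fderiv ℝ (scaleField x r i) y (EuclideanSpace.single i 1) := by
    intro i
    have hc : Continuous fun y => fderiv ℝ (scaleField x r i) y (EuclideanSpace.single i 1) :=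
      ((contDiff_scaleField x r i).continuous_fderiv (by simp)).clm_apply continuous_const
    have hs : HasCompactSupport fun y =>
        fderiv ℝ (scaleField x r i) y (EuclideanSpace.single i 1) :=
      (hasCompactSupport_scaleField x hr i).fderiv_apply (𝕜 := ℝ) _
    simpa only [smul_eq_mul, mul_comm] using
      hG.locallyIntegrable.integrable_smul_left_of_hasCompactSupport hc hs
  have hGball : IntegrableOn (fun y => ‖G y‖) (ball x r) :=
    ((hG.locallyIntegrable_grad.integrableOn_isCompact (isCompact_closedBall x r)).mono_set
      ball_subset_closedBall).norm
  have hbound : ∀ i, |∫ y, G y i * scaleField x r i y|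
      ≤ C * ((r ^ N)⁻¹ * ∫ y in ball x r, ‖G y‖) := by
    intro i
    have h1 : ∫ y, G y i * scaleField x r i y = ∫ y in ball x r, G y i * scaleField x r i y := by
      symm
      refine setIntegral_eq_integral_of_forall_compl_eq_zero fun y hy => ?_
      rw [scaleField_eq_zero hr i (not_lt.1 hy), mul_zero]
    rw [h1, ← mul_assoc, ← integral_const_mul]
    rw [← Real.norm_eq_abs]
    refine norm_integral_le_of_norm_le (hGball.const_mul _) ?_
    filter_upwards [ae_restrict_mem measurableSet_ball] with y hy
    rw [norm_mul, mul_comm]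
    exact mul_le_mul (norm_scaleField_le hC hr i (le_of_lt hy)) (PiLp.norm_apply_le (G y) i)
      (norm_nonneg _) (by positivity)
  have hEq : ∫ y, u y * (-(r ^ (N + 1))⁻¹ * (N * mollifier N (r⁻¹ • (x - y))
        + fderiv ℝ (mollifier N) (r⁻¹ • (x - y)) (r⁻¹ • (x - y))))
      = ∑ i, -∫ y, G y i * scaleField x r i y := by
    simp_rw [← sum_fderiv_scaleField, Finset.mul_sum]
    rw [integral_finsetSum _ fun i _ => hui i]
    exact Finset.sum_congr rfl fun i _ => hG.integral_eq _ (contDiff_scaleField x r i)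
      (hasCompactSupport_scaleField x hr i) i
  rw [hEq]
  have hnn : 0 ≤ C * ((r ^ N)⁻¹ * ∫ y in ball x r, ‖G y‖) := by
    have : 0 ≤ ∫ y in ball x r, ‖G y‖ := integral_nonneg fun _ => norm_nonneg _
    positivity
  calc |∑ i, -∫ y, G y i * scaleField x r i y|
      ≤ ∑ i : Fin N, |-∫ y, G y i * scaleField x r i y| := Finset.abs_sum_le_sum_abs _ _
    _ ≤ ∑ _i : Fin N, C * ((r ^ N)⁻¹ * ∫ y in ball x r, ‖G y‖) :=
        Finset.sum_le_sum fun i _ => by rw [abs_neg]; exact hbound i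
    _ = N * (C * ((r ^ N)⁻¹ * ∫ y in ball x r, ‖G y‖)) := by simp
    _ ≤ (N + 1) * (C * ((r ^ N)⁻¹ * ∫ y in ball x r, ‖G y‖)) := by gcongr; linarith
    _ = _ := by ring

theorem exists_abs_mollify_le (N : ℕ) : ∃ C : ℝ, 0 < C ∧
    ∀ {u : EuclideanSpace ℝ (Fin N) → ℝ}, LocallyIntegrable u volume →
      ∀ (x : EuclideanSpace ℝ (Fin N)) {r : ℝ}, 0 < r →
        |mollify u r x| ≤ C * ((r ^ N)⁻¹ * ∫ y in ball x r, ‖u y‖) := by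
  obtain ⟨C, hC0, hC⟩ := exists_mollifier_le N
  refine ⟨C, hC0, fun {u} hu x {r} hr => ?_⟩
  have huball : IntegrableOn (fun y => ‖u y‖) (ball x r) :=
    ((hu.integrableOn_isCompact (isCompact_closedBall x r)).mono_set ball_subset_closedBall).norm
  have h1 : mollify u r x = ∫ y in ball x r, u y * ((r ^ N)⁻¹ * mollifier N (r⁻¹ • (x - y))) := by
    symm
    refine setIntegral_eq_integral_of_forall_compl_eq_zero fun y hy => ?_
    rw [mollifier_eq_zero]
    · simp
    · rw [norm_inv_smul_sub hr, le_div_iff₀ hr, one_mul]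
      exact not_lt.1 hy
  rw [h1, ← mul_assoc, ← integral_const_mul]
  rw [← Real.norm_eq_abs]
  refine norm_integral_le_of_norm_le (huball.const_mul _) (ae_of_all _ fun y => ?_)
  rw [norm_mul, norm_mul, norm_inv, norm_pow, Real.norm_of_nonneg hr.le, mul_comm C, mul_comm]
  gcongr
  exact hC _

theorem integral_mollifier_scaled (x : EuclideanSpace ℝ (Fin N)) {r : ℝ} (hr : 0 < r) :
    ∫ y, (r ^ N)⁻¹ * mollifier N (r⁻¹ • (x - y)) = 1 := by
  rw [integral_const_mul, integral_sub_left_eq_self (fun y => mollifier N (r⁻¹ • y)) volume x,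
    Measure.integral_comp_smul volume (mollifier N) r⁻¹, finrank_euclideanSpace, Fintype.card_fin, mollifier,
    ContDiffBump.integral_normed, abs_of_pos (by positivity)]
  simp
  field_simp

/-- The scaled mollifier has integral one, so the error is the mollification of y ↦ u(y) - u(x),
bounded by the average of |u - u(x)|, which tends to zero at Lebesgue points. -/
theorem ae_tendsto_mollify {u : EuclideanSpace ℝ (Fin N) → ℝ} (hu : LocallyIntegrable u volume) :
    ∀ᵐ x, Tendsto (fun r => mollify u r x) (𝓝[>] 0) (𝓝 (u x)) := by
  obtain ⟨C, hC0, hC⟩ := exists_abs_mollify_le N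
  filter_upwards [(Besicovitch.vitaliFamily (volume : Measure
    (EuclideanSpace ℝ (Fin N)))).ae_tendsto_average_norm_sub hu] with x hx
  have h1 := hx.comp (Besicovitch.tendsto_filterAt volume x)
  set v₁ : ℝ := volume.real (ball (0 : EuclideanSpace ℝ (Fin N)) 1) with hv₁
  have h2 := h1.const_mul (C * v₁)
  rw [mul_zero] at h2
  rw [tendsto_iff_norm_sub_tendsto_zero]
  refine squeeze_zero' (Eventually.of_forall fun _ => norm_nonneg _) ?_ h2
  filter_upwards [self_mem_nhdsWithin] with r hr
  have hr : 0 < r := hr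
  have hv : LocallyIntegrable (fun y => u y - u x) volume := hu.sub (locallyIntegrable_const _)
  have hsub : mollify u r x - u x = mollify (fun y => u y - u x) r x := by
    have hc : Continuous fun y => (r ^ N)⁻¹ * mollifier N (r⁻¹ • (x - y)) :=
      continuous_const.mul ((contDiff_mollifier (N := N)).continuous.comp (by fun_prop))
    have hs : HasCompactSupport fun y => (r ^ N)⁻¹ * mollifier N (r⁻¹ • (x - y)) :=
      HasCompactSupport.of_support_subset_isCompact (isCompact_closedBall x r) fun y hy => by
        by_contra h
        refine hy ?_
        simp only
        rw [mollifier_eq_zero, mul_zero]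
        rw [norm_inv_smul_sub hr, le_div_iff₀ hr, one_mul]
        exact le_of_lt (not_le.1 h)
    have i1 : Integrable fun y => u y * ((r ^ N)⁻¹ * mollifier N (r⁻¹ • (x - y))) := by
      simpa only [smul_eq_mul, mul_comm] using
        hu.integrable_smul_left_of_hasCompactSupport hc hs
    have i2 : Integrable fun y => u x * ((r ^ N)⁻¹ * mollifier N (r⁻¹ • (x - y))) :=
      (hc.integrable_of_hasCompactSupport hs).const_mul _
    simp only [mollify, sub_mul]
    rw [integral_sub i1 i2, integral_const_mul, integral_mollifier_scaled x hr, mul_one]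
  rw [hsub]
  refine (hC hv x hr).trans ?_
  have hvol : volume.real (closedBall x r) = r ^ N * v₁ := by
    rw [Measure.real, Measure.addHaar_closedBall volume x hr.le, ENNReal.toReal_mul,
      ENNReal.toReal_ofReal (by positivity), finrank_euclideanSpace, Fintype.card_fin]
    rfl
  have hv0 : 0 < v₁ := ENNReal.toReal_pos (measure_ball_pos volume 0 one_pos).ne'
    measure_ball_lt_top.ne
  simp only [Function.comp_apply, setAverage_eq, smul_eq_mul]
  rw [hvol, mul_assoc C, ← mul_assoc v₁, show v₁ * (r ^ N * v₁)⁻¹ = (r ^ N)⁻¹ by field_simp]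
  gcongr
  · exact ae_of_all _ fun _ => norm_nonneg _
  · exact (hv.integrableOn_isCompact (isCompact_closedBall x r)).norm
  · exact ball_subset_closedBall

end Mollification

end CoulombSobolev

namespace CoulombSobolev

/-! ### One-variable estimates: a derivative bound balanced against decay. -/

section RealEstimates

open Set Filter Topology

/-- Both (K/s) t^s + U and (K/s) t^s - U are nondecreasing. The sign of s is left free: positive s
serves to integrate from 0, negative s from infinity. -/
theorem abs_sub_le_of_abs_deriv_le_rpow {U : ℝ → ℝ} {K s : ℝ} (hs : s ≠ 0)
    (hU : ∀ r, 0 < r → ∃ d, HasDerivAt U d r ∧ |d| ≤ K * r ^ (s - 1)) {r ρ : ℝ} (hr : 0 < r)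
    (hrρ : r ≤ ρ) : |U ρ - U r| ≤ K / s * (ρ ^ s - r ^ s) := by
  have hP : ∀ t, 0 < t → HasDerivAt (fun t : ℝ => K / s * t ^ s) (K * t ^ (s - 1)) t := by
    intro t ht
    refine ((Real.hasDerivAt_rpow_const (p := s) (Or.inl ht.ne')).const_mul (K / s)).congr_deriv ?_
    field_simp
  have key : ∀ c : ℝ, |c| = 1 → MonotoneOn (fun t => K / s * t ^ s + c * U t) (Ioi 0) := by
    intro c hc
    have hd : ∀ t, 0 < t → ∃ e, HasDerivAt (fun t => K / s * t ^ s + c * U t) e t ∧ 0 ≤ e := by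
      intro t ht
      obtain ⟨d, hd, hdK⟩ := hU t ht
      refine ⟨_, (hP t ht).add (hd.const_mul c), ?_⟩
      have : |c * d| ≤ K * t ^ (s - 1) := by rwa [abs_mul, hc, one_mul]
      linarith [neg_abs_le (c * d)]
    refine monotoneOn_of_deriv_nonneg (convex_Ioi 0) ?_ ?_ ?_
    · intro t ht
      obtain ⟨e, he, -⟩ := hd t ht
      exact he.continuousAt.continuousWithinAt
    · rw [interior_Ioi]
      intro t ht
      obtain ⟨e, he, -⟩ := hd t ht
      exact he.differentiableAt.differentiableWithinAt
    · rw [interior_Ioi]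
      intro t ht
      obtain ⟨e, he, h0⟩ := hd t ht
      rwa [he.deriv]
  have h1 := key 1 (by simp) hr (hr.trans_le hrρ) hrρ
  have h2 := key (-1) (by simp) hr (hr.trans_le hrρ) hrρ
  simp only at h1 h2
  rw [abs_le]
  constructor <;> linarith

theorem abs_sub_le_of_tendsto_zero {U : ℝ → ℝ} {K s a : ℝ} (hs : 0 < s) (hK : 0 ≤ K)
    (hU : ∀ r, 0 < r → ∃ d, HasDerivAt U d r ∧ |d| ≤ K * r ^ (s - 1))
    (ha : Tendsto U (𝓝[>] 0) (𝓝 a)) {ρ : ℝ} (hρ : 0 < ρ) : |U ρ - a| ≤ K / s * ρ ^ s := by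
  refine le_of_tendsto (f := fun r => |U ρ - U r|) ((tendsto_const_nhds.sub ha).abs) ?_
  filter_upwards [Ioc_mem_nhdsGT hρ] with r hr
  refine (abs_sub_le_of_abs_deriv_le_rpow hs.ne' hU hr.1 hr.2).trans ?_
  have : 0 ≤ r ^ s := Real.rpow_nonneg hr.1.le s
  gcongr
  linarith

theorem abs_le_of_tendsto_atTop {U : ℝ → ℝ} {K s : ℝ} (hs : s < 0) (hK : 0 ≤ K)
    (hU : ∀ r, 0 < r → ∃ d, HasDerivAt U d r ∧ |d| ≤ K * r ^ (s - 1))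
    (ha : Tendsto U atTop (𝓝 0)) {r : ℝ} (hr : 0 < r) : |U r| ≤ K / -s * r ^ s := by
  have h0 : Tendsto (fun ρ => |U ρ - U r|) atTop (𝓝 |0 - U r|) :=
    (ha.sub tendsto_const_nhds).abs
  rw [zero_sub, abs_neg] at h0
  refine le_of_tendsto h0 ?_
  filter_upwards [eventually_ge_atTop r] with ρ hρ
  refine (abs_sub_le_of_abs_deriv_le_rpow hs.ne hU hr hρ).trans ?_
  have h1 : 0 ≤ ρ ^ s := Real.rpow_nonneg (hr.le.trans hρ) s
  have h2 : 0 ≤ K / -s := div_nonneg hK (by linarith)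
  have h3 : K / s = -(K / -s) := by rw [div_neg, neg_neg]
  rw [h3]
  nlinarith

theorem le_zero_of_forall_le_rpow_neg {y b κ : ℝ} (hκ : 0 < κ)
    (h : ∀ ρ : ℝ, 0 < ρ → y ≤ ρ ^ (-κ) * b) : y ≤ 0 := by
  have h1 : Tendsto (fun ρ : ℝ => ρ ^ (-κ) * b) atTop (𝓝 (0 * b)) :=
    (tendsto_rpow_neg_atTop hκ).mul_const b
  rw [zero_mul] at h1
  refine ge_of_tendsto h1 ?_
  filter_upwards [eventually_gt_atTop 0] with ρ hρ using h ρ hρ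

/-- Optimisation in ρ: at ρ = (b/a)^(1/(s+κ)) the two terms are equal, hence the factor 2. If a or b
vanishes, ρ is sent to ∞ or to 0. -/
theorem le_two_mul_rpow_mul_rpow {y a b s κ : ℝ} (ha : 0 ≤ a) (hb : 0 ≤ b) (hs : 0 < s) (hκ : 0 < κ)
    (h : ∀ ρ : ℝ, 0 < ρ → y ≤ ρ ^ s * a + ρ ^ (-κ) * b) :
    y ≤ 2 * (a ^ (κ / (s + κ)) * b ^ (s / (s + κ))) := by
  have hsκ : 0 < s + κ := by linarith
  rcases ha.eq_or_lt with rfl | ha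
  · have h1 := le_zero_of_forall_le_rpow_neg hκ fun ρ hρ => by simpa using h ρ hρ
    rwa [Real.zero_rpow (by positivity), zero_mul, mul_zero]
  rcases hb.eq_or_lt with rfl | hb
  · have h1 := le_zero_of_forall_le_rpow_neg (y := y) (b := a) hs fun ρ hρ => by
      have h2 := h ρ⁻¹ (inv_pos.2 hρ)
      rwa [mul_zero, add_zero, Real.inv_rpow hρ.le, ← Real.rpow_neg hρ.le] at h2
    rwa [Real.zero_rpow (by positivity), mul_zero, mul_zero]
  have h1 := h ((b / a) ^ (1 / (s + κ))) (by positivity)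
  refine h1.trans (le_of_eq ?_)
  rw [← Real.rpow_mul (by positivity), ← Real.rpow_mul (by positivity),
    Real.div_rpow hb.le ha.le, Real.div_rpow hb.le ha.le]
  have e1 : a = a ^ (1 / (s + κ) * s) * a ^ (κ / (s + κ)) := by
    rw [← Real.rpow_add ha]
    conv_lhs => rw [← Real.rpow_one a]
    congr 1
    field_simp
  have e2 : b = b ^ (-(1 / (s + κ) * -κ)) * b ^ (s / (s + κ)) := by
    rw [← Real.rpow_add hb]
    conv_lhs => rw [← Real.rpow_one b]
    congr 1
    field_simp
    ring
  have p1 : 0 < a ^ (1 / (s + κ) * s) := by positivity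
  have p2 : 0 < b ^ (1 / (s + κ) * -κ) := by positivity
  have e3 : b ^ (1 / (s + κ) * s) / a ^ (1 / (s + κ) * s) * a
      = a ^ (κ / (s + κ)) * b ^ (s / (s + κ)) := by
    nth_rw 2 [e1]
    rw [show 1 / (s + κ) * s = s / (s + κ) by ring] at p1 ⊢
    field_simp
  have e4 : b ^ (1 / (s + κ) * -κ) / a ^ (1 / (s + κ) * -κ) * b
      = a ^ (κ / (s + κ)) * b ^ (s / (s + κ)) := by
    nth_rw 2 [e2]
    rw [show κ / (s + κ) = -(1 / (s + κ) * -κ) by ring, Real.rpow_neg ha.le, Real.rpow_neg hb.le]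
    field_simp
  rw [e3, e4]
  ring

/-- The mechanism behind all the pointwise estimates: |a| ≤ |U(ρ) - a| + |U(ρ)|, where the first
term grows like ρ^s and the second decays like ρ^(-κ). -/
theorem abs_le_of_deriv_bound_of_decay {U : ℝ → ℝ} {K B s κ a : ℝ} (hs : 0 < s) (hκ : 0 < κ)
    (hK : 0 ≤ K) (hB : 0 ≤ B)
    (hU : ∀ r, 0 < r → ∃ d, HasDerivAt U d r ∧ |d| ≤ K * r ^ (s - 1))
    (hd : ∀ r, 0 < r → |U r| ≤ B * r ^ (-κ)) (ha : Tendsto U (𝓝[>] 0) (𝓝 a)) :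
    |a| ≤ 2 * ((K / s) ^ (κ / (s + κ)) * B ^ (s / (s + κ))) := by
  refine le_two_mul_rpow_mul_rpow (by positivity) hB hs hκ fun ρ hρ => ?_
  have h1 := abs_sub_le_of_tendsto_zero hs hK hU ha hρ
  have h2 := hd ρ hρ
  have h3 : |a| ≤ |U ρ - a| + |U ρ| := by
    have := abs_sub_abs_le_abs_sub a (U ρ)
    rw [abs_sub_comm] at this
    linarith
  linarith

end RealEstimates

/-! ### Integrals of |u|^p over balls, controlled by the Riesz potential and the Coulomb energy. -/

section CoulombBounds

open Set Metric Filter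

variable {N : ℕ}

/-- The constant `A_β` of the Riesz kernel. -/
noncomputable def rieszConst (N : ℕ) (β : ℝ) : ℝ :=
  Gamma (((N : ℝ) - β) / 2) / (Gamma (β / 2) * π ^ ((N : ℝ) / 2) * 2 ^ β)

theorem rieszConst_pos {β : ℝ} (hβ : 0 < β) (hβN : β < N) : 0 < rieszConst N β := by
  have h1 : 0 < Gamma (((N : ℝ) - β) / 2) := Real.Gamma_pos_of_pos (by linarith)
  have h2 : 0 < Gamma (β / 2) := Real.Gamma_pos_of_pos (by linarith)
  unfold rieszConst
  positivity

theorem rieszKernel_eq (β : ℝ) (x : EuclideanSpace ℝ (Fin N)) :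
    rieszKernel N β x = rieszConst N β * ‖x‖ ^ (β - (N : ℝ)) := rfl

theorem measurable_rieszKernel (β : ℝ) : Measurable (rieszKernel N β) := by
  have : rieszKernel N β = fun x => rieszConst N β * ‖x‖ ^ (β - (N : ℝ)) := rfl
  rw [this]
  exact (measurable_norm.pow_const _).const_mul _

theorem measurable_rieszPotential {u : EuclideanSpace ℝ (Fin N) → ℝ}
    (hu : AEStronglyMeasurable u volume) (β p : ℝ) : Measurable (rieszPotential β p u) := by
  have h : rieszPotential β p u = fun x =>
      ∫⁻ y, ENNReal.ofReal (rieszKernel N β (x - y)) * ‖hu.mk u y‖ₑ ^ p := by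
    funext x
    refine lintegral_congr_ae ?_
    filter_upwards [hu.ae_eq_mk] with y hy
    rw [hy]
  rw [h]
  refine Measurable.lintegral_prod_right'
    (f := fun z : EuclideanSpace ℝ (Fin N) × EuclideanSpace ℝ (Fin N) =>
      ENNReal.ofReal (rieszKernel N β (z.1 - z.2)) * ‖hu.mk u z.2‖ₑ ^ p) ?_
  refine Measurable.mul ?_ ?_
  · exact ENNReal.measurable_ofReal.comp
      ((measurable_rieszKernel β).comp (measurable_fst.sub measurable_snd))
  · exact ((hu.stronglyMeasurable_mk.measurable.comp measurable_snd).enorm).pow_const p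

theorem setLIntegral_le_rieszPotential [NeZero N] {β : ℝ} (hβ : 0 < β) (hβN : β < N) (p : ℝ)
    (u : EuclideanSpace ℝ (Fin N) → ℝ) {s : Set (EuclideanSpace ℝ (Fin N))}
    (hs : MeasurableSet s) {x : EuclideanSpace ℝ (Fin N)} {r : ℝ} (hsr : s ⊆ ball x r) :
    ENNReal.ofReal (rieszConst N β * r ^ (β - N)) * ∫⁻ y in s, ‖u y‖ₑ ^ p
      ≤ rieszPotential β p u x := by
  have hA := rieszConst_pos (N := N) hβ hβN
  calc ENNReal.ofReal (rieszConst N β * r ^ (β - N)) * ∫⁻ y in s, ‖u y‖ₑ ^ p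
      = ∫⁻ y in s, ENNReal.ofReal (rieszConst N β * r ^ (β - N)) * ‖u y‖ₑ ^ p :=
        (lintegral_const_mul' _ _ ENNReal.ofReal_ne_top).symm
    _ ≤ ∫⁻ y in s, ENNReal.ofReal (rieszKernel N β (x - y)) * ‖u y‖ₑ ^ p := by
        refine lintegral_mono_ae ?_
        -- The formal value of the kernel at the origin is 0, not ∞, so the lower bound fails at y =
        -- x and that null point is discarded.
        have hx : ∀ᵐ y ∂(volume : Measure (EuclideanSpace ℝ (Fin N))), y ≠ x :=
          Measure.ae_ne volume x
        filter_upwards [ae_restrict_mem hs, ae_restrict_of_ae hx] with y hy hyx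
        gcongr
        rw [rieszKernel_eq]
        have h1 : 0 < ‖x - y‖ := norm_pos_iff.2 (sub_ne_zero.2 hyx.symm)
        have h2 : ‖x - y‖ ≤ r := by
          rw [← dist_eq_norm, dist_comm]
          exact le_of_lt (hsr hy)
        exact mul_le_mul_of_nonneg_left
          (Real.rpow_le_rpow_of_nonpos h1 h2 (by linarith)) hA.le
    _ ≤ _ := setLIntegral_le_lintegral _ _

theorem volume_ball_eq (x : EuclideanSpace ℝ (Fin N)) {r : ℝ} (hr : 0 < r) :
    volume (ball x r)
      = ENNReal.ofReal (r ^ N) * volume (ball (0 : EuclideanSpace ℝ (Fin N)) 1) := by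
  rw [Measure.addHaar_ball_of_pos volume x hr, finrank_euclideanSpace, Fintype.card_fin]

/-- The ball of radius r about x lies in the ball of radius 2r about each of its points, so the
potential is bounded below on the whole ball; its square is then integrated there. -/
theorem setLIntegral_sq_le_coulombEnergy [NeZero N] {α : ℝ} (hα : 0 < α) (hαN : α < N) (p : ℝ)
    (u : EuclideanSpace ℝ (Fin N) → ℝ) (x : EuclideanSpace ℝ (Fin N)) {r : ℝ} (hr : 0 < r) :
    ENNReal.ofReal (r ^ N) * volume (ball (0 : EuclideanSpace ℝ (Fin N)) 1) *
      (ENNReal.ofReal (rieszConst N (α / 2) * (2 * r) ^ (α / 2 - N))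
        * ∫⁻ y in ball x r, ‖u y‖ₑ ^ p) ^ 2 ≤ coulombEnergy α p u := by
  rw [← volume_ball_eq x hr, mul_comm, ← setLIntegral_const]
  refine (setLIntegral_mono' measurableSet_ball fun y hy => ?_).trans
    (setLIntegral_le_lintegral _ _)
  gcongr
  refine setLIntegral_le_rieszPotential (by linarith) (by linarith) p u measurableSet_ball ?_
  intro z hz
  have h1 : dist z x < r := hz
  have h2 : dist y x < r := hy
  have h3 := dist_triangle_right z y x
  rw [mem_ball]
  linarith

theorem setLIntegral_lt_top_of_coulombEnergy [NeZero N] {α : ℝ} (hα : 0 < α) (hαN : α < N) {p : ℝ}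
    {u : EuclideanSpace ℝ (Fin N) → ℝ} (hu : coulombEnergy α p u < ⊤)
    (x : EuclideanSpace ℝ (Fin N)) {r : ℝ} (hr : 0 < r) :
    ∫⁻ y in ball x r, ‖u y‖ₑ ^ p < ⊤ := by
  have hA := rieszConst_pos (N := N) (β := α / 2) (by linarith) (by linarith)
  by_contra h
  rw [not_lt, top_le_iff] at h
  have h1 := setLIntegral_sq_le_coulombEnergy hα hαN p u x hr
  have h2 : ENNReal.ofReal (rieszConst N (α / 2) * (2 * r) ^ (α / 2 - N)) ≠ 0 := by
    rw [Ne, ENNReal.ofReal_eq_zero, not_le]; positivity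
  have h3 : ENNReal.ofReal (r ^ N) * volume (ball (0 : EuclideanSpace ℝ (Fin N)) 1) ≠ 0 :=
    mul_ne_zero (by rw [Ne, ENNReal.ofReal_eq_zero, not_le]; positivity)
      (measure_ball_pos volume 0 one_pos).ne'
  rw [h, ENNReal.mul_top h2, ENNReal.top_pow two_ne_zero, ENNReal.mul_top h3, top_le_iff] at h1
  exact hu.ne h1

theorem setLIntegral_le_rpow_mul {g : EuclideanSpace ℝ (Fin N) → ℝ≥0∞} (hg : AEMeasurable g volume)
    {p : ℝ} (hp : 1 ≤ p) (s : Set (EuclideanSpace ℝ (Fin N))) :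
    ∫⁻ y in s, g y ≤ (∫⁻ y in s, g y ^ p) ^ (1 / p) * volume s ^ (1 - 1 / p) := by
  have hp0 : 0 < p := by linarith
  have h := ENNReal.lintegral_mul_norm_pow_le (μ := volume.restrict s) (f := fun y => g y ^ p)
    (g := fun _ => 1) (hg.restrict.pow_const p) aemeasurable_const (p := 1 / p) (q := 1 - 1 / p)
    (by positivity) (by rw [sub_nonneg, div_le_one hp0]; exact hp) (by ring)
  simpa [← ENNReal.rpow_mul, mul_inv_cancel₀ hp0.ne'] using h

/-- Jensen's inequality for the normalised integral over a ball. -/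
theorem ball_average_le_rpow {g : EuclideanSpace ℝ (Fin N) → ℝ≥0∞} (hg : AEMeasurable g volume)
    {p : ℝ} (hp : 1 ≤ p) (x : EuclideanSpace ℝ (Fin N)) {r : ℝ} (hr : 0 < r)
    (hfin : ∫⁻ y in ball x r, g y ^ p < ⊤) :
    (r ^ N)⁻¹ * (∫⁻ y in ball x r, g y).toReal
      ≤ volume.real (ball (0 : EuclideanSpace ℝ (Fin N)) 1) ^ (1 - 1 / p)
        * ((r ^ N)⁻¹ * (∫⁻ y in ball x r, g y ^ p).toReal) ^ (1 / p) := by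
  have hp0 : 0 < p := by linarith
  have hq : 0 ≤ 1 - 1 / p := by rw [sub_nonneg, div_le_one hp0]; exact hp
  have hrN : 0 < r ^ N := by positivity
  have h := setLIntegral_le_rpow_mul hg hp (ball x r)
  have hX0 : 0 ≤ (∫⁻ y in ball x r, g y ^ p).toReal := ENNReal.toReal_nonneg
  have h1 := ENNReal.toReal_mono (ENNReal.mul_ne_top
    (ENNReal.rpow_ne_top_of_nonneg (by positivity) hfin.ne)
    (ENNReal.rpow_ne_top_of_nonneg hq measure_ball_lt_top.ne)) h
  rw [ENNReal.toReal_mul, ← ENNReal.toReal_rpow, ← ENNReal.toReal_rpow, volume_ball_eq x hr,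
    ENNReal.toReal_mul, ENNReal.toReal_ofReal hrN.le, ← Measure.real,
    Real.mul_rpow hrN.le measureReal_nonneg] at h1
  rw [Real.mul_rpow (by positivity) hX0]
  have e : (r ^ N)⁻¹ * (r ^ N) ^ (1 - 1 / p) = (r ^ N)⁻¹ ^ (1 / p) := by
    rw [Real.inv_rpow hrN.le, ← Real.rpow_neg_one, ← Real.rpow_add hrN, ← Real.rpow_neg hrN.le]
    congr 1; ring
  rw [← e]
  refine (mul_le_mul_of_nonneg_left h1 (inv_nonneg.2 hrN.le)).trans_eq ?_
  ring

end CoulombBounds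

end CoulombSobolev

namespace CoulombSobolev

/-! ### Pointwise bounds on u by the maximal function, the potential and the energies. -/

section Pointwise

open Set Metric Filter Topology

variable {N : ℕ}

/-- The maximal function of the weak gradient. -/
noncomputable def gradMax (u : EuclideanSpace ℝ (Fin N) → ℝ) :
    EuclideanSpace ℝ (Fin N) → ℝ≥0∞ :=
  maximalFunction volume fun y => ‖weakGradient u y‖ₑ

theorem volume_real_unitBall_pos :
    0 < volume.real (ball (0 : EuclideanSpace ℝ (Fin N)) 1) :=
  ENNReal.toReal_pos (measure_ball_pos volume 0 one_pos).ne' measure_ball_lt_top.ne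

/-- One average of |Du|, estimated twice: by the maximal function, uniformly in r, and by Jensen
with exponent 2, uniformly in x. The two are later combined. -/
theorem exists_abs_deriv_mollify_le_gradMax (N : ℕ) : ∃ C : ℝ, 0 < C ∧
    ∀ {u : EuclideanSpace ℝ (Fin N) → ℝ}, WeaklyDifferentiable u → dirichletEnergy u < ⊤ →
      ∀ {x : EuclideanSpace ℝ (Fin N)}, gradMax u x < ⊤ → ∀ r : ℝ, 0 < r →
        ∃ d, HasDerivAt (fun t => mollify u t x) d r ∧ |d| ≤ C * (gradMax u x).toReal ∧
          |d| ≤ C * ((dirichletEnergy u).toReal ^ (1 / 2 : ℝ) * r ^ (-(N / 2 : ℝ))) := by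
  obtain ⟨C, hC0, hC⟩ := exists_abs_deriv_mollify_le N
  set v₁ := volume.real (ball (0 : EuclideanSpace ℝ (Fin N)) 1) with hv₁
  have hv0 : 0 < v₁ := volume_real_unitBall_pos
  set c : ℝ := max (2 ^ N * v₁) (v₁ ^ (1 - 1 / 2 : ℝ)) with hc
  have hc0 : 0 < c := lt_max_of_lt_left (by positivity)
  refine ⟨C * c, by positivity, fun {u} hu hD {x} hx r hr => ?_⟩
  have hG := hasWeakGradient_weakGradient hu
  obtain ⟨d, hd, hdC⟩ := hC hG x hr
  have hGm : AEStronglyMeasurable (weakGradient u) volume :=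
    hG.locallyIntegrable_grad.aestronglyMeasurable
  rw [integral_norm_eq_lintegral_enorm hGm.restrict] at hdC
  have hrN : 0 < r ^ N := by positivity
  refine ⟨d, hd, hdC.trans ?_, hdC.trans ?_⟩
  · rw [mul_assoc]
    refine mul_le_mul_of_nonneg_left ?_ hC0.le
    have h1 := setLIntegral_ball_le_maximalFunction volume
      (fun y => ‖weakGradient u y‖ₑ) x hr
    rw [finrank_euclideanSpace, Fintype.card_fin] at h1
    have h2 := ENNReal.toReal_mono (ENNReal.mul_ne_top (ENNReal.mul_ne_top ENNReal.ofReal_ne_top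
      measure_ball_lt_top.ne) hx.ne) h1
    rw [ENNReal.toReal_mul, ENNReal.toReal_mul, ENNReal.toReal_ofReal (by positivity),
      ← Measure.real, ← hv₁, mul_pow] at h2
    rw [inv_mul_le_iff₀ hrN]
    refine h2.trans ?_
    calc 2 ^ N * r ^ N * v₁ * (gradMax u x).toReal
        = r ^ N * ((2 ^ N * v₁) * (gradMax u x).toReal) := by ring
      _ ≤ _ := by gcongr; exact le_max_left _ _
  · rw [mul_assoc]
    refine mul_le_mul_of_nonneg_left ?_ hC0.le
    have hle : ∫⁻ y in ball x r, ‖weakGradient u y‖ₑ ^ (2 : ℝ) ≤ dirichletEnergy u := by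
      refine (setLIntegral_le_lintegral _ _).trans (le_of_eq ?_)
      simp [dirichletEnergy]
    have h1 := ball_average_le_rpow (g := fun y => ‖weakGradient u y‖ₑ) hGm.enorm
      (p := 2) (by norm_num) x hr (hle.trans_lt hD)
    refine h1.trans ?_
    rw [← hv₁, Real.mul_rpow (by positivity) ENNReal.toReal_nonneg]
    have h2 : (r ^ N)⁻¹ ^ (1 / 2 : ℝ) = r ^ (-(N / 2 : ℝ)) := by
      rw [← Real.rpow_natCast, ← Real.rpow_neg hr.le, ← Real.rpow_mul hr.le]
      congr 1; ring
    rw [h2]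
    have h3 := ENNReal.toReal_mono hD.ne hle
    calc _ ≤ c * (r ^ (-(N / 2 : ℝ)) * (dirichletEnergy u).toReal ^ (1 / 2 : ℝ)) := by
          gcongr
          exact le_max_right _ _
      _ = _ := by ring

/-- The average of |u| is at most a multiple of the 1/p power of the average of |u|^p. The latter is
bounded through the potential at x, or, with faster decay but no pointwise information, through the
whole Coulomb energy. -/
theorem exists_abs_mollify_le_rieszPotential [NeZero N] {α p : ℝ} (hα : 0 < α) (hαN : α < N)
    (hp : 1 ≤ p) : ∃ C : ℝ, 0 < C ∧
    ∀ {u : EuclideanSpace ℝ (Fin N) → ℝ}, LocallyIntegrable u volume → coulombEnergy α p u < ⊤ →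
      ∀ (x : EuclideanSpace ℝ (Fin N)) (r : ℝ), 0 < r →
        (rieszPotential (α / 2) p u x < ⊤ → |mollify u r x| ≤
          C * (rieszPotential (α / 2) p u x).toReal ^ (1 / p) * r ^ (-(α / (2 * p)))) ∧
        |mollify u r x| ≤ C * (coulombEnergy α p u).toReal ^ (1 / (2 * p))
          * r ^ (-((α + N) / (2 * p))) := by
  obtain ⟨C, hC0, hC⟩ := exists_abs_mollify_le N
  have hp0 : 0 < p := by linarith
  set v₁ := volume.real (ball (0 : EuclideanSpace ℝ (Fin N)) 1) with hv₁
  have hv0 : 0 < v₁ := volume_real_unitBall_pos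
  set A := rieszConst N (α / 2) with hA
  have hA0 : 0 < A := rieszConst_pos (by linarith) (by linarith)
  set c₁ : ℝ := A⁻¹ with hc1
  set c₂ : ℝ := (A * 2 ^ (α / 2 - N) * v₁ ^ (1 / 2 : ℝ))⁻¹ with hc2
  have hc1p : 0 < c₁ := by positivity
  have hc2p : 0 < c₂ := by positivity
  set c : ℝ := max (c₁ ^ (1 / p)) (c₂ ^ (1 / p)) with hc
  have hc0 : 0 < c := lt_max_of_lt_left (by positivity)
  refine ⟨C * v₁ ^ (1 - 1 / p) * c, by positivity, fun {u} hu hE x r hr => ?_⟩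
  have hrN : 0 < r ^ N := by positivity
  have hfin := setLIntegral_lt_top_of_coulombEnergy hα hαN hE x hr
  have h0 := hC hu x hr
  rw [integral_norm_eq_lintegral_enorm hu.aestronglyMeasurable.restrict] at h0
  have h1 : |mollify u r x| ≤ C * (v₁ ^ (1 - 1 / p) *
      ((r ^ N)⁻¹ * (∫⁻ y in ball x r, ‖u y‖ₑ ^ p).toReal) ^ (1 / p)) := by
    refine h0.trans (mul_le_mul_of_nonneg_left ?_ hC0.le)
    exact ball_average_le_rpow hu.aestronglyMeasurable.enorm hp x hr hfin
  set F := (∫⁻ y in ball x r, ‖u y‖ₑ ^ p).toReal with hF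
  have hF0 : 0 ≤ F := ENNReal.toReal_nonneg
  constructor
  · intro hV
    set V := (rieszPotential (α / 2) p u x).toReal with hVdef
    have hV0 : 0 ≤ V := ENNReal.toReal_nonneg
    have h2 := ENNReal.toReal_mono hV.ne (setLIntegral_le_rieszPotential (β := α / 2)
      (by linarith) (by linarith) p u measurableSet_ball (subset_refl (ball x r)))
    rw [ENNReal.toReal_mul, ENNReal.toReal_ofReal (by positivity), ← hA, ← hVdef, ← hF,
      Real.rpow_sub hr, Real.rpow_natCast] at h2
    have h3 : (r ^ N)⁻¹ * F ≤ c₁ * V * r ^ (-(α / 2)) := by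
      have hp1 : 0 < r ^ (α / 2) := by positivity
      rw [Real.rpow_neg hr.le, hc1]
      calc (r ^ N)⁻¹ * F = A⁻¹ * (A * (r ^ (α / 2) / r ^ N) * F) * (r ^ (α / 2))⁻¹ := by
            field_simp
        _ ≤ _ := by gcongr
    have h4 : ((r ^ N)⁻¹ * F) ^ (1 / p) ≤ c * V ^ (1 / p) * r ^ (-(α / (2 * p))) := by
      refine (Real.rpow_le_rpow (by positivity) h3 (by positivity)).trans ?_
      rw [Real.mul_rpow (by positivity) (by positivity), Real.mul_rpow (by positivity) hV0,
        ← Real.rpow_mul hr.le, show -(α / 2) * (1 / p) = -(α / (2 * p)) by field_simp]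
      gcongr
      exact le_max_left _ _
    calc _ ≤ C * (v₁ ^ (1 - 1 / p) * (c * V ^ (1 / p) * r ^ (-(α / (2 * p))))) :=
          h1.trans (by gcongr)
      _ = _ := by ring
  · set e := (coulombEnergy α p u).toReal with hedef
    have he0 : 0 ≤ e := ENNReal.toReal_nonneg
    have h2 := ENNReal.toReal_mono hE.ne (setLIntegral_sq_le_coulombEnergy hα hαN p u x hr)
    rw [ENNReal.toReal_mul, ENNReal.toReal_mul, ENNReal.toReal_pow, ENNReal.toReal_mul,
      ENNReal.toReal_ofReal hrN.le, ENNReal.toReal_ofReal (by positivity), ← Measure.real, ← hv₁,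
      ← hA, ← hedef, ← hF, Real.mul_rpow two_pos.le hr.le, Real.rpow_sub hr,
      Real.rpow_natCast] at h2
    have hp1 : 0 < r ^ (α / 2) := by positivity
    have h5 := Real.rpow_le_rpow (z := (1 / 2 : ℝ)) (by positivity) h2 (by norm_num)
    rw [Real.mul_rpow (by positivity) (by positivity), Real.mul_rpow (by positivity) hv0.le,
      ← Real.sqrt_eq_rpow (_ ^ 2), Real.sqrt_sq (by positivity)] at h5
    have h3 : (r ^ N)⁻¹ * F ≤ c₂ * e ^ (1 / 2 : ℝ) * r ^ (-((α + N) / 2)) := by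
      have hp2 : 0 < (r ^ N) ^ (1 / 2 : ℝ) := by positivity
      have hp3 : (0 : ℝ) < 2 ^ (α / 2 - N) := by positivity
      have hp4 : 0 < v₁ ^ (1 / 2 : ℝ) := by positivity
      have hre : r ^ (-((α + N) / 2)) = (r ^ (α / 2))⁻¹ * ((r ^ N) ^ (1 / 2 : ℝ))⁻¹ := by
        rw [← Real.rpow_natCast, ← Real.rpow_mul hr.le, ← Real.rpow_neg hr.le,
          ← Real.rpow_neg hr.le, ← Real.rpow_add hr]
        congr 1; ring
      rw [hre, hc2]
      calc (r ^ N)⁻¹ * F = (A * 2 ^ (α / 2 - N) * v₁ ^ (1 / 2 : ℝ))⁻¹ *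
            ((r ^ N) ^ (1 / 2 : ℝ) * v₁ ^ (1 / 2 : ℝ) *
              (A * (2 ^ (α / 2 - N) * (r ^ (α / 2) / r ^ N)) * F)) *
            ((r ^ (α / 2))⁻¹ * ((r ^ N) ^ (1 / 2 : ℝ))⁻¹) := by
            field_simp
        _ ≤ _ := by gcongr
    have h4 : ((r ^ N)⁻¹ * F) ^ (1 / p) ≤
        c * e ^ (1 / (2 * p)) * r ^ (-((α + N) / (2 * p))) := by
      refine (Real.rpow_le_rpow (by positivity) h3 (by positivity)).trans ?_
      rw [Real.mul_rpow (by positivity) (by positivity),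
        Real.mul_rpow (by positivity) (by positivity), ← Real.rpow_mul hr.le,
        ← Real.rpow_mul he0, show -((α + N) / 2) * (1 / p) = -((α + N) / (2 * p)) by field_simp,
        show (1 / 2 : ℝ) * (1 / p) = 1 / (2 * p) by field_simp]
      gcongr
      exact le_max_right _ _
    calc _ ≤ C * (v₁ ^ (1 - 1 / p) * (c * e ^ (1 / (2 * p)) * r ^ (-((α + N) / (2 * p))))) :=
          h1.trans (by gcongr)
      _ = _ := by ring

theorem dirichletEnergy_lt_top_of_mem {α p : ℝ} {u : EuclideanSpace ℝ (Fin N) → ℝ}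
    (hu : u ∈ coulombSobolevSpace N α p) : dirichletEnergy u < ⊤ := by
  have h := hu.2.2
  have h1 := lintegral_rpow_enorm_lt_top_of_eLpNorm_lt_top (by norm_num) (by norm_num) h.2
  simpa [dirichletEnergy] using h1

theorem measurable_gradMax {u : EuclideanSpace ℝ (Fin N) → ℝ} (hu : WeaklyDifferentiable u) :
    Measurable (gradMax u) := by
  have hG : AEMeasurable (fun y => ‖weakGradient u y‖ₑ) volume :=
    (hasWeakGradient_weakGradient hu).locallyIntegrable_grad.aestronglyMeasurable.enorm
  rw [gradMax, maximalFunction_congr volume hG.ae_eq_mk]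
  exact measurable_maximalFunction volume hG.measurable_mk

theorem lintegral_gradMax_sq_le [NeZero N] {u : EuclideanSpace ℝ (Fin N) → ℝ}
    (hu : WeaklyDifferentiable u) :
    ∫⁻ x, gradMax u x ^ 2 ≤ 8 * ENNReal.ofReal (4 ^ N) * dirichletEnergy u := by
  have h := lintegral_maximalFunction_sq_le volume (g := fun y => ‖weakGradient u y‖ₑ)
    (hasWeakGradient_weakGradient hu).locallyIntegrable_grad.aestronglyMeasurable.enorm
  rwa [finrank_euclideanSpace, Fintype.card_fin] at h

theorem ae_gradMax_lt_top [NeZero N] {α p : ℝ} {u : EuclideanSpace ℝ (Fin N) → ℝ}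
    (hu : u ∈ coulombSobolevSpace N α p) : ∀ᵐ x, gradMax u x < ⊤ := by
  have h : ∫⁻ x, gradMax u x ^ 2 ≠ ⊤ := ne_top_of_le_ne_top
    (ENNReal.mul_ne_top (ENNReal.mul_ne_top (by norm_num) ENNReal.ofReal_ne_top)
      (dirichletEnergy_lt_top_of_mem hu).ne) (lintegral_gradMax_sq_le hu.2.1)
  filter_upwards [ae_lt_top ((measurable_gradMax hu.2.1).pow_const 2) h] with x hx
  by_contra hc
  rw [not_lt, top_le_iff] at hc
  simp [hc] at hx

theorem ae_rieszPotential_lt_top {α p : ℝ} {u : EuclideanSpace ℝ (Fin N) → ℝ}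
    (hu : u ∈ coulombSobolevSpace N α p) : ∀ᵐ x, rieszPotential (α / 2) p u x < ⊤ := by
  filter_upwards [ae_lt_top ((measurable_rieszPotential hu.1.1 (α / 2) p).pow_const 2)
    hu.1.2.ne] with x hx
  by_contra hc
  rw [not_lt, top_le_iff] at hc
  simp [hc] at hx

/-- Pointwise interpolation between the maximal function of the gradient and the Riesz
potential. -/
theorem exists_abs_le_gradMax_rieszPotential [NeZero N] {α p : ℝ} (hα : 0 < α) (hαN : α < N)
    (hp : 1 ≤ p) : ∃ C : ℝ, 0 < C ∧ ∀ u ∈ coulombSobolevSpace N α p, ∀ᵐ x,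
      |u x| ≤ C * ((gradMax u x).toReal ^ (α / (2 * p + α)) *
        (rieszPotential (α / 2) p u x).toReal ^ (2 / (2 * p + α))) := by
  obtain ⟨C₁, hC₁, H₁⟩ := exists_abs_deriv_mollify_le_gradMax N
  obtain ⟨C₂, hC₂, H₂⟩ := exists_abs_mollify_le_rieszPotential hα hαN hp
  have hp0 : 0 < p := by linarith
  refine ⟨2 * (C₁ ^ (α / (2 * p + α)) * C₂ ^ (2 * p / (2 * p + α))), by positivity,
    fun u hu => ?_⟩
  have hG := hasWeakGradient_weakGradient hu.2.1
  filter_upwards [ae_tendsto_mollify hG.locallyIntegrable, ae_gradMax_lt_top hu,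
    ae_rieszPotential_lt_top hu] with x hx hM hV
  have hm0 : 0 ≤ (gradMax u x).toReal := ENNReal.toReal_nonneg
  have hv0 : 0 ≤ (rieszPotential (α / 2) p u x).toReal := ENNReal.toReal_nonneg
  have h := abs_le_of_deriv_bound_of_decay (U := fun t => mollify u t x) (s := 1)
    (κ := α / (2 * p)) (K := C₁ * (gradMax u x).toReal)
    (B := C₂ * (rieszPotential (α / 2) p u x).toReal ^ (1 / p)) one_pos (by positivity)
    (by positivity) (by positivity)
    (fun r hr => by
      obtain ⟨d, hd, hd1, -⟩ := H₁ hu.2.1 (dirichletEnergy_lt_top_of_mem hu) hM r hr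
      exact ⟨d, hd, by simpa using hd1⟩)
    (fun r hr => (H₂ hG.locallyIntegrable hu.1.2 x r hr).1 hV) hx
  refine h.trans (le_of_eq ?_)
  have e1 : α / (2 * p) / (1 + α / (2 * p)) = α / (2 * p + α) := by field_simp
  have e2 : 1 / (1 + α / (2 * p)) = 2 * p / (2 * p + α) := by field_simp
  rw [div_one, e1, e2, Real.mul_rpow hC₁.le hm0, Real.mul_rpow hC₂.le (by positivity),
    ← Real.rpow_mul hv0, show 1 / p * (2 * p / (2 * p + α)) = 2 / (2 * p + α) by field_simp]
  ring

/-- Pointwise Sobolev estimate in dimension at least three. -/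
theorem exists_abs_le_gradMax_dirichletEnergy [NeZero N] (hN : 3 ≤ N) {α p : ℝ} (hα : 0 < α)
    (hαN : α < N) (hp : 1 ≤ p) : ∃ C : ℝ, 0 < C ∧ ∀ u ∈ coulombSobolevSpace N α p, ∀ᵐ x,
      |u x| ≤ C * ((gradMax u x).toReal ^ (1 - 2 / (N : ℝ)) *
        (dirichletEnergy u).toReal ^ (1 / (N : ℝ))) := by
  obtain ⟨C₁, hC₁, H₁⟩ := exists_abs_deriv_mollify_le_gradMax N
  obtain ⟨C₂, hC₂, H₂⟩ := exists_abs_mollify_le_rieszPotential hα hαN hp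
  have hp0 : 0 < p := by linarith
  have hN' : (3 : ℝ) ≤ N := by exact_mod_cast hN
  have hN0 : (0 : ℝ) < N := by linarith
  have hk : 0 < (N : ℝ) / 2 - 1 := by linarith
  refine ⟨2 * (C₁ ^ (1 - 2 / (N : ℝ)) * (C₁ / ((N : ℝ) / 2 - 1)) ^ (2 / (N : ℝ))), by positivity,
    fun u hu => ?_⟩
  have hG := hasWeakGradient_weakGradient hu.2.1
  filter_upwards [ae_tendsto_mollify hG.locallyIntegrable, ae_gradMax_lt_top hu] with x hx hM
  have hm0 : 0 ≤ (gradMax u x).toReal := ENNReal.toReal_nonneg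
  have hd0 : 0 ≤ (dirichletEnergy u).toReal := ENNReal.toReal_nonneg
  set δ := (dirichletEnergy u).toReal ^ (1 / 2 : ℝ) with hδ
  have hδ0 : 0 ≤ δ := by positivity
  -- Only here does the Coulomb energy enter: its finiteness makes u vanish at infinity on average,
  -- which excludes constants. No quantitative trace of it remains in the estimate.
  have hinf : Tendsto (fun t => mollify u t x) atTop (𝓝 0) := by
    have h1 : Tendsto (fun r : ℝ => C₂ * (coulombEnergy α p u).toReal ^ (1 / (2 * p))
          * r ^ (-((α + N) / (2 * p)))) atTop
        (𝓝 (C₂ * (coulombEnergy α p u).toReal ^ (1 / (2 * p)) * 0)) :=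
      (tendsto_rpow_neg_atTop (by positivity)).const_mul _
    rw [mul_zero] at h1
    refine squeeze_zero_norm' ?_ h1
    filter_upwards [eventually_gt_atTop 0] with r hr
    exact (H₂ hG.locallyIntegrable hu.1.2 x r hr).2
  -- Integrating the bound ‖Du‖₂ r^(-N/2) from infinity, which converges because N > 2.
  have hdec : ∀ r, 0 < r → |mollify u r x| ≤
      C₁ / ((N : ℝ) / 2 - 1) * δ * r ^ (-((N : ℝ) / 2 - 1)) := by
    intro r hr
    have h := abs_le_of_tendsto_atTop (U := fun t => mollify u t x) (s := 1 - (N : ℝ) / 2)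
      (K := C₁ * δ) (by linarith) (by positivity) (fun r hr => by
        obtain ⟨d, hd, -, hd1⟩ := H₁ hu.2.1 (dirichletEnergy_lt_top_of_mem hu) hM r hr
        refine ⟨d, hd, hd1.trans_eq ?_⟩
        rw [show (1 : ℝ) - N / 2 - 1 = -(N / 2) by ring]
        ring) hinf hr
    rw [show -(1 - (N : ℝ) / 2) = N / 2 - 1 by ring] at h
    rw [show -((N : ℝ) / 2 - 1) = 1 - N / 2 by ring, div_mul_eq_mul_div]
    exact h
  have h := abs_le_of_deriv_bound_of_decay (U := fun t => mollify u t x) (s := 1)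
    (κ := (N : ℝ) / 2 - 1) (K := C₁ * (gradMax u x).toReal)
    (B := C₁ / ((N : ℝ) / 2 - 1) * δ) one_pos hk (by positivity) (by positivity)
    (fun r hr => by
      obtain ⟨d, hd, hd1, -⟩ := H₁ hu.2.1 (dirichletEnergy_lt_top_of_mem hu) hM r hr
      exact ⟨d, hd, by simpa using hd1⟩) hdec hx
  refine h.trans (le_of_eq ?_)
  have e1 : ((N : ℝ) / 2 - 1) / (1 + ((N : ℝ) / 2 - 1)) = 1 - 2 / N := by
    rw [add_sub_cancel]; field_simp
  have e2 : 1 / (1 + ((N : ℝ) / 2 - 1)) = 2 / N := by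
    rw [add_sub_cancel]; field_simp
  rw [div_one, e1, e2, Real.mul_rpow hC₁.le hm0, Real.mul_rpow (by positivity) hδ0, hδ,
    ← Real.rpow_mul hd0, show (1 / 2 : ℝ) * (2 / N) = 1 / N by field_simp]
  ring

/-- Pointwise estimate giving arbitrarily large exponents in low dimension. -/
theorem exists_abs_le_gradMax_coulombEnergy [NeZero N] {α p ε s κ : ℝ} (hα : 0 < α) (hαN : α < N)
    (hp : 1 ≤ p) (hε0 : 0 < ε) (hε1 : ε ≤ 1) (hs : s = 1 - (1 - ε) * N / 2) (hs0 : 0 < s)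
    (hκ : κ = (α + N) / (2 * p)) :
    ∃ C : ℝ, 0 < C ∧ ∀ u ∈ coulombSobolevSpace N α p, ∀ᵐ x,
      |u x| ≤ C * ((gradMax u x).toReal ^ (ε * (κ / (s + κ))) *
        ((dirichletEnergy u).toReal ^ ((1 - ε) / 2 * (κ / (s + κ))) *
          (coulombEnergy α p u).toReal ^ (1 / (2 * p) * (s / (s + κ))))) := by
  obtain ⟨C₁, hC₁, H₁⟩ := exists_abs_deriv_mollify_le_gradMax N
  obtain ⟨C₂, hC₂, H₂⟩ := exists_abs_mollify_le_rieszPotential hα hαN hp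
  have hp0 : 0 < p := by linarith
  have hN0 : (0 : ℝ) < N := by linarith
  have hκ0 : 0 < κ := by rw [hκ]; positivity
  refine ⟨2 * ((C₁ / s) ^ (κ / (s + κ)) * C₂ ^ (s / (s + κ))), by positivity, fun u hu => ?_⟩
  have hG := hasWeakGradient_weakGradient hu.2.1
  filter_upwards [ae_tendsto_mollify hG.locallyIntegrable, ae_gradMax_lt_top hu] with x hx hM
  have hm0 : 0 ≤ (gradMax u x).toReal := ENNReal.toReal_nonneg
  have hd0 : 0 ≤ (dirichletEnergy u).toReal := ENNReal.toReal_nonneg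
  have he0 : 0 ≤ (coulombEnergy α p u).toReal := ENNReal.toReal_nonneg
  set m := (gradMax u x).toReal
  set D := (dirichletEnergy u).toReal
  set e := (coulombEnergy α p u).toReal
  -- The geometric mean, with weights ε and 1 - ε, of the two derivative bounds. The power of r is
  -- -(1-ε)N/2 = s - 1, integrable at 0 because s > 0.
  have hder : ∀ r, 0 < r → ∃ d, HasDerivAt (fun t => mollify u t x) d r ∧
      |d| ≤ C₁ * (m ^ ε * D ^ ((1 - ε) / 2)) * r ^ (s - 1) := by
    intro r hr
    obtain ⟨d, hd, hd1, hd2⟩ := H₁ hu.2.1 (dirichletEnergy_lt_top_of_mem hu) hM r hr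
    refine ⟨d, hd, ?_⟩
    calc |d| = |d| ^ ε * |d| ^ (1 - ε) := by
          rw [← Real.rpow_add_of_nonneg (abs_nonneg d) hε0.le (by linarith)]
          simp
      _ ≤ (C₁ * m) ^ ε * (C₁ * (D ^ (1 / 2 : ℝ) * r ^ (-(N / 2 : ℝ)))) ^ (1 - ε) := by
          have : 0 ≤ 1 - ε := by linarith
          gcongr
      _ = _ := by
          rw [Real.mul_rpow hC₁.le hm0, Real.mul_rpow hC₁.le (by positivity),
            Real.mul_rpow (by positivity) (by positivity), ← Real.rpow_mul hd0,
            ← Real.rpow_mul hr.le, show -((N : ℝ) / 2) * (1 - ε) = s - 1 by rw [hs]; ring,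
            show (1 / 2 : ℝ) * (1 - ε) = (1 - ε) / 2 by ring]
          have : C₁ = C₁ ^ ε * C₁ ^ (1 - ε) := by
            rw [← Real.rpow_add hC₁]; simp
          nth_rw 3 [this]
          ring
  have h := abs_le_of_deriv_bound_of_decay (U := fun t => mollify u t x) (s := s)
    (κ := κ) (K := C₁ * (m ^ ε * D ^ ((1 - ε) / 2))) (B := C₂ * e ^ (1 / (2 * p))) hs0 hκ0
    (by positivity) (by positivity) hder
    (fun r hr => by rw [hκ]; exact (H₂ hG.locallyIntegrable hu.1.2 x r hr).2) hx
  refine h.trans (le_of_eq ?_)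
  rw [mul_div_right_comm, Real.mul_rpow (by positivity) (by positivity),
    Real.mul_rpow (by positivity) (by positivity), Real.mul_rpow hC₂.le (by positivity),
    ← Real.rpow_mul hm0, ← Real.rpow_mul hd0, ← Real.rpow_mul he0]
  ring

end Pointwise

end CoulombSobolev

namespace CoulombSobolev

/-! ### Integrated estimates at the endpoints, and Hölder interpolation between them. -/

section Integrated

open Set Metric Filter Topology

variable {N : ℕ}

/-- The interpolation estimate with exponents `q` and `θ`. -/
def InterpolationBound (N : ℕ) (α p q θ : ℝ) : Prop :=
  ∃ C : ℝ≥0, ∀ u ∈ coulombSobolevSpace N α p,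
    (∫⁻ x, ‖u x‖ₑ ^ q) ^ (1 / q) ≤
      C * (dirichletEnergy u ^ (θ / 2) * coulombEnergy α p u ^ ((1 - θ) / (2 * p)))

theorem ofReal_toReal_rpow {m : ℝ≥0∞} (hm : m ≠ ⊤) {a : ℝ} (ha : 0 ≤ a) :
    ENNReal.ofReal (m.toReal ^ a) = m ^ a := by
  rw [← ENNReal.ofReal_rpow_of_nonneg ENNReal.toReal_nonneg ha, ENNReal.ofReal_toReal hm]

theorem enorm_le_of_abs_le {y C z : ℝ} {m : ℝ≥0∞} (hm : m ≠ ⊤) {a : ℝ} (ha : 0 ≤ a)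
    (hC : 0 ≤ C) (h : |y| ≤ C * (m.toReal ^ a * z)) :
    ‖y‖ₑ ≤ ENNReal.ofReal C * (m ^ a * ENNReal.ofReal z) := by
  rw [← ofReal_norm, Real.norm_eq_abs]
  refine (ENNReal.ofReal_le_ofReal h).trans ?_
  rw [ENNReal.ofReal_mul hC, ENNReal.ofReal_mul (Real.rpow_nonneg ENNReal.toReal_nonneg _),
    ofReal_toReal_rpow hm ha]

/-- At this exponent the pointwise bound becomes (M²)^(α/(2+α)) (V²)^(2/(2+α)), with M = `gradMax u`
and V the Riesz potential of |u|^p. The weights sum to one, so Hölder and the L² bound for M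
conclude. Nothing excludes the critical line. -/
theorem exists_lintegral_le_endpoint [NeZero N] {α p : ℝ} (hα : 0 < α) (hαN : α < N)
    (hp : 1 ≤ p) : ∃ C : ℝ≥0, ∀ u ∈ coulombSobolevSpace N α p,
      ∫⁻ x, ‖u x‖ₑ ^ (2 * (2 * p + α) / (2 + α)) ≤
        C * (dirichletEnergy u ^ (α / (2 + α)) * coulombEnergy α p u ^ (2 / (2 + α))) := by
  obtain ⟨C, hC0, hC⟩ := exists_abs_le_gradMax_rieszPotential hα hαN hp
  have hp0 : 0 < p := by linarith
  set q := 2 * (2 * p + α) / (2 + α) with hq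
  have hq0 : 0 < q := by positivity
  have ht0 : 0 ≤ α / (2 + α) := by positivity
  have hc1 : ENNReal.ofReal C ^ q ≠ ⊤ :=
    ENNReal.rpow_ne_top_of_nonneg hq0.le ENNReal.ofReal_ne_top
  have hc2 : (8 * ENNReal.ofReal (4 ^ N)) ^ (α / (2 + α)) ≠ ⊤ :=
    ENNReal.rpow_ne_top_of_nonneg ht0 (ENNReal.mul_ne_top (by norm_num) ENNReal.ofReal_ne_top)
  refine ⟨(ENNReal.ofReal C ^ q * (8 * ENNReal.ofReal (4 ^ N)) ^ (α / (2 + α))).toNNReal,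
    fun u hu => ?_⟩
  rw [ENNReal.coe_toNNReal (ENNReal.mul_ne_top hc1 hc2)]
  have hM := measurable_gradMax hu.2.1
  have hV := measurable_rieszPotential hu.1.1 (α / 2) p
  calc ∫⁻ x, ‖u x‖ₑ ^ q
      ≤ ∫⁻ x, ENNReal.ofReal C ^ q * ((gradMax u x ^ 2) ^ (α / (2 + α)) *
          (rieszPotential (α / 2) p u x ^ 2) ^ (2 / (2 + α))) := by
        refine lintegral_mono_ae ?_
        filter_upwards [hC u hu, ae_gradMax_lt_top hu, ae_rieszPotential_lt_top hu] with x hx hm hv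
        have h1 := enorm_le_of_abs_le hm.ne (by positivity) hC0.le hx
        rw [ofReal_toReal_rpow hv.ne (by positivity)] at h1
        refine (ENNReal.rpow_le_rpow h1 hq0.le).trans (le_of_eq ?_)
        rw [ENNReal.mul_rpow_of_nonneg _ _ hq0.le, ENNReal.mul_rpow_of_nonneg _ _ hq0.le,
          ← ENNReal.rpow_mul, ← ENNReal.rpow_mul, ← ENNReal.rpow_natCast, ← ENNReal.rpow_natCast,
          ← ENNReal.rpow_mul, ← ENNReal.rpow_mul]
        congr 3 <;>
        · rw [hq]; push_cast; field_simp
    _ = ENNReal.ofReal C ^ q * ∫⁻ x, ((gradMax u x ^ 2) ^ (α / (2 + α)) *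
          (rieszPotential (α / 2) p u x ^ 2) ^ (2 / (2 + α))) := lintegral_const_mul' _ _ hc1
    _ ≤ ENNReal.ofReal C ^ q * ((∫⁻ x, gradMax u x ^ 2) ^ (α / (2 + α)) *
          (∫⁻ x, rieszPotential (α / 2) p u x ^ 2) ^ (2 / (2 + α))) := by
        gcongr
        exact ENNReal.lintegral_mul_norm_pow_le (hM.pow_const 2).aemeasurable
          (hV.pow_const 2).aemeasurable ht0 (by positivity) (by field_simp; ring)
    _ ≤ ENNReal.ofReal C ^ q * ((8 * ENNReal.ofReal (4 ^ N) * dirichletEnergy u) ^ (α / (2 + α)) *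
          coulombEnergy α p u ^ (2 / (2 + α))) := by
        gcongr
        · exact lintegral_gradMax_sq_le hu.2.1
        · exact le_rfl
    _ = _ := by
        rw [ENNReal.mul_rpow_of_nonneg _ _ ht0]
        ring

theorem interpolationBound_endpoint [NeZero N] {α p : ℝ} (hα : 0 < α) (hαN : α < N)
    (hp : 1 ≤ p) :
    InterpolationBound N α p (2 * (2 * p + α) / (2 + α)) (α / (2 * p + α)) := by
  obtain ⟨C, hC⟩ := exists_lintegral_le_endpoint hα hαN hp
  have hp0 : 0 < p := by linarith
  set q := 2 * (2 * p + α) / (2 + α) with hq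
  have hq0 : 0 < q := by positivity
  have hq1 : 0 ≤ 1 / q := by positivity
  refine ⟨C ^ (1 / q), fun u hu => ?_⟩
  refine (ENNReal.rpow_le_rpow (hC u hu) hq1).trans (le_of_eq ?_)
  rw [ENNReal.mul_rpow_of_nonneg _ _ hq1, ENNReal.mul_rpow_of_nonneg _ _ hq1,
    ← ENNReal.rpow_mul, ← ENNReal.rpow_mul, ENNReal.coe_rpow_of_nonneg _ hq1]
  congr 3
  · rw [hq]; field_simp
  · rw [hq]; field_simp; ring

/-- The power 2/q is the one whose q-th power is the square that the L² bound for the maximal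
function controls; Z stands for a factor independent of x. -/
theorem lintegral_rpow_le_of_enorm_le_gradMax [NeZero N] {u : EuclideanSpace ℝ (Fin N) → ℝ}
    (hu : WeaklyDifferentiable u) {q : ℝ} (hq : 0 < q) {c Z : ℝ≥0∞}
    (h : ∀ᵐ x, ‖u x‖ₑ ≤ c * (gradMax u x ^ (2 / q) * Z)) :
    (∫⁻ x, ‖u x‖ₑ ^ q) ^ (1 / q) ≤
      c * (8 * ENNReal.ofReal (4 ^ N)) ^ (1 / q) * (dirichletEnergy u ^ (1 / q) * Z) := by
  have hq1 : 0 ≤ 1 / q := by positivity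
  have h1 : ∫⁻ x, ‖u x‖ₑ ^ q ≤
      (8 * ENNReal.ofReal (4 ^ N) * dirichletEnergy u) * (c ^ q * Z ^ q) := by
    calc ∫⁻ x, ‖u x‖ₑ ^ q ≤ ∫⁻ x, gradMax u x ^ 2 * (c ^ q * Z ^ q) := by
          refine lintegral_mono_ae ?_
          filter_upwards [h] with x hx
          refine (ENNReal.rpow_le_rpow hx hq.le).trans (le_of_eq ?_)
          rw [ENNReal.mul_rpow_of_nonneg _ _ hq.le, ENNReal.mul_rpow_of_nonneg _ _ hq.le,
            ← ENNReal.rpow_mul, div_mul_cancel₀ _ hq.ne', ENNReal.rpow_two]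
          ring
      _ = (∫⁻ x, gradMax u x ^ 2) * (c ^ q * Z ^ q) :=
          lintegral_mul_const _ ((measurable_gradMax hu).pow_const 2)
      _ ≤ _ := by
          gcongr
          exact lintegral_gradMax_sq_le hu
  refine (ENNReal.rpow_le_rpow h1 hq1).trans (le_of_eq ?_)
  generalize 8 * ENNReal.ofReal (4 ^ N) = K
  rw [ENNReal.mul_rpow_of_nonneg _ _ hq1, ENNReal.mul_rpow_of_nonneg _ _ hq1,
    ENNReal.mul_rpow_of_nonneg _ _ hq1, ← ENNReal.rpow_mul, ← ENNReal.rpow_mul,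
    mul_one_div_cancel hq.ne', ENNReal.rpow_one, ENNReal.rpow_one]
  ring

theorem interpolationBound_sobolev [NeZero N] (hN : 3 ≤ N) {α p : ℝ} (hα : 0 < α)
    (hαN : α < N) (hp : 1 ≤ p) : InterpolationBound N α p (2 * N / ((N : ℝ) - 2)) 1 := by
  obtain ⟨C, hC0, hC⟩ := exists_abs_le_gradMax_dirichletEnergy hN hα hαN hp
  have hN' : (3 : ℝ) ≤ N := by exact_mod_cast hN
  have hN0 : (0 : ℝ) < N := by linarith
  have hN2 : (0 : ℝ) < N - 2 := by linarith
  set q := 2 * N / ((N : ℝ) - 2) with hq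
  have hq0 : 0 < q := by positivity
  have e1 : 1 - 2 / (N : ℝ) = 2 / q := by rw [hq]; field_simp
  have hfin : ENNReal.ofReal C * (8 * ENNReal.ofReal (4 ^ N)) ^ (1 / q) ≠ ⊤ :=
    ENNReal.mul_ne_top ENNReal.ofReal_ne_top (ENNReal.rpow_ne_top_of_nonneg (by positivity)
      (ENNReal.mul_ne_top (by norm_num) ENNReal.ofReal_ne_top))
  refine ⟨(ENNReal.ofReal C * (8 * ENNReal.ofReal (4 ^ N)) ^ (1 / q)).toNNReal, fun u hu => ?_⟩
  have hD := dirichletEnergy_lt_top_of_mem hu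
  have h := lintegral_rpow_le_of_enorm_le_gradMax hu.2.1 hq0 (c := ENNReal.ofReal C)
    (Z := dirichletEnergy u ^ (1 / (N : ℝ))) (by
      filter_upwards [hC u hu, ae_gradMax_lt_top hu] with x hx hm
      have h1 := enorm_le_of_abs_le hm.ne (by rw [e1]; positivity) hC0.le hx
      rwa [ofReal_toReal_rpow hD.ne (by positivity), e1] at h1)
  rw [ENNReal.coe_toNNReal hfin]
  refine h.trans (le_of_eq ?_)
  rw [← ENNReal.rpow_add_of_nonneg _ _ (by positivity) (by positivity), sub_self, zero_div,
    ENNReal.rpow_zero, mul_one]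
  congr 2
  rw [hq]; field_simp; ring

/-- The substitute for the Sobolev endpoint when N ≤ 2: then s > 0 for every ε in (0, 1], and q → ∞
as ε → 0, while θ tends to 1 if N = 2 and to (1+α)/(1+α+p) if N = 1. -/
theorem interpolationBound_large [NeZero N] {α p ε s κ : ℝ} (hα : 0 < α) (hαN : α < N)
    (hp : 1 ≤ p) (hε0 : 0 < ε) (hε1 : ε ≤ 1) (hs : s = 1 - (1 - ε) * N / 2) (hs0 : 0 < s)
    (hκ : κ = (α + N) / (2 * p)) :
    InterpolationBound N α p (2 * (s + κ) / (ε * κ)) (κ / (s + κ)) := by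
  obtain ⟨C, hC0, hC⟩ := exists_abs_le_gradMax_coulombEnergy hα hαN hp hε0 hε1 hs hs0 hκ
  have hp0 : 0 < p := by linarith
  have hN0 : (0 : ℝ) < N := by linarith
  have hκ0 : 0 < κ := by rw [hκ]; positivity
  have hε2 : 0 ≤ 1 - ε := by linarith
  set q := 2 * (s + κ) / (ε * κ) with hq
  have hq0 : 0 < q := by positivity
  have e1 : ε * (κ / (s + κ)) = 2 / q := by rw [hq]; field_simp
  have hfin : ENNReal.ofReal C * (8 * ENNReal.ofReal (4 ^ N)) ^ (1 / q) ≠ ⊤ :=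
    ENNReal.mul_ne_top ENNReal.ofReal_ne_top (ENNReal.rpow_ne_top_of_nonneg (by positivity)
      (ENNReal.mul_ne_top (by norm_num) ENNReal.ofReal_ne_top))
  refine ⟨(ENNReal.ofReal C * (8 * ENNReal.ofReal (4 ^ N)) ^ (1 / q)).toNNReal, fun u hu => ?_⟩
  have hD := dirichletEnergy_lt_top_of_mem hu
  have h := lintegral_rpow_le_of_enorm_le_gradMax hu.2.1 hq0 (c := ENNReal.ofReal C)
    (Z := dirichletEnergy u ^ ((1 - ε) / 2 * (κ / (s + κ))) *
      coulombEnergy α p u ^ (1 / (2 * p) * (s / (s + κ)))) (by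
      filter_upwards [hC u hu, ae_gradMax_lt_top hu] with x hx hm
      have h1 := enorm_le_of_abs_le hm.ne (by positivity) hC0.le hx
      rwa [ENNReal.ofReal_mul (by positivity), ofReal_toReal_rpow hD.ne (by positivity),
        ofReal_toReal_rpow hu.1.2.ne (by positivity), e1] at h1)
  rw [ENNReal.coe_toNNReal hfin]
  refine h.trans (le_of_eq ?_)
  rw [← mul_assoc (dirichletEnergy u ^ (1 / q)),
    ← ENNReal.rpow_add_of_nonneg _ _ (by positivity) (by positivity)]
  congr 3
  · rw [hq]; field_simp; ring
  · field_simp; ring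

theorem lintegral_rpow_interpolate {X : Type*} [MeasurableSpace X] {μ : Measure X} {f : X → ℝ≥0∞}
    (hf : AEMeasurable f μ) {q₀ q₁ q s : ℝ} (hq₀ : 0 < q₀) (hq₁ : 0 < q₁) (hq : 0 < q)
    (hs0 : 0 ≤ s) (hs1 : s ≤ 1) (h : 1 / q = s / q₀ + (1 - s) / q₁) :
    (∫⁻ x, f x ^ q ∂μ) ^ (1 / q) ≤ ((∫⁻ x, f x ^ q₀ ∂μ) ^ (1 / q₀)) ^ s *
      ((∫⁻ x, f x ^ q₁ ∂μ) ^ (1 / q₁)) ^ (1 - s) := by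
  have hs2 : 0 ≤ 1 - s := by linarith
  have hsum : s * q / q₀ + (1 - s) * q / q₁ = 1 := by
    have : s * q / q₀ + (1 - s) * q / q₁ = q * (s / q₀ + (1 - s) / q₁) := by ring
    rw [this, ← h, mul_one_div_cancel hq.ne']
  have e0 : q₀ * (s * q / q₀) = s * q := by field_simp
  have e1 : q₁ * ((1 - s) * q / q₁) = (1 - s) * q := by field_simp
  have h1 := ENNReal.lintegral_mul_norm_pow_le (hf.pow_const q₀) (hf.pow_const q₁)
    (p := s * q / q₀) (q := (1 - s) * q / q₁) (by positivity) (by positivity) hsum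
  have h2 : ∀ x, (f x ^ q₀) ^ (s * q / q₀) * (f x ^ q₁) ^ ((1 - s) * q / q₁) = f x ^ q := by
    intro x
    rw [← ENNReal.rpow_mul, ← ENNReal.rpow_mul, e0, e1,
      ← ENNReal.rpow_add_of_nonneg _ _ (by positivity) (by positivity)]
    congr 1; ring
  simp_rw [h2] at h1
  refine (ENNReal.rpow_le_rpow h1 (by positivity)).trans (le_of_eq ?_)
  rw [ENNReal.mul_rpow_of_nonneg _ _ (by positivity), ← ENNReal.rpow_mul, ← ENNReal.rpow_mul,
    ← ENNReal.rpow_mul, ← ENNReal.rpow_mul]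
  congr 2 <;> field_simp

theorem InterpolationBound.interpolate {α p q₀ q₁ q θ₀ θ₁ θ s : ℝ} (hp : 0 < p)
    (h₀ : InterpolationBound N α p q₀ θ₀) (h₁ : InterpolationBound N α p q₁ θ₁)
    (hq₀ : 0 < q₀) (hq₁ : 0 < q₁) (hq : 0 < q) (hs0 : 0 ≤ s) (hs1 : s ≤ 1)
    (hθ₀ : θ₀ ∈ Icc (0 : ℝ) 1) (hθ₁ : θ₁ ∈ Icc (0 : ℝ) 1)
    (h : 1 / q = s / q₀ + (1 - s) / q₁) (hθ : θ = s * θ₀ + (1 - s) * θ₁) :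
    InterpolationBound N α p q θ := by
  obtain ⟨C₀, hC₀⟩ := h₀
  obtain ⟨C₁, hC₁⟩ := h₁
  have hs2 : 0 ≤ 1 - s := by linarith
  have a0 := hθ₀.1
  have a1 := hθ₁.1
  have b0 : 0 ≤ 1 - θ₀ := by linarith [hθ₀.2]
  have b1 : 0 ≤ 1 - θ₁ := by linarith [hθ₁.2]
  refine ⟨C₀ ^ s * C₁ ^ (1 - s), fun u hu => ?_⟩
  refine (lintegral_rpow_interpolate hu.1.1.enorm hq₀ hq₁ hq hs0 hs1 h).trans ?_
  refine (mul_le_mul' (ENNReal.rpow_le_rpow (hC₀ u hu) hs0)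
    (ENNReal.rpow_le_rpow (hC₁ u hu) hs2)).trans (le_of_eq ?_)
  rw [ENNReal.mul_rpow_of_nonneg _ _ hs0, ENNReal.mul_rpow_of_nonneg _ _ hs0,
    ENNReal.mul_rpow_of_nonneg _ _ hs2, ENNReal.mul_rpow_of_nonneg _ _ hs2,
    ← ENNReal.rpow_mul, ← ENNReal.rpow_mul, ← ENNReal.rpow_mul, ← ENNReal.rpow_mul,
    show θ / 2 = θ₀ / 2 * s + θ₁ / 2 * (1 - s) by rw [hθ]; ring,
    show (1 - θ) / (2 * p) = (1 - θ₀) / (2 * p) * s + (1 - θ₁) / (2 * p) * (1 - s) by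
      rw [hθ]; field_simp; ring,
    ENNReal.rpow_add_of_nonneg _ _ (by positivity) (by positivity),
    ENNReal.rpow_add_of_nonneg _ _ (by positivity) (by positivity),
    ENNReal.coe_mul, ENNReal.coe_rpow_of_nonneg _ hs0, ENNReal.coe_rpow_of_nonneg _ hs2]
  ring

end Integrated

end CoulombSobolev

namespace CoulombSobolev

/-! ### Condition (Q) implies the interpolation estimate and the embedding. -/

section Sufficiency

variable {N : ℕ}

/-- Since 1/q is affine in θ, the Hölder weight can be read off from the position of θ between θ₀
and θ₁. -/
theorem InterpolationBound.interpolate_of_affine {α p q₀ q₁ q θ₀ θ₁ θ a b : ℝ} (hp : 0 < p)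
    (h₀ : InterpolationBound N α p q₀ θ₀) (h₁ : InterpolationBound N α p q₁ θ₁)
    (hq₀ : 0 < q₀) (hq₁ : 0 < q₁) (hq : 0 < q) (hθ₀ : 0 ≤ θ₀) (hθ₁ : θ₁ ≤ 1)
    (hθ₀θ : θ₀ ≤ θ) (hθθ₁ : θ ≤ θ₁) (e₀ : 1 / q₀ = θ₀ * a + (1 - θ₀) * b)
    (e₁ : 1 / q₁ = θ₁ * a + (1 - θ₁) * b) (e : 1 / q = θ * a + (1 - θ) * b) :
    InterpolationBound N α p q θ := by
  rcases (hθ₀θ.trans hθθ₁).eq_or_lt with h01 | h01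
  · obtain rfl : θ = θ₀ := le_antisymm (hθθ₁.trans h01.ge) hθ₀θ
    have : q = q₀ := by
      rw [← one_div_one_div q, e, ← e₀, one_div_one_div]
    rwa [this]
  · have hd : 0 < θ₁ - θ₀ := by linarith
    have hs1 : 1 - (θ₁ - θ) / (θ₁ - θ₀) = (θ - θ₀) / (θ₁ - θ₀) := by field_simp; ring
    refine h₀.interpolate (s := (θ₁ - θ) / (θ₁ - θ₀)) hp h₁ hq₀ hq₁ hq
      (div_nonneg (by linarith) hd.le) ((div_le_one hd).2 (by linarith))
      ⟨hθ₀, by linarith⟩ ⟨by linarith, hθ₁⟩ ?_ ?_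
    · rw [div_eq_mul_one_div _ q₀, div_eq_mul_one_div _ q₁, e, e₀, e₁, hs1]
      field_simp
      ring
    · rw [hs1]
      field_simp
      ring

theorem one_div_endpoint {α p : ℝ} (hα : 0 < α) (hp : 0 < p) (hN : (0 : ℝ) < N) :
    1 / (2 * (2 * p + α) / (2 + α)) = α / (2 * p + α) * (1 / 2 - 1 / (N : ℝ))
      + (1 - α / (2 * p + α)) * ((N + α) / (2 * N * p)) := by
  field_simp
  ring

theorem endpoint_eq {α p : ℝ} (hα : 0 < α) (hp : 0 < p) :
    1 / 2 - (p - 1) / (α + 2 * p) = 1 / (2 * (2 * p + α) / (2 + α)) := by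
  field_simp
  ring

theorem interpolationBound_of_affine [NeZero N] {α p q θ : ℝ} (hα : 0 < α) (hαN : α < N)
    (hp : 1 ≤ p) (hq : 1 ≤ q) (hθ₀ : α / (2 * p + α) ≤ θ) (hθ₁ : θ ≤ 1)
    (e : 1 / q = θ * (1 / 2 - 1 / (N : ℝ)) + (1 - θ) * ((N + α) / (2 * N * p))) :
    InterpolationBound N α p q θ := by
  have hp0 : 0 < p := by linarith
  have hq0 : 0 < q := by linarith
  have hN0 : (0 : ℝ) < N := by linarith
  have hq1 : 0 < 1 / q := by positivity
  have hθp : 0 < θ := lt_of_lt_of_le (by positivity) hθ₀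
  rcases le_or_gt 3 N with hN | hN
  · have hN' : (3 : ℝ) ≤ N := by exact_mod_cast hN
    have hN2 : (0 : ℝ) < N - 2 := by linarith
    refine (interpolationBound_endpoint hα hαN hp).interpolate_of_affine hp0
      (interpolationBound_sobolev hN hα hαN hp) (by positivity) (by positivity) hq0
      (by positivity) le_rfl hθ₀ hθ₁ (one_div_endpoint hα hp0 hN0) ?_ e
    field_simp
    ring
  · have hN' : (N : ℝ) ≤ 2 := by exact_mod_cast Nat.lt_succ_iff.1 hN
    set κ := (α + N) / (2 * p) with hκ
    have hκ0 : 0 < κ := by positivity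
    have hk : ((N : ℝ) + α) / (2 * N * p) = κ / N := by rw [hκ]; field_simp; ring
    rw [hk] at e
    -- This is 1/q > 0 in disguise: finiteness of q bounds θ strictly away from the limiting value.
    have hpos : θ * (1 - (N : ℝ) / 2) < (1 - θ) * κ := by
      have h1 : 0 < N * (θ * (1 / 2 - 1 / (N : ℝ)) + (1 - θ) * (κ / N)) := by
        rw [← e]; positivity
      have h2 : N * (θ * (1 / 2 - 1 / (N : ℝ)) + (1 - θ) * (κ / N))
          = (1 - θ) * κ - θ * (1 - (N : ℝ) / 2) := by field_simp; ring
      linarith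
    -- Chosen so that s = 1 - N/2 + εN/2 is at most κ(1-θ)/θ, which says θ ≤ κ/(s+κ): the
    -- large-exponent endpoint lies beyond θ.
    set ε := min 1 (2 / N * (κ * (1 - θ) / θ - (1 - (N : ℝ) / 2))) with hε
    have hε0 : 0 < ε := by
      refine lt_min one_pos (mul_pos (by positivity) ?_)
      rw [sub_pos, lt_div_iff₀ hθp]
      linarith
    have hε1 : ε ≤ 1 := min_le_left _ _
    set s := 1 - (1 - ε) * N / 2 with hs
    have hs0 : 0 < s := by
      rw [hs]
      nlinarith
    have hsθ : s ≤ κ * (1 - θ) / θ := by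
      have h1 : ε ≤ 2 / N * (κ * (1 - θ) / θ - (1 - (N : ℝ) / 2)) := min_le_right _ _
      have h2 : ε * (N / 2) ≤ κ * (1 - θ) / θ - (1 - (N : ℝ) / 2) := by
        calc ε * (N / 2) ≤ 2 / N * (κ * (1 - θ) / θ - (1 - (N : ℝ) / 2)) * (N / 2) := by gcongr
          _ = _ := by field_simp
      rw [hs]
      linarith
    have hθs : θ ≤ κ / (s + κ) := by
      rw [le_div_iff₀ hθp] at hsθ
      rw [le_div_iff₀ (by positivity)]
      linarith
    refine (interpolationBound_endpoint hα hαN hp).interpolate_of_affine hp0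
      (interpolationBound_large hα hαN hp hε0 hε1 hs hs0 hκ) (by positivity) (by positivity) hq0
      (by positivity) ((div_le_one (by positivity)).2 (by linarith)) hθ₀ hθs
      (by rw [one_div_endpoint hα hp0 hN0, hk]) ?_ e
    have h3 : ε = (s - 1 + N / 2) * (2 / N) := by rw [hs]; field_simp; ring
    rw [h3]
    have h4 : 0 < s - 1 + N / 2 := by
      have : s - 1 + N / 2 = ε * (N / 2) := by rw [hs]; ring
      rw [this]; positivity
    field_simp
    ring

/-- Under `(Q)` and off the critical line, the exponent `θ` exists, lies in the stated range, and
the interpolation estimate holds. -/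
theorem exists_interpolationBound_of_conditionQ [NeZero N] {α p q : ℝ} (hα : 0 < α) (hαN : α < N)
    (hp : 1 ≤ p) (hq : 1 ≤ q) (hQ : ConditionQ N α p q) (hne : α + N ≠ p * ((N : ℝ) - 2)) :
    ∃ θ : ℝ, 1 / q = θ * (1 / 2 - 1 / (N : ℝ)) + (1 - θ) * ((N + α) / (2 * N * p)) ∧
      α / (2 * p + α) ≤ θ ∧ θ ≤ 1 ∧ InterpolationBound N α p q θ := by
  have hp0 : 0 < p := by linarith
  have hN0 : (0 : ℝ) < N := by linarith
  have hNα : 0 < (N : ℝ) + α := by linarith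
  set a := 1 / 2 - 1 / (N : ℝ) with ha
  set b := ((N : ℝ) + α) / (2 * N * p) with hb
  have hba : b - a = (α + N - p * (N - 2)) / (2 * N * p) := by
    rw [ha, hb]; field_simp; ring
  have hend : 1 / 2 - (p - 1) / (α + 2 * p) = α / (2 * p + α) * a + (1 - α / (2 * p + α)) * b := by
    rw [endpoint_eq hα hp0, one_div_endpoint hα hp0 hN0]
  have hba0 : b - a ≠ 0 := by
    rw [hba]
    exact div_ne_zero (sub_ne_zero.2 hne) (by positivity)
  set θ := (b - 1 / q) / (b - a) with hθ
  have e : 1 / q = θ * a + (1 - θ) * b := by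
    have : θ * (b - a) = b - 1 / q := by rw [hθ]; field_simp
    linarith
  -- The two alternatives of (Q) are the two signs of b - a. Dividing by b - a reverses the
  -- inequalities in the second one, so both yield the same range for θ.
  have hbd : α / (2 * p + α) ≤ θ ∧ θ ≤ 1 := by
    rcases hQ with ⟨h1, h2, h3⟩ | ⟨h1, h2, h3⟩
    · have hpos : 0 < b - a := by
        refine lt_of_le_of_ne ?_ hba0.symm
        rw [hba]
        refine div_nonneg ?_ (by positivity)
        rw [ge_iff_le, div_le_div_iff₀ hNα hp0] at h1
        nlinarith [le_max_left ((N : ℝ) - 2) 0]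
      rw [hend] at h3
      constructor
      · rw [hθ, le_div_iff₀ hpos]
        linarith
      · rw [hθ, div_le_one hpos]
        linarith
    · have hneg : b - a < 0 := by
        rw [hba]
        refine div_neg_of_neg_of_pos ?_ (by positivity)
        rw [div_lt_div_iff₀ hp0 hNα] at h1
        rcases le_total ((N : ℝ) - 2) 0 with h | h
        · rw [max_eq_right h] at h1; linarith
        · rw [max_eq_left h] at h1; linarith
      rw [hend] at h3
      constructor
      · rw [hθ, le_div_iff_of_neg hneg]
        linarith
      · rw [hθ, div_le_one_of_neg hneg]
        linarith
  exact ⟨θ, e, hbd.1, hbd.2, interpolationBound_of_affine hα hαN hp hq hbd.1 hbd.2 e⟩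

/-- Each energy, suitably normalised, is at most the squared norm, and the exponents θ/2 and (1-θ)/2
add up to 1/2. -/
theorem InterpolationBound.continuouslyEmbedded {α p q θ : ℝ} (hp : 0 < p) (hq : 0 < q)
    (hθ0 : 0 ≤ θ) (hθ1 : θ ≤ 1) (h : InterpolationBound N α p q θ) :
    ContinuouslyEmbedded N α p q := by
  obtain ⟨C, hC⟩ := h
  have hθ2 : 0 ≤ 1 - θ := by linarith
  refine ⟨C, fun u hu => ?_⟩
  have e1 : eLpNorm u (ENNReal.ofReal q) volume = (∫⁻ x, ‖u x‖ₑ ^ q) ^ (1 / q) := by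
    rw [eLpNorm_eq_lintegral_rpow_enorm_toReal (by simpa using hq) ENNReal.ofReal_ne_top,
      ENNReal.toReal_ofReal hq.le]
  have h1 : eLpNorm u (ENNReal.ofReal q) volume ≤ C * coulombSobolevNorm α p u := by
    rw [e1]
    refine (hC u hu).trans ?_
    gcongr
    set S := dirichletEnergy u + coulombEnergy α p u ^ (1 / p) with hS
    have e2 : coulombEnergy α p u ^ ((1 - θ) / (2 * p))
        = (coulombEnergy α p u ^ (1 / p)) ^ ((1 - θ) / 2) := by
      rw [← ENNReal.rpow_mul]
      congr 1; field_simp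
    calc _ ≤ S ^ (θ / 2) * S ^ ((1 - θ) / 2) := by
          rw [e2]
          gcongr
          · exact le_self_add
          · exact le_add_self
      _ = S ^ (1 / 2 : ℝ) := by
          rw [← ENNReal.rpow_add_of_nonneg _ _ (by positivity) (by positivity)]
          congr 1; ring
  refine ⟨⟨hu.1.1, ?_⟩, h1⟩
  rw [e1]
  refine (hC u hu).trans_lt (ENNReal.mul_lt_top ENNReal.coe_lt_top (ENNReal.mul_lt_top ?_ ?_))
  · exact ENNReal.rpow_lt_top_of_nonneg (by positivity) (dirichletEnergy_lt_top_of_mem hu).ne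
  · exact ENNReal.rpow_lt_top_of_nonneg (by positivity) hu.1.2.ne

theorem ConditionQ.continuouslyEmbedded [NeZero N] {α p q : ℝ} (hα : 0 < α) (hαN : α < N)
    (hp : 1 ≤ p) (hq : 1 ≤ q) (hQ : ConditionQ N α p q) : ContinuouslyEmbedded N α p q := by
  have hp0 : 0 < p := by linarith
  have hq0 : 0 < q := by linarith
  have hN0 : (0 : ℝ) < N := by linarith
  -- On the critical line the two bounds of (Q) coincide and force the Sobolev exponent; θ is no
  -- longer determined by q, and θ = 1 is used.
  by_cases hc : α + N = p * ((N : ℝ) - 2)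
  · have hN2 : 0 < (N : ℝ) - 2 := by
      by_contra h
      nlinarith
    have hN3 : 3 ≤ N := by
      have : (2 : ℝ) < N := by linarith
      exact_mod_cast this
    have hend : 1 / 2 - (p - 1) / (α + 2 * p) = 1 / 2 - 1 / (N : ℝ) := by
      have : α = p * ((N : ℝ) - 2) - N := by linarith
      have h2 : α + 2 * p = N * (p - 1) := by rw [this]; ring
      have h3 : 0 < p - 1 := by
        have : 0 < (N : ℝ) * (p - 1) := by rw [← h2]; positivity
        exact (mul_pos_iff_of_pos_left hN0).1 this
      rw [h2]; field_simp
    have hq' : 1 / q = 1 / 2 - 1 / (N : ℝ) := by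
      rcases hQ with ⟨-, h2, h3⟩ | ⟨-, h2, h3⟩
      · rw [hend] at h3; exact le_antisymm h3 h2
      · rw [hend] at h3; exact le_antisymm h2 h3
    have hqe : q = 2 * N / ((N : ℝ) - 2) := by
      rw [← one_div_one_div q, hq']
      field_simp
    rw [hqe] at hq0 ⊢
    exact (interpolationBound_sobolev hN3 hα hαN hp).continuouslyEmbedded hp0 hq0 zero_le_one le_rfl
  · obtain ⟨θ, -, h1, h2, h3⟩ := exists_interpolationBound_of_conditionQ hα hαN hp hq hQ hc
    exact h3.continuouslyEmbedded hp0 hq0 (le_trans (by positivity) h1) h2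

end Sufficiency

end CoulombSobolev

namespace CoulombSobolev

/-! ### Smooth test functions: membership in the space and finite Coulomb energy. -/

section TestFunctions

open Set Metric Filter Topology

variable {N : ℕ}

theorem gradient_apply (v : EuclideanSpace ℝ (Fin N) → ℝ) (x : EuclideanSpace ℝ (Fin N))
    (i : Fin N) : gradient v x i = fderiv ℝ v x (EuclideanSpace.single i 1) := by
  rw [← inner_gradient_left, EuclideanSpace.inner_single_right]
  simp

theorem norm_gradient (v : EuclideanSpace ℝ (Fin N) → ℝ) (x : EuclideanSpace ℝ (Fin N)) :
    ‖gradient v x‖ = ‖fderiv ℝ v x‖ := by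
  rw [gradient, LinearIsometryEquiv.norm_map]

theorem continuous_gradient {v : EuclideanSpace ℝ (Fin N) → ℝ} (hv : ContDiff ℝ ∞ v) :
    Continuous (gradient v) :=
  (InnerProductSpace.toDual ℝ _).symm.continuous.comp (hv.continuous_fderiv (by simp))

theorem hasCompactSupport_gradient {v : EuclideanSpace ℝ (Fin N) → ℝ} (hc : HasCompactSupport v) :
    HasCompactSupport (gradient v) :=
  (hc.fderiv (𝕜 := ℝ)).comp_left (g := (InnerProductSpace.toDual ℝ _).symm) (map_zero _)

theorem hasWeakGradient_gradient {v : EuclideanSpace ℝ (Fin N) → ℝ} (hv : ContDiff ℝ ∞ v) :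
    HasWeakGradient v (gradient v) where
  locallyIntegrable := hv.continuous.locallyIntegrable
  locallyIntegrable_grad := (continuous_gradient hv).locallyIntegrable
  integral_eq := by
    intro φ hφ hφc i
    have hc1 : Continuous fun x => fderiv ℝ v x (EuclideanSpace.single i 1) :=
      (hv.continuous_fderiv (by simp)).clm_apply continuous_const
    have hc2 : Continuous fun x => fderiv ℝ φ x (EuclideanSpace.single i 1) :=
      (hφ.continuous_fderiv (by simp)).clm_apply continuous_const
    simp_rw [gradient_apply]
    refine integral_mul_fderiv_eq_neg_fderiv_mul_of_integrable ?_ ?_ ?_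
      (fun x _ => hv.differentiable (by simp) x) (fun x _ => hφ.differentiable (by simp) x)
    · exact (hc1.mul hφ.continuous).integrable_of_hasCompactSupport hφc.mul_left
    · exact (hv.continuous.mul hc2).integrable_of_hasCompactSupport
        (hφc.fderiv_apply (𝕜 := ℝ) _).mul_left
    · exact (hv.continuous.mul hφ.continuous).integrable_of_hasCompactSupport hφc.mul_left

theorem weakGradient_ae_eq {v : EuclideanSpace ℝ (Fin N) → ℝ} (hv : ContDiff ℝ ∞ v) :
    weakGradient v =ᵐ[volume] gradient v :=
  (hasWeakGradient_weakGradient ⟨_, hasWeakGradient_gradient hv⟩).ae_eq (hasWeakGradient_gradient hv)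

theorem dirichletEnergy_eq {v : EuclideanSpace ℝ (Fin N) → ℝ} (hv : ContDiff ℝ ∞ v) :
    dirichletEnergy v = ∫⁻ x, ‖fderiv ℝ v x‖ₑ ^ 2 := by
  refine lintegral_congr_ae ?_
  filter_upwards [weakGradient_ae_eq hv] with x hx
  rw [hx, ← ofReal_norm, norm_gradient, ofReal_norm]

theorem mem_coulombSobolevSpace {v : EuclideanSpace ℝ (Fin N) → ℝ} (hv : ContDiff ℝ ∞ v)
    (hc : HasCompactSupport v) {α p : ℝ} (hE : coulombEnergy α p v < ⊤) :
    v ∈ coulombSobolevSpace N α p :=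
  ⟨⟨hv.continuous.aestronglyMeasurable, hE⟩, ⟨_, hasWeakGradient_gradient hv⟩,
    (memLp_congr_ae (weakGradient_ae_eq hv)).2
      ((continuous_gradient hv).memLp_of_hasCompactSupport (hasCompactSupport_gradient hc))⟩

theorem lintegral_ball_rieszKernel_lt_top [NeZero N] {β : ℝ} (hβ : 0 < β) (R : ℝ) :
    ∫⁻ z in ball (0 : EuclideanSpace ℝ (Fin N)) R, ENNReal.ofReal (rieszKernel N β z) < ⊤ := by
  have h1 : IntegrableOn (fun z : EuclideanSpace ℝ (Fin N) => ‖z‖ ^ (β - (N : ℝ))) (ball 0 R) := by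
    rw [integrableOn_fun_norm_addHaar volume (f := fun t => t ^ (β - (N : ℝ)))]
    have h2 : IntegrableOn (fun t : ℝ => t ^ (β - 1)) (Ioo 0 R) := by
      rcases le_or_gt R 0 with hR | hR
      · rw [Ioo_eq_empty (not_lt.2 hR)]; exact integrableOn_empty
      · exact (intervalIntegral.integrableOn_Ioo_rpow_iff hR).2 (by linarith)
    refine h2.congr_fun (fun t ht => ?_) measurableSet_Ioo
    have ht0 : 0 < t := ht.1
    simp only [finrank_euclideanSpace, Fintype.card_fin, smul_eq_mul]
    rw [← Real.rpow_natCast, ← Real.rpow_add ht0, Nat.cast_sub (NeZero.one_le)]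
    congr 1; push_cast; ring
  exact (h1.const_mul (rieszConst N β)).lintegral_lt_top

/-- Near the support the kernel is locally integrable (if |x| < 2 and |y| < 1, then x - y lies in
the ball of radius 3). For |x| ≥ 2 one has |x - y| ≥ (1+|x|)/4, so the potential decays like the
kernel. -/
theorem exists_rieszPotential_le [NeZero N] {β p : ℝ} (hβ : 0 < β) (hβN : β < N) (hp : 0 < p)
    {u : EuclideanSpace ℝ (Fin N) → ℝ} {C : ℝ} (hC : ∀ x, |u x| ≤ C)
    (hu : ∀ x, 1 ≤ ‖x‖ → u x = 0) :
    ∃ K : ℝ≥0, ∀ x, rieszPotential β p u x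
      ≤ K * ENNReal.ofReal ((1 + ‖x‖) ^ (β - (N : ℝ))) := by
  have hA := rieszConst_pos (N := N) hβ hβN
  have hC0 : 0 ≤ C := (abs_nonneg _).trans (hC 0)
  set c : ℝ≥0∞ := ENNReal.ofReal C ^ p
  have hct : c ≠ ⊤ := ENNReal.rpow_ne_top_of_nonneg hp.le ENNReal.ofReal_ne_top
  set I₀ := ∫⁻ z in ball (0 : EuclideanSpace ℝ (Fin N)) 3, ENNReal.ofReal (rieszKernel N β z)
  have hI : I₀ < ⊤ := lintegral_ball_rieszKernel_lt_top hβ 3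
  set v₀ := volume (ball (0 : EuclideanSpace ℝ (Fin N)) 1)
  set B := ball (0 : EuclideanSpace ℝ (Fin N)) 1 with hB
  have hpot : ∀ x, rieszPotential β p u x
      ≤ ∫⁻ y in B, ENNReal.ofReal (rieszKernel N β (x - y)) * c := by
    intro x
    rw [← lintegral_indicator measurableSet_ball]
    refine lintegral_mono fun y => ?_
    by_cases hy : y ∈ B
    · rw [indicator_of_mem hy]
      gcongr
      rw [← ofReal_norm]
      exact ENNReal.rpow_le_rpow (ENNReal.ofReal_le_ofReal (hC y)) hp.le
    · rw [indicator_of_notMem hy, hu y (by simpa [hB] using hy)]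
      simp [hp]
  have h4 : (0 : ℝ) < 4 ^ (β - (N : ℝ)) := by positivity
  have hK1 : I₀ * c * ENNReal.ofReal ((4 ^ (β - (N : ℝ)))⁻¹) ≠ ⊤ := by finiteness
  have hK2 : ENNReal.ofReal (rieszConst N β * (4 ^ (β - (N : ℝ)))⁻¹) * c * v₀ ≠ ⊤ :=
    ENNReal.mul_ne_top (ENNReal.mul_ne_top ENNReal.ofReal_ne_top hct) measure_ball_lt_top.ne
  refine ⟨(I₀ * c * ENNReal.ofReal ((4 ^ (β - (N : ℝ)))⁻¹)
    + ENNReal.ofReal (rieszConst N β * (4 ^ (β - (N : ℝ)))⁻¹) * c * v₀).toNNReal, fun x => ?_⟩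
  rw [ENNReal.coe_toNNReal (ENNReal.add_ne_top.2 ⟨hK1, hK2⟩), add_mul]
  have hx1 : 0 < 1 + ‖x‖ := by positivity
  rcases lt_or_ge ‖x‖ 2 with hx | hx
  · refine le_add_right ?_
    have e1 : 1 ≤ ENNReal.ofReal ((4 ^ (β - (N : ℝ)))⁻¹) *
        ENNReal.ofReal ((1 + ‖x‖) ^ (β - (N : ℝ))) := by
      rw [← ENNReal.ofReal_mul (by positivity), ENNReal.one_le_ofReal, inv_mul_eq_div,
        one_le_div h4]
      exact Real.rpow_le_rpow_of_nonpos hx1 (by linarith) (by linarith)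
    calc rieszPotential β p u x
        ≤ ∫⁻ y in B, ENNReal.ofReal (rieszKernel N β (x - y)) * c := hpot x
      _ = (∫⁻ y in B, ENNReal.ofReal (rieszKernel N β (x - y))) * c :=
          lintegral_mul_const' _ _ hct
      _ ≤ I₀ * c := by
          gcongr
          rw [← lintegral_indicator measurableSet_ball]
          have e2 : I₀ = ∫⁻ y, (ball (0 : EuclideanSpace ℝ (Fin N)) 3).indicator
              (fun z => ENNReal.ofReal (rieszKernel N β z)) (x - y) := by
            rw [lintegral_sub_left_eq_self (fun y => (ball (0 : EuclideanSpace ℝ (Fin N)) 3).indicator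
              (fun z => ENNReal.ofReal (rieszKernel N β z)) y) x,
              lintegral_indicator measurableSet_ball]
          rw [e2]
          refine lintegral_mono fun y => ?_
          by_cases hy : y ∈ B
          · have hy3 : x - y ∈ ball (0 : EuclideanSpace ℝ (Fin N)) 3 := by
              rw [mem_ball_zero_iff]
              have : ‖y‖ < 1 := by simpa [hB] using hy
              linarith [norm_sub_le x y]
            rw [indicator_of_mem hy, indicator_of_mem hy3]
          · rw [indicator_of_notMem hy]
            exact bot_le
      _ = I₀ * c * 1 := (mul_one _).symm
      _ ≤ _ := by
          rw [mul_assoc (I₀ * c)]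
          gcongr
  · refine le_add_left ?_
    calc rieszPotential β p u x
        ≤ ∫⁻ y in B, ENNReal.ofReal (rieszKernel N β (x - y)) * c := hpot x
      _ ≤ ∫⁻ _y in B, ENNReal.ofReal (rieszConst N β * (4 ^ (β - (N : ℝ)))⁻¹
            * (1 + ‖x‖) ^ (β - (N : ℝ))) * c := by
          refine setLIntegral_mono' measurableSet_ball fun y hy => ?_
          gcongr
          rw [rieszKernel_eq, mul_assoc]
          refine mul_le_mul_of_nonneg_left ?_ hA.le
          rw [inv_mul_eq_div, ← Real.div_rpow hx1.le (by norm_num)]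
          refine Real.rpow_le_rpow_of_nonpos (by positivity) ?_ (by linarith)
          have : ‖y‖ < 1 := by simpa [hB] using hy
          linarith [norm_sub_norm_le x y]
      _ = _ := by
          rw [setLIntegral_const, ENNReal.ofReal_mul (by positivity)]
          ring

/-- The squared potential decays with exponent 2N - α, which exceeds N exactly because α < N. -/
theorem coulombEnergy_lt_top [NeZero N] {α p : ℝ} (hα : 0 < α) (hαN : α < N) (hp : 0 < p)
    {u : EuclideanSpace ℝ (Fin N) → ℝ} {C : ℝ} (hC : ∀ x, |u x| ≤ C)
    (hu : ∀ x, 1 ≤ ‖x‖ → u x = 0) : coulombEnergy α p u < ⊤ := by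
  obtain ⟨K, hK⟩ := exists_rieszPotential_le (β := α / 2) (by linarith) (by linarith) hp hC hu
  have h1 : coulombEnergy α p u ≤
      ∫⁻ x : EuclideanSpace ℝ (Fin N), (K : ℝ≥0∞) ^ 2 *
        ENNReal.ofReal ((1 + ‖x‖) ^ (-(2 * N - α : ℝ))) := by
    refine lintegral_mono fun x => ?_
    refine (pow_le_pow_left' (hK x) 2).trans (le_of_eq ?_)
    have hx1 : 0 < 1 + ‖x‖ := by positivity
    rw [mul_pow, ← ENNReal.ofReal_pow (by positivity), ← Real.rpow_natCast, ← Real.rpow_mul hx1.le]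
    congr 3; push_cast; ring
  refine h1.trans_lt ?_
  rw [lintegral_const_mul' _ _ (by finiteness)]
  refine ENNReal.mul_lt_top (by finiteness) (finite_integral_one_add_norm ?_)
  rw [finrank_euclideanSpace, Fintype.card_fin]
  linarith

/-! ### Behaviour of the three integrals under x ↦ A v(l x). -/

section Scaling

theorem lintegral_comp_smul_pos (f : EuclideanSpace ℝ (Fin N) → ℝ≥0∞) {l : ℝ} (hl : 0 < l) :
    ∫⁻ x, f (l • x) = ENNReal.ofReal ((l ^ N)⁻¹) * ∫⁻ x, f x := by
  have h := lintegral_map_equiv (μ := (volume : Measure (EuclideanSpace ℝ (Fin N)))) f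
    (Homeomorph.smulOfNeZero l hl.ne').toMeasurableEquiv
  have h2 : Measure.map (⇑(Homeomorph.smulOfNeZero l hl.ne').toMeasurableEquiv) volume
      = ENNReal.ofReal ((l ^ N)⁻¹) • (volume : Measure (EuclideanSpace ℝ (Fin N))) := by
    have h3 := Measure.map_addHaar_smul (volume : Measure (EuclideanSpace ℝ (Fin N))) hl.ne'
    rw [finrank_euclideanSpace, Fintype.card_fin, abs_of_pos (by positivity)] at h3
    exact h3
  rw [h2, lintegral_smul_measure, smul_eq_mul] at h
  exact h.symm

variable {v : EuclideanSpace ℝ (Fin N) → ℝ} {A l : ℝ}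

theorem lintegral_rpow_scaled (hA : 0 < A) (hl : 0 < l) {q : ℝ} (hq : 0 < q) :
    ∫⁻ x, ‖A * v (l • x)‖ₑ ^ q
      = ENNReal.ofReal (A ^ q * l ^ (-(N : ℝ))) * ∫⁻ x, ‖v x‖ₑ ^ q := by
  have h1 : ∀ x, ‖A * v (l • x)‖ₑ ^ q = ENNReal.ofReal (A ^ q) * ‖v (l • x)‖ₑ ^ q := by
    intro x
    rw [enorm_mul, ENNReal.mul_rpow_of_nonneg _ _ hq.le, Real.enorm_eq_ofReal hA.le,
      ENNReal.ofReal_rpow_of_pos hA]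
  simp_rw [h1]
  rw [lintegral_const_mul' _ _ ENNReal.ofReal_ne_top,
    lintegral_comp_smul_pos (fun x => ‖v x‖ₑ ^ q) hl, ← mul_assoc,
    ← ENNReal.ofReal_mul (by positivity), Real.rpow_neg hl.le, Real.rpow_natCast]

theorem dirichletEnergy_scaled (hv : ContDiff ℝ ∞ v) (hA : 0 < A) (hl : 0 < l) :
    dirichletEnergy (fun x => A * v (l • x))
      = ENNReal.ofReal (A ^ 2 * l ^ (2 - (N : ℝ))) * dirichletEnergy v := by
  have hw : ContDiff ℝ ∞ fun x => A * v (l • x) :=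
    contDiff_const.mul (hv.comp (contDiff_const_smul l))
  have hd : ∀ x, fderiv ℝ (fun x => A * v (l • x)) x = A • l • fderiv ℝ v (l • x) := by
    intro x
    have h1 : DifferentiableAt ℝ (fun x => v (l • x)) x :=
      (hv.comp (contDiff_const_smul l)).differentiable (by simp) x
    rw [fderiv_const_mul h1, fderiv_comp_smul]
  rw [dirichletEnergy_eq hw, dirichletEnergy_eq hv]
  have h2 : ∀ x, ‖fderiv ℝ (fun x => A * v (l • x)) x‖ₑ ^ 2
      = ENNReal.ofReal ((A * l) ^ 2) * ‖fderiv ℝ v (l • x)‖ₑ ^ 2 := by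
    intro x
    rw [hd, enorm_smul, enorm_smul, Real.enorm_eq_ofReal hA.le, Real.enorm_eq_ofReal hl.le,
      ← mul_assoc, mul_pow, ← ENNReal.ofReal_mul hA.le, ENNReal.ofReal_pow (by positivity)]
  simp_rw [h2]
  rw [lintegral_const_mul' _ _ ENNReal.ofReal_ne_top,
    lintegral_comp_smul_pos (fun x => ‖fderiv ℝ v x‖ₑ ^ 2) hl, ← mul_assoc,
    ← ENNReal.ofReal_mul (by positivity), Real.rpow_sub hl, Real.rpow_natCast, Real.rpow_two]
  congr 2
  ring

theorem rieszPotential_scaled (hA : 0 < A) (hl : 0 < l) {β p : ℝ} (hp : 0 < p)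
    (x : EuclideanSpace ℝ (Fin N)) :
    rieszPotential β p (fun x => A * v (l • x)) x
      = ENNReal.ofReal (A ^ p * l ^ (-β)) * rieszPotential β p v (l • x) := by
  have h1 : ∀ y, ENNReal.ofReal (rieszKernel N β (x - y)) * ‖A * v (l • y)‖ₑ ^ p
      = ENNReal.ofReal (A ^ p * l ^ ((N : ℝ) - β)) *
        (fun z => ENNReal.ofReal (rieszKernel N β (l • x - z)) * ‖v z‖ₑ ^ p) (l • y) := by
    intro y
    have hk : rieszKernel N β (x - y) = l ^ ((N : ℝ) - β) * rieszKernel N β (l • x - l • y) := by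
      rw [rieszKernel_eq, rieszKernel_eq, ← smul_sub, norm_smul, Real.norm_of_nonneg hl.le,
        Real.mul_rpow hl.le (norm_nonneg _)]
      have : l ^ ((N : ℝ) - β) * l ^ (β - N) = 1 := by
        rw [← Real.rpow_add hl]; simp
      linear_combination (-(rieszConst N β * ‖x - y‖ ^ (β - (N : ℝ)))) * this
    rw [enorm_mul, ENNReal.mul_rpow_of_nonneg _ _ hp.le, Real.enorm_eq_ofReal hA.le,
      ENNReal.ofReal_rpow_of_pos hA, hk, ENNReal.ofReal_mul (by positivity),
      ENNReal.ofReal_mul (by positivity)]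
    ring
  simp only [rieszPotential]
  simp_rw [h1]
  rw [lintegral_const_mul' _ _ ENNReal.ofReal_ne_top, lintegral_comp_smul_pos
    (fun z => ENNReal.ofReal (rieszKernel N β (l • x - z)) * ‖v z‖ₑ ^ p) hl, ← mul_assoc,
    ← ENNReal.ofReal_mul (by positivity)]
  congr 2
  rw [Real.rpow_sub hl, Real.rpow_neg hl.le, Real.rpow_natCast]
  field_simp

theorem coulombEnergy_scaled (hA : 0 < A) (hl : 0 < l) {α p : ℝ} (hp : 0 < p) :
    coulombEnergy α p (fun x => A * v (l • x))
      = ENNReal.ofReal (A ^ (2 * p) * l ^ (-(N + α : ℝ))) * coulombEnergy α p v := by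
  simp only [coulombEnergy]
  simp_rw [rieszPotential_scaled hA hl hp, mul_pow]
  rw [lintegral_const_mul' _ _ (by finiteness),
    lintegral_comp_smul_pos (fun x => rieszPotential (α / 2) p v x ^ 2) hl, ← mul_assoc,
    ← ENNReal.ofReal_pow (by positivity), ← ENNReal.ofReal_mul (by positivity)]
  congr 2
  rw [mul_pow, ← Real.rpow_natCast (A ^ p), ← Real.rpow_mul hA.le, ← Real.rpow_natCast (l ^ _),
    ← Real.rpow_mul hl.le, ← Real.rpow_natCast l, ← Real.rpow_neg hl.le, mul_assoc,
    ← Real.rpow_add hl]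
  push_cast
  congr 2 <;> ring

end Scaling

end TestFunctions

end CoulombSobolev

namespace CoulombSobolev

/-! ### The embedding forces (Q): trains of far apart bumps. -/

section Necessity

open Set Metric Filter Topology

/-- Used at each point x for bumps with disjoint supports: at most one term is nonzero, so powers
and norms become additive. -/
theorem apply_sum_of_pairwise_zero {ι M : Type*} [AddCommMonoid M] (s : Finset ι) (a : ι → M)
    (F : M → ℝ≥0∞) (h0 : F 0 = 0) (h : ∀ i ∈ s, ∀ j ∈ s, i ≠ j → a i = 0 ∨ a j = 0) :
    F (∑ i ∈ s, a i) = ∑ i ∈ s, F (a i) := by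
  by_cases hz : ∀ i ∈ s, a i = 0
  · rw [Finset.sum_eq_zero hz, h0, Finset.sum_eq_zero fun i hi => by rw [hz i hi, h0]]
  · push Not at hz
    obtain ⟨i, hi, hai⟩ := hz
    have hj : ∀ j ∈ s, j ≠ i → a j = 0 := fun j hj hji =>
      (h j hj i hi hji).resolve_right hai
    rw [Finset.sum_eq_single_of_mem i hi hj,
      Finset.sum_eq_single_of_mem i hi fun j hjs hji => by rw [hj j hjs hji, h0]]

variable {N : ℕ}

theorem lintegral_sum_translates {g : EuclideanSpace ℝ (Fin N) → ℝ≥0∞} (hg : Measurable g)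
    (c : ℕ → EuclideanSpace ℝ (Fin N)) (m : ℕ) :
    ∫⁻ x, ∑ k ∈ Finset.range m, g (x - c k) = m * ∫⁻ x, g x := by
  have h1 : ∀ k ∈ Finset.range m, Measurable fun x => g (x - c k) := fun k _ =>
    hg.comp (measurable_id.sub_const _)
  rw [lintegral_finsetSum _ h1]
  simp_rw [lintegral_sub_right_eq_self]
  simp

/-- Continuity from above of the finite measure with density g. -/
theorem exists_setLIntegral_compl_closedBall_le {g : EuclideanSpace ℝ (Fin N) → ℝ≥0∞}
    (hg : ∫⁻ x, g x ≠ ⊤) {ε : ℝ≥0∞} (hε : ε ≠ 0) :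
    ∃ n : ℕ, ∫⁻ x in (closedBall 0 (n : ℝ))ᶜ, g x ≤ ε := by
  have hms : ∀ n : ℕ, MeasurableSet (closedBall (0 : EuclideanSpace ℝ (Fin N)) (n : ℝ))ᶜ :=
    fun n => measurableSet_closedBall.compl
  have h := tendsto_measure_iInter_atTop (μ := volume.withDensity g)
    (s := fun n : ℕ => (closedBall (0 : EuclideanSpace ℝ (Fin N)) (n : ℝ))ᶜ)
    (fun n => (hms n).nullMeasurableSet)
    (fun m n hmn => compl_subset_compl.2 (closedBall_subset_closedBall (by exact_mod_cast hmn)))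
    ⟨0, by
      rw [withDensity_apply _ (hms 0)]
      exact ne_top_of_le_ne_top hg (setLIntegral_le_lintegral _ _)⟩
  have hem : ⋂ n : ℕ, (closedBall (0 : EuclideanSpace ℝ (Fin N)) (n : ℝ))ᶜ = ∅ := by
    rw [← compl_iUnion, iUnion_closedBall_nat, compl_univ]
  rw [hem, measure_empty] at h
  obtain ⟨n, hn⟩ := (h.eventually (gt_mem_nhds hε.bot_lt)).exists
  refine ⟨n, ?_⟩
  rw [Function.comp_apply, withDensity_apply _ (hms n)] at hn
  exact hn.le

theorem lintegral_mollifier_rpow_ne_zero {q : ℝ} (hq : 0 < q) :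
    ∫⁻ x, ‖mollifier N x‖ₑ ^ q ≠ 0 := by
  intro h
  rw [lintegral_eq_zero_iff ((contDiff_mollifier.continuous.measurable.enorm).pow_const q)] at h
  have h1 : mollifier N =ᵐ[volume] 0 := by
    filter_upwards [h] with x hx
    simpa [hq, hq.not_gt] using hx
  have h2 : ∫ x, mollifier N x = 1 := (unitBump N).integral_normed
  rw [integral_congr_ae h1] at h2
  simp at h2

variable [NeZero N]

/-- Equally spaced points on a coordinate axis. -/
noncomputable def latticePoint (N : ℕ) [NeZero N] (L : ℝ) (k : ℕ) : EuclideanSpace ℝ (Fin N) :=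
  (k * L : ℝ) • EuclideanSpace.single 0 1

theorem latticePoint_separated {L R : ℝ} (hR : 0 ≤ R) (hL : 2 * R < L) {j k : ℕ} (hjk : j ≠ k)
    {x : EuclideanSpace ℝ (Fin N)} (hj : ‖x - latticePoint N L j‖ ≤ R)
    (hk : ‖x - latticePoint N L k‖ ≤ R) : False := by
  have hL0 : 0 < L := by linarith
  have h1 : ‖latticePoint N L j - latticePoint N L k‖ ≤ 2 * R := by
    have : latticePoint N L j - latticePoint N L k
        = (x - latticePoint N L k) - (x - latticePoint N L j) := by abel
    rw [this]
    exact (norm_sub_le _ _).trans (by linarith)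
  have h2 : ‖latticePoint N L j - latticePoint N L k‖ = |(j : ℝ) - k| * L := by
    rw [latticePoint, latticePoint, ← sub_smul, norm_smul, PiLp.norm_single, norm_one, mul_one,
      ← sub_mul, Real.norm_eq_abs, abs_mul, abs_of_pos hL0]
  have h3 : (1 : ℝ) ≤ |(j : ℝ) - k| := by
    have : (1 : ℤ) ≤ |(j : ℤ) - k| := Int.one_le_abs (sub_ne_zero.2 (by exact_mod_cast hjk))
    exact_mod_cast this
  nlinarith

/-- The sum of `m` equally spaced translates of the mollifier. -/
noncomputable def bumpTrain (N : ℕ) [NeZero N] (L : ℝ) (m : ℕ) (x : EuclideanSpace ℝ (Fin N)) : ℝ :=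
  ∑ k ∈ Finset.range m, mollifier N (x - latticePoint N L k)

theorem contDiff_bumpTrain (L : ℝ) (m : ℕ) : ContDiff ℝ ∞ (bumpTrain N L m) :=
  ContDiff.sum fun _ _ => contDiff_mollifier.comp (contDiff_id.sub contDiff_const)

theorem hasCompactSupport_bumpTrain (L : ℝ) (m : ℕ) : HasCompactSupport (bumpTrain N L m) := by
  refine HasCompactSupport.of_support_subset_isCompact
    (K := ⋃ k ∈ Finset.range m, closedBall (latticePoint N L k) 1)
    ((Finset.range m).isCompact_biUnion fun k _ => isCompact_closedBall _ _) fun x hx => ?_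
  obtain ⟨k, hk, hxk⟩ := Finset.exists_ne_zero_of_sum_ne_zero hx
  refine mem_biUnion (Finset.mem_coe.2 hk) ?_
  by_contra hc
  refine hxk (mollifier_eq_zero ?_)
  rw [← dist_eq_norm]
  exact le_of_lt (not_le.1 hc)

theorem enorm_bumpTrain_rpow {L : ℝ} (hL : 2 < L) (m : ℕ) {q : ℝ} (hq : 0 < q)
    (x : EuclideanSpace ℝ (Fin N)) :
    ‖bumpTrain N L m x‖ₑ ^ q
      = ∑ k ∈ Finset.range m, ‖mollifier N (x - latticePoint N L k)‖ₑ ^ q := by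
  refine apply_sum_of_pairwise_zero _ _ (fun t : ℝ => ‖t‖ₑ ^ q) (by simp [hq])
    fun i _ j _ hij => ?_
  by_contra! hc
  refine latticePoint_separated (N := N) (R := 1) (L := L) zero_le_one (by linarith) hij (x := x) ?_ ?_
  · by_contra h
    exact hc.1 (mollifier_eq_zero (le_of_lt (not_le.1 h)))
  · by_contra h
    exact hc.2 (mollifier_eq_zero (le_of_lt (not_le.1 h)))

theorem lintegral_bumpTrain_rpow {L : ℝ} (hL : 2 < L) (m : ℕ) {q : ℝ} (hq : 0 < q) :
    ∫⁻ x, ‖bumpTrain N L m x‖ₑ ^ q = m * ∫⁻ x, ‖mollifier N x‖ₑ ^ q := by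
  have hm : Measurable fun x => ‖mollifier N x‖ₑ ^ q :=
    (contDiff_mollifier.continuous.measurable.enorm).pow_const q
  simp_rw [enorm_bumpTrain_rpow hL m hq]
  exact lintegral_sum_translates hm _ m

theorem dirichletEnergy_bumpTrain {L : ℝ} (hL : 2 < L) (m : ℕ) :
    dirichletEnergy (bumpTrain N L m) = m * dirichletEnergy (mollifier N) := by
  rw [dirichletEnergy_eq (contDiff_bumpTrain L m), dirichletEnergy_eq contDiff_mollifier]
  have hm : Measurable fun x => ‖fderiv ℝ (mollifier N) x‖ₑ ^ 2 :=
    ((contDiff_mollifier.continuous_fderiv (by simp)).measurable.enorm).pow_const 2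
  have hd : ∀ x, fderiv ℝ (bumpTrain N L m) x
      = ∑ k ∈ Finset.range m, fderiv ℝ (mollifier N) (x - latticePoint N L k) := by
    intro x
    have h1 : bumpTrain N L m = fun x => ∑ k ∈ Finset.range m,
      mollifier N (x - latticePoint N L k) := rfl
    have h2 : ∀ k ∈ Finset.range m,
        DifferentiableAt ℝ (fun x => mollifier N (x - latticePoint N L k)) x := fun k _ =>
      (differentiable_mollifier.comp (differentiable_id.sub_const _)).differentiableAt
    rw [h1, fderiv_fun_sum h2]
    exact Finset.sum_congr rfl fun k _ => fderiv_comp_sub _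
  have hs : ∀ x, ‖fderiv ℝ (bumpTrain N L m) x‖ₑ ^ 2
      = ∑ k ∈ Finset.range m, ‖fderiv ℝ (mollifier N) (x - latticePoint N L k)‖ₑ ^ 2 := by
    intro x
    rw [hd]
    refine apply_sum_of_pairwise_zero _ _
      (fun t : EuclideanSpace ℝ (Fin N) →L[ℝ] ℝ => ‖t‖ₑ ^ 2)
      (by simp [← ofReal_norm]) fun i _ j _ hij => ?_
    by_contra! hc
    refine latticePoint_separated (N := N) (R := 1) (L := L) zero_le_one (by linarith) hij (x := x) ?_ ?_
    · by_contra h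
      exact hc.1 (fderiv_mollifier_eq_zero (not_le.1 h))
    · by_contra h
      exact hc.2 (fderiv_mollifier_eq_zero (not_le.1 h))
  simp_rw [hs]
  exact lintegral_sum_translates hm _ m

/-- Disjoint supports make |·|^p additive, hence also the potentials. These are not compactly
supported, so the square in the Coulomb energy still has cross terms. -/
theorem rieszPotential_bumpTrain {L : ℝ} (hL : 2 < L) (m : ℕ) (β : ℝ) {p : ℝ} (hp : 0 < p)
    (x : EuclideanSpace ℝ (Fin N)) :
    rieszPotential β p (bumpTrain N L m) x
      = ∑ k ∈ Finset.range m, rieszPotential β p (mollifier N) (x - latticePoint N L k) := by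
  have hm : ∀ z : EuclideanSpace ℝ (Fin N), Measurable fun y =>
      ENNReal.ofReal (rieszKernel N β (z - y)) * ‖mollifier N y‖ₑ ^ p := fun z =>
    (ENNReal.measurable_ofReal.comp ((measurable_rieszKernel β).comp
      (measurable_const.sub measurable_id))).mul
      ((contDiff_mollifier.continuous.measurable.enorm).pow_const p)
  have hsub : ∀ (y : EuclideanSpace ℝ (Fin N)) k,
      ENNReal.ofReal (rieszKernel N β (x - y)) * ‖mollifier N (y - latticePoint N L k)‖ₑ ^ p
      = (fun z => ENNReal.ofReal (rieszKernel N β (x - latticePoint N L k - z))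
          * ‖mollifier N z‖ₑ ^ p) (y - latticePoint N L k) := by
    intro y k
    simp only [sub_sub_sub_cancel_right]
  simp only [rieszPotential]
  have hms : ∀ k ∈ Finset.range m, Measurable fun y => ENNReal.ofReal (rieszKernel N β (x - y))
      * ‖mollifier N (y - latticePoint N L k)‖ₑ ^ p := by
    intro k _
    simp_rw [hsub]
    exact (hm _).comp (measurable_id.sub_const _)
  simp_rw [enorm_bumpTrain_rpow hL m hp, Finset.mul_sum]
  rw [lintegral_finsetSum _ hms]
  refine Finset.sum_congr rfl fun k _ => ?_
  simp_rw [hsub]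
  exact lintegral_sub_right_eq_self (fun z => ENNReal.ofReal
    (rieszKernel N β (x - latticePoint N L k - z)) * ‖mollifier N z‖ₑ ^ p) _

/-- Translates of a square integrable function that are far apart are almost orthogonal. -/
theorem exists_lintegral_sq_sum_translates_le {g : EuclideanSpace ℝ (Fin N) → ℝ≥0∞}
    (hgm : Measurable g) (hg : ∫⁻ x, g x ^ 2 ≠ ⊤) {m : ℕ} (hm : 1 ≤ m) :
    ∃ L : ℝ, 2 < L ∧ ∫⁻ x, (∑ k ∈ Finset.range m, g (x - latticePoint N L k)) ^ 2
      ≤ m * (2 * ((∫⁻ x, g x ^ 2) + 1)) := by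
  have hm0 : (m : ℝ≥0∞) ≠ 0 := by exact_mod_cast (Nat.one_le_iff_ne_zero.1 hm)
  have hmt : (m : ℝ≥0∞) ≠ ⊤ := ENNReal.natCast_ne_top m
  -- A tail of size 1/m suffices: Cauchy–Schwarz on the sum of m tails loses a factor m, so together
  -- they contribute at most m · m · (1/m) = m.
  obtain ⟨n, hn⟩ := exists_setLIntegral_compl_closedBall_le hg
    (ε := (m : ℝ≥0∞)⁻¹) (ENNReal.inv_ne_zero.2 hmt)
  set B := closedBall (0 : EuclideanSpace ℝ (Fin N)) (n : ℝ) with hB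
  have hBm : MeasurableSet B := measurableSet_closedBall
  -- Spacing above 2n makes the truncated parts disjoint, and spacing above 2 is kept for the bumps
  -- themselves.
  set L : ℝ := 2 * n + 3
  have hn0 : (0 : ℝ) ≤ n := Nat.cast_nonneg n
  refine ⟨L, by simp only [L]; linarith, ?_⟩
  set a : ℕ → EuclideanSpace ℝ (Fin N) → ℝ≥0∞ := fun k x => B.indicator g (x - latticePoint N L k)
  set b : ℕ → EuclideanSpace ℝ (Fin N) → ℝ≥0∞ := fun k x => Bᶜ.indicator g (x - latticePoint N L k)
  have ham : ∀ k, Measurable fun x => a k x ^ 2 := fun k =>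
    ((hgm.indicator hBm).comp (measurable_id.sub_const _)).pow_const 2
  have hbm : ∀ k, Measurable fun x => b k x ^ 2 := fun k =>
    ((hgm.indicator hBm.compl).comp (measurable_id.sub_const _)).pow_const 2
  have hab : ∀ k x, g (x - latticePoint N L k) = a k x + b k x := fun k x =>
    (congrFun (indicator_self_add_compl B g) _).symm
  have ha2 : ∀ x, (∑ k ∈ Finset.range m, a k x) ^ 2 = ∑ k ∈ Finset.range m, a k x ^ 2 := by
    intro x
    refine apply_sum_of_pairwise_zero _ _ (fun t : ℝ≥0∞ => t ^ 2) (by simp) fun i _ j _ hij => ?_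
    by_contra! hc
    refine latticePoint_separated (N := N) (R := n) hn0 (L := L) (by simp only [L]; linarith) hij
      (x := x) ?_ ?_
    · have := mem_of_indicator_ne_zero hc.1
      rwa [hB, mem_closedBall_zero_iff] at this
    · have := mem_of_indicator_ne_zero hc.2
      rwa [hB, mem_closedBall_zero_iff] at this
  have hb2 : ∀ x, (∑ k ∈ Finset.range m, b k x) ^ 2 ≤ m * ∑ k ∈ Finset.range m, b k x ^ 2 := by
    intro x
    have := ENNReal.rpow_sum_le_const_mul_sum_rpow (Finset.range m) (fun k => b k x)
      (p := 2) (by norm_num)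
    norm_num at this
    exact this
  have hia : ∀ k, ∫⁻ x, a k x ^ 2 ≤ ∫⁻ x, g x ^ 2 := by
    intro k
    rw [lintegral_sub_right_eq_self (fun x => B.indicator g x ^ 2) (latticePoint N L k)]
    exact lintegral_mono fun x => pow_le_pow_left' (indicator_le_self B g x) 2
  have hib : ∀ k, ∫⁻ x, b k x ^ 2 ≤ (m : ℝ≥0∞)⁻¹ := by
    intro k
    rw [lintegral_sub_right_eq_self (fun x => Bᶜ.indicator g x ^ 2) (latticePoint N L k)]
    have : ∀ x, Bᶜ.indicator g x ^ 2 = Bᶜ.indicator (fun x => g x ^ 2) x := by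
      intro x
      by_cases hx : x ∈ Bᶜ
      · rw [indicator_of_mem hx, indicator_of_mem hx]
      · rw [indicator_of_notMem hx, indicator_of_notMem hx]; simp
    simp_rw [this]
    rwa [lintegral_indicator hBm.compl]
  calc ∫⁻ x, (∑ k ∈ Finset.range m, g (x - latticePoint N L k)) ^ 2
      ≤ ∫⁻ x, 2 * (∑ k ∈ Finset.range m, a k x ^ 2 + m * ∑ k ∈ Finset.range m, b k x ^ 2) := by
        refine lintegral_mono fun x => ?_
        simp_rw [hab, Finset.sum_add_distrib]
        have h1 := ENNReal.rpow_add_le_mul_rpow_add_rpow (∑ k ∈ Finset.range m, a k x)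
          (∑ k ∈ Finset.range m, b k x) (p := 2) (by norm_num)
        norm_num at h1
        refine h1.trans ?_
        rw [ha2]
        gcongr
        exact hb2 x
    _ = 2 * ((∑ k ∈ Finset.range m, ∫⁻ x, a k x ^ 2)
          + m * ∑ k ∈ Finset.range m, ∫⁻ x, b k x ^ 2) := by
        rw [lintegral_const_mul' _ _ (by norm_num), lintegral_add_left
          (Finset.measurable_sum _ fun k _ => ham k), lintegral_const_mul' _ _ hmt,
          lintegral_finsetSum _ fun k _ => ham k, lintegral_finsetSum _ fun k _ => hbm k]
    _ ≤ 2 * ((∑ _k ∈ Finset.range m, ∫⁻ x, g x ^ 2)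
          + m * ∑ _k ∈ Finset.range m, (m : ℝ≥0∞)⁻¹) := by
        exact mul_le_mul' le_rfl (add_le_add (Finset.sum_le_sum fun k _ => hia k)
          (mul_le_mul' le_rfl (Finset.sum_le_sum fun k _ => hib k)))
    _ = m * (2 * ((∫⁻ x, g x ^ 2) + 1)) := by
        simp only [Finset.sum_const, Finset.card_range, nsmul_eq_mul]
        rw [ENNReal.mul_inv_cancel hm0 hmt]
        ring

theorem coulombEnergy_mollifier_lt_top {α p : ℝ} (hα : 0 < α) (hαN : α < N) (hp : 0 < p) :
    coulombEnergy α p (mollifier N) < ⊤ := by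
  obtain ⟨C, -, hC⟩ := exists_mollifier_le N
  exact coulombEnergy_lt_top hα hαN hp hC fun x hx => mollifier_eq_zero hx

/-- Testing a continuous embedding on rescaled trains of bumps. -/
theorem ContinuouslyEmbedded.exists_bound {α p q : ℝ} (hα : 0 < α) (hαN : α < N) (hp : 1 ≤ p)
    (hq : 1 ≤ q) (h : ContinuouslyEmbedded N α p q) :
    ∃ K : ℝ, ∀ (m : ℕ) (A l : ℝ), 1 ≤ m → 0 < A → 0 < l → A ^ 2 * l ^ (2 - (N : ℝ)) * m ≤ 1 →
      A ^ (2 * p) * l ^ (-(N + α : ℝ)) * m ≤ 1 → A ^ q * l ^ (-(N : ℝ)) * m ≤ K := by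
  obtain ⟨C, hC⟩ := h
  have hp0 : 0 < p := by linarith
  have hq0 : 0 < q := by linarith
  have hE0 := coulombEnergy_mollifier_lt_top (N := N) hα hαN hp0
  -- The cost in Coulomb energy per bump, independent of m because the spacing is chosen after m.
  set E₀ := 2 * (coulombEnergy α p (mollifier N) + 1) with hE₀
  have hE₀t : E₀ < ⊤ := ENNReal.mul_lt_top (by norm_num) (ENNReal.add_lt_top.2 ⟨hE0, by norm_num⟩)
  set D₀ := dirichletEnergy (mollifier N) with hD₀
  have hD₀t : D₀ < ⊤ := dirichletEnergy_lt_top_of_mem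
    (mem_coulombSobolevSpace contDiff_mollifier hasCompactSupport_mollifier hE0)
  set c := ∫⁻ x, ‖mollifier N x‖ₑ ^ q with hc
  have hc0 : c ≠ 0 := lintegral_mollifier_rpow_ne_zero hq0
  have hct : c ≠ ⊤ := by
    have h1 := lintegral_rpow_enorm_lt_top_of_eLpNorm_lt_top (by simpa using hq0)
      ENNReal.ofReal_ne_top (hC _ (mem_coulombSobolevSpace contDiff_mollifier
        hasCompactSupport_mollifier hE0)).1.2
    rw [ENNReal.toReal_ofReal hq0.le] at h1
    exact h1.ne
  set T : ℝ≥0∞ := (C * (D₀ + E₀ ^ (1 / p)) ^ (1 / 2 : ℝ)) ^ q / c with hT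
  have hTt : T ≠ ⊤ := by
    refine (ENNReal.div_lt_top (ENNReal.rpow_ne_top_of_nonneg hq0.le (ENNReal.mul_ne_top
      ENNReal.coe_ne_top (ENNReal.rpow_ne_top_of_nonneg (by norm_num)
      (ENNReal.add_ne_top.2 ⟨hD₀t.ne, ENNReal.rpow_ne_top_of_nonneg (by positivity) hE₀t.ne⟩))))
      hc0).ne
  refine ⟨T.toReal, fun m A l hm hA hl hX hY => ?_⟩
  have hgm := measurable_rieszPotential
    (contDiff_mollifier (N := N)).continuous.aestronglyMeasurable (α / 2) p
  obtain ⟨L, hL, hLe⟩ := exists_lintegral_sq_sum_translates_le hgm hE0.ne hm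
  set v := bumpTrain N L m with hv
  have hvs : ContDiff ℝ ∞ v := contDiff_bumpTrain L m
  have hvE : coulombEnergy α p v ≤ m * E₀ := by
    refine le_trans (le_of_eq ?_) hLe
    simp only [coulombEnergy]
    simp_rw [hv, rieszPotential_bumpTrain hL m _ hp0]
  have hmt : (m : ℝ≥0∞) ≠ ⊤ := ENNReal.natCast_ne_top m
  set w : EuclideanSpace ℝ (Fin N) → ℝ := fun x => A * v (l • x) with hw
  have hwE : coulombEnergy α p w ≤ E₀ := by
    rw [hw, coulombEnergy_scaled hA hl hp0]
    calc _ ≤ ENNReal.ofReal (A ^ (2 * p) * l ^ (-(N + α : ℝ))) * (m * E₀) := by gcongr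
      _ = ENNReal.ofReal (A ^ (2 * p) * l ^ (-(N + α : ℝ)) * m) * E₀ := by
          rw [ENNReal.ofReal_mul (q := (m : ℝ)) (by positivity), ENNReal.ofReal_natCast, mul_assoc]
      _ ≤ 1 * E₀ := by
          gcongr
          exact ENNReal.ofReal_le_one.2 hY
      _ = E₀ := one_mul _
  have hwD : dirichletEnergy w ≤ D₀ := by
    rw [hw, dirichletEnergy_scaled hvs hA hl, hv, dirichletEnergy_bumpTrain hL]
    calc _ = ENNReal.ofReal (A ^ 2 * l ^ (2 - (N : ℝ)) * m) * D₀ := by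
          rw [ENNReal.ofReal_mul (q := (m : ℝ)) (by positivity), ENNReal.ofReal_natCast, mul_assoc]
      _ ≤ 1 * D₀ := by
          gcongr
          exact ENNReal.ofReal_le_one.2 hX
      _ = D₀ := one_mul _
  have hwmem : w ∈ coulombSobolevSpace N α p := by
    refine mem_coulombSobolevSpace (contDiff_const.mul (hvs.comp (contDiff_const_smul l))) ?_
      (hwE.trans_lt hE₀t)
    exact ((hasCompactSupport_bumpTrain L m).comp_smul hl.ne').mul_left
  have h1 := (hC w hwmem).2
  rw [eLpNorm_eq_lintegral_rpow_enorm_toReal (by simpa using hq0) ENNReal.ofReal_ne_top,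
    ENNReal.toReal_ofReal hq0.le, hw, lintegral_rpow_scaled hA hl hq0, hv,
    lintegral_bumpTrain_rpow hL m hq0, ← mul_assoc, ← ENNReal.ofReal_natCast,
    ← ENNReal.ofReal_mul (by positivity), ← hc] at h1
  have h2 : ENNReal.ofReal (A ^ q * l ^ (-(N : ℝ)) * m) * c
      ≤ (C * (D₀ + E₀ ^ (1 / p)) ^ (1 / 2 : ℝ)) ^ q := by
    rw [← ENNReal.rpow_inv_le_iff hq0, ← one_div]
    refine h1.trans ?_
    rw [coulombSobolevNorm]
    gcongr
  rw [← ENNReal.ofReal_le_iff_le_toReal hTt]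
  exact (ENNReal.le_div_iff_mul_le (Or.inl hc0) (Or.inl hct)).2 h2

theorem nonpos_of_forall_natCast_rpow_le {e K : ℝ} (h : ∀ m : ℕ, 1 ≤ m → (m : ℝ) ^ e ≤ K) :
    e ≤ 0 := by
  by_contra! he
  have h1 := (tendsto_rpow_atTop he).comp (tendsto_natCast_atTop_atTop (R := ℝ))
  obtain ⟨m, hm, hm1⟩ := ((h1.eventually_gt_atTop K).and (eventually_ge_atTop 1)).exists
  exact absurd (h m hm1) (not_le.2 hm)

/-- With both energies kept bounded, a positive power of a free parameter cannot stay bounded in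
L^q. The sign of Δ decides which dilations are allowed, hence which alternative of (Q) results. -/
theorem ContinuouslyEmbedded.conditionQ {α p q : ℝ} (hα : 0 < α) (hαN : α < N) (hp : 1 ≤ p)
    (hq : 1 ≤ q) (h : ContinuouslyEmbedded N α p q) : ConditionQ N α p q := by
  obtain ⟨K, hK⟩ := h.exists_bound hα hαN hp hq
  have hp0 : 0 < p := by linarith
  have hq0 : 0 < q := by linarith
  have hN0 : (0 : ℝ) < N := by linarith
  have hN1 : (1 : ℝ) ≤ N := by exact_mod_cast NeZero.one_le
  have hNα : 0 < (N : ℝ) + α := by linarith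
  set Δ := (N : ℝ) + α - p * (N - 2) with hΔ
  -- A single bump with amplitude l^((N-2)/2), which leaves the Dirichlet energy invariant; the
  -- Coulomb energy then scales as l^(-Δ).
  have hdil : ∀ l : ℝ, 0 < l → l ^ (-Δ) ≤ 1 → l ^ (q * (N - 2) / 2 - N) ≤ K := by
    intro l hl hlΔ
    have h1 := hK 1 (l ^ (((N : ℝ) - 2) / 2)) l le_rfl (by positivity) hl
    rw [← Real.rpow_natCast (l ^ _), ← Real.rpow_mul hl.le, ← Real.rpow_mul hl.le,
      ← Real.rpow_mul hl.le, ← Real.rpow_add hl, ← Real.rpow_add hl, ← Real.rpow_add hl,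
      Nat.cast_one, mul_one, mul_one, mul_one,
      show ((N : ℝ) - 2) / 2 * (2 : ℕ) + (2 - N) = 0 by push_cast; ring, Real.rpow_zero,
      show ((N : ℝ) - 2) / 2 * (2 * p) + -(N + α) = -Δ by rw [hΔ]; ring,
      show ((N : ℝ) - 2) / 2 * q + -N = q * (N - 2) / 2 - N by ring] at h1
    exact h1 le_rfl hlΔ
  have hpos : 0 ≤ Δ → 1 / 2 - 1 / (N : ℝ) ≤ 1 / q := by
    intro hΔ0
    have h1 : q * ((N : ℝ) - 2) / 2 - N ≤ 0 := nonpos_of_forall_natCast_rpow_le (K := K)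
      fun m hm => hdil m (by exact_mod_cast hm)
        (Real.rpow_le_one_of_one_le_of_nonpos (by exact_mod_cast hm) (by linarith))
    rw [div_sub_div _ _ two_ne_zero hN0.ne', div_le_div_iff₀ (by positivity) hq0]
    linarith
  have hneg : Δ ≤ 0 → 1 / q ≤ 1 / 2 - 1 / (N : ℝ) := by
    intro hΔ0
    have h1 : -(q * ((N : ℝ) - 2) / 2 - N) ≤ 0 := nonpos_of_forall_natCast_rpow_le (K := K)
      fun m hm => by
        have hm0 : (0 : ℝ) < m := by exact_mod_cast hm
        have h2 := hdil (m : ℝ)⁻¹ (by positivity)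
        rw [Real.inv_rpow hm0.le, Real.inv_rpow hm0.le, ← Real.rpow_neg hm0.le,
          ← Real.rpow_neg hm0.le, neg_neg] at h2
        exact h2 (Real.rpow_le_one_of_one_le_of_nonpos (by exact_mod_cast hm) hΔ0)
    rw [div_sub_div _ _ two_ne_zero hN0.ne', div_le_div_iff₀ hq0 (by positivity)]
    linarith
  -- Now m bumps. The exponents of m in A and l solve the linear system making both energy
  -- constraints equalities (`e1`, `e2`), solvable when Δ ≠ 0; the resulting power of m must be
  -- nonpositive.
  have hsplit : Δ ≠ 0 → (α + 2 * p - q * (2 + α) / 2) / Δ ≤ 0 := by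
    intro hΔ0
    refine nonpos_of_forall_natCast_rpow_le (K := K) fun m hm => ?_
    have hm0 : (0 : ℝ) < m := by exact_mod_cast hm
    have h1 := hK m ((m : ℝ) ^ (-(2 + α) / (2 * Δ))) ((m : ℝ) ^ ((1 - p) / Δ)) hm
      (by positivity) (by positivity)
    have hm1 : (m : ℝ) = (m : ℝ) ^ (1 : ℝ) := (Real.rpow_one _).symm
    have hexp : ∀ a b : ℝ, ((m : ℝ) ^ (-(2 + α) / (2 * Δ))) ^ a * ((m : ℝ) ^ ((1 - p) / Δ)) ^ b * m
        = (m : ℝ) ^ (-(2 + α) / (2 * Δ) * a + (1 - p) / Δ * b + 1) := by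
      intro a b
      rw [← Real.rpow_mul hm0.le, ← Real.rpow_mul hm0.le, Real.rpow_add hm0, Real.rpow_add hm0,
        Real.rpow_one]
    have e1 : -(2 + α) / (2 * Δ) * (2 : ℕ) + (1 - p) / Δ * (2 - N) + 1 = 0 := by
      push_cast
      field_simp
      rw [hΔ]; ring
    have e2 : -(2 + α) / (2 * Δ) * (2 * p) + (1 - p) / Δ * (-(N + α)) + 1 = 0 := by
      field_simp
      rw [hΔ]; ring
    have e3 : -(2 + α) / (2 * Δ) * q + (1 - p) / Δ * (-N) + 1
        = (α + 2 * p - q * (2 + α) / 2) / Δ := by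
      field_simp
      rw [hΔ]; ring
    rw [← Real.rpow_natCast ((m : ℝ) ^ (-(2 + α) / (2 * Δ))), hexp, hexp, hexp, e1, e2, e3,
      Real.rpow_zero] at h1
    exact h1 le_rfl le_rfl
  have hend : 1 / 2 - (p - 1) / (α + 2 * p) = (2 + α) / (2 * (α + 2 * p)) := by
    field_simp
    ring
  rcases lt_trichotomy Δ 0 with hd | hd | hd
  · refine Or.inr ⟨?_, hneg hd.le, ?_⟩
    · rw [div_lt_div_iff₀ hp0 hNα]
      nlinarith [le_max_left ((N : ℝ) - 2) 0]
    · have h1 := hsplit hd.ne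
      rw [div_nonpos_iff] at h1
      rw [hend, ge_iff_le, div_le_div_iff₀ (by positivity) hq0]
      rcases h1 with h1 | h1 <;> linarith [h1.1, h1.2]
  -- When Δ = 0 both l → 0 and l → ∞ are allowed, so q is the Sobolev exponent, and the remaining
  -- inequality of (Q) holds with equality.
  · have hN2 : 0 < (N : ℝ) - 2 := by
      by_contra hc
      nlinarith
    have hq' : 1 / q = 1 / 2 - 1 / (N : ℝ) := le_antisymm (hneg hd.le) (hpos hd.ge)
    refine Or.inl ⟨?_, hq'.ge, ?_⟩
    · rw [max_eq_left hN2.le, ge_iff_le, div_le_div_iff₀ hNα hp0]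
      linarith
    · rw [hq', hend, div_sub_div _ _ two_ne_zero hN0.ne',
        div_le_div_iff₀ (by positivity) (by positivity)]
      nlinarith
  · refine Or.inl ⟨?_, hpos hd.le, ?_⟩
    · rw [ge_iff_le, div_le_div_iff₀ hNα hp0]
      rcases le_total ((N : ℝ) - 2) 0 with h | h
      · rw [max_eq_right h]; linarith
      · rw [max_eq_left h]; linarith
    · have h1 := hsplit hd.ne'
      rw [div_nonpos_iff] at h1
      rw [hend, div_le_div_iff₀ hq0 (by positivity)]
      rcases h1 with h1 | h1 <;> linarith [h1.1, h1.2]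

end Necessity

end CoulombSobolev

/-! ### Assembly of the final statement. -/

namespace CoulombSobolev

/-- The constant C may be zero, so C + 1 is inverted to obtain a positive constant on the left. -/
theorem inv_coe_add_one_mul_le {C : ℝ≥0} {X Y : ℝ≥0∞} (h : X ≤ C * Y) :
    (((C + 1)⁻¹ : ℝ≥0) : ℝ≥0∞) * X ≤ Y := by
  have hC : C + 1 ≠ 0 := by positivity
  rw [ENNReal.coe_inv hC, ENNReal.inv_mul_le_iff (by exact_mod_cast hC) ENNReal.coe_ne_top]
  refine h.trans (mul_le_mul' ?_ le_rfl)
  exact_mod_cast le_self_add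

/-- The strict upper bound on θ in dimension one is only the positivity of 1/q. -/
theorem lt_of_one_div_eq_of_dim_one {α p q θ : ℝ} (hα : 0 < α) (hp : 1 ≤ p) (hq : 1 ≤ q)
    (h : 1 / q = θ * (1 / 2 - 1 / 1) + (1 - θ) * ((1 + α) / (2 * 1 * p))) :
    θ < (1 + α) / (1 + α + p) := by
  have hp0 : 0 < p := by linarith
  have hq' : 0 < 1 / q := by positivity
  have h1 : 2 * p * (1 / q) = -θ * p + (1 - θ) * (1 + α) := by
    rw [h]; field_simp; ring
  have h2 : 0 < 2 * p * (1 / q) := by positivity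
  rw [lt_div_iff₀ (by positivity)]
  linarith

end CoulombSobolev

theorem mainTheorem1 (N : ℕ) (α : ℝ) (hα : 0 < α) (hαN : α < N) :
    (∀ p q : ℝ, 1 ≤ p → 1 ≤ q →
      -- the embedding holds exactly under (Q)
      (CoulombSobolev.ContinuouslyEmbedded N α p q ↔ CoulombSobolev.ConditionQ N α p q) ∧
      -- the interpolation estimate
      (CoulombSobolev.ConditionQ N α p q → α + N ≠ p * ((N : ℝ) - 2) →
        ∃ θ : ℝ,
          1 / q = θ * (1 / 2 - 1 / (N : ℝ)) + (1 - θ) * ((N + α) / (2 * N * p)) ∧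
          (2 ≤ N → α / (2 * p + α) ≤ θ ∧ θ ≤ 1) ∧
          (N = 1 → α / (2 * p + α) ≤ θ ∧ θ < (1 + α) / (1 + α + p)) ∧
          ∃ S : ℝ≥0, 0 < S ∧ ∀ u ∈ CoulombSobolev.coulombSobolevSpace N α p,
            S * (∫⁻ x, ‖u x‖ₑ ^ q) ^ (1 / q) ≤
              CoulombSobolev.dirichletEnergy u ^ (θ / 2) *
                CoulombSobolev.coulombEnergy α p u ^ ((1 - θ) / (2 * p)))) ∧
    -- the critical case `α + N = p (N - 2)`
    (3 ≤ N → ∃ C : ℝ≥0, 0 < C ∧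
      ∀ u ∈ CoulombSobolev.coulombSobolevSpace N α ((N + α) / ((N : ℝ) - 2)),
        C * ∫⁻ x, ‖u x‖ₑ ^ (2 * N / ((N : ℝ) - 2)) ≤
          CoulombSobolev.dirichletEnergy u ^ (α / (2 + α)) *
            CoulombSobolev.coulombEnergy α ((N + α) / ((N : ℝ) - 2)) u ^ (2 / (2 + α))) := by

  have hN0 : (0 : ℝ) < N := hα.trans hαN
  have : NeZero N := ⟨by rintro rfl; simp at hN0⟩
  refine ⟨fun p q hp hq => ⟨⟨fun h => h.conditionQ hα hαN hp hq,
    fun h => h.continuouslyEmbedded hα hαN hp hq⟩, fun hQ hne => ?_⟩, fun hN => ?_⟩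
  · obtain ⟨θ, hθ, h1, h2, C, hC⟩ :=
      CoulombSobolev.exists_interpolationBound_of_conditionQ hα hαN hp hq hQ hne
    refine ⟨θ, hθ, fun _ => ⟨h1, h2⟩, fun hN => ⟨h1, ?_⟩, (C + 1)⁻¹, by positivity,
      fun u hu => CoulombSobolev.inv_coe_add_one_mul_le (hC u hu)⟩
    rw [hN, Nat.cast_one] at hθ
    exact CoulombSobolev.lt_of_one_div_eq_of_dim_one hα hp hq hθ
  · have hN' : (3 : ℝ) ≤ N := by exact_mod_cast hN
    have hN2 : (0 : ℝ) < N - 2 := by linarith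
    have hp : 1 ≤ ((N : ℝ) + α) / (N - 2) := by
      rw [le_div_iff₀ hN2]; linarith
    -- At the critical p the endpoint exponent is the Sobolev exponent, so (iii) is the endpoint
    -- estimate itself.
    have he : 2 * (2 * (((N : ℝ) + α) / (N - 2)) + α) / (2 + α) = 2 * N / (N - 2) := by
      field_simp
      ring
    obtain ⟨C, hC⟩ := CoulombSobolev.exists_lintegral_le_endpoint hα hαN hp
    rw [he] at hC
    exact ⟨(C + 1)⁻¹, by positivity,
      fun u hu => CoulombSobolev.inv_coe_add_one_mul_le (hC u hu)⟩
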